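/- Let $d\ge 1$, $M=S^{d-1}\subset\mathbb R^d$ with surface measure $\sigma$, $e(t)=e^{2\pi i t}$, $\langle x\rangle=2+|x|$, $(\mathcal E g)(x)=\int_M e(x\cdot\xi)g(\xi)\,d\sigma(\xi)$, $(\mathcal E^*f)(\xi)=\int_{\mathbb R^d}e(-x\cdot\xi)f(x)\,dx$ for $\xi\in M$. Let $(\omega_j)_{j\in h\mathbb Z^d}$ be i.i.d., either centred Gaussian or symmetric Bernoulli ($\pm1$ with probability $1/2$), with product measure $\mathbf P$ and expectation $\mathbf E$, and let $V_\omega(x)=\sum_{j\in h\mathbb Z^d}\omega_jV(x)\mathbf 1_{[0,1)^d}((x-j)/h)$. Norms of $\mathcal E^*W\mathcal E$ are operator norms on $L^2(M)$. Below, $B(c,R)$ is the open ball with arbitrary center $c$; constants in $\lesssim$ depend only on $d$ and the law of $\omega_j$ (and on $\epsilon$ where indicated). *Chaining objects* ($R\ge1$, $0<h\le R$, $V\in L^\infty$ vanishing outside $B(c,R)$). Let $\Lambda\subset M$ be any finite set that is $1/R$-separated (distinct points have distance at least $1/R$) and such that each point of $M$ has distance at most $1/R$ to $\Lambda$. For $\tau\in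 B(0,10/R)\subset\mathbb R^d$ put $\eta^\tau=(\eta+\tau)/|\eta+\tau|$, and for $a\in\ell^2(\Lambda)$ put $(\mathcal E_\tau a)(u)=\sum_{\eta\in\Lambda}a_\eta e(u\cdot\eta^\tau)$ and $\|a\|_*=\sup_{|\tau|<10/R,\,|u|<R}|(\mathcal E_\tau a)(u)|$. Let $Z_0=\{0\}$ and, for $k\ge1$, let $Z_k$ be any set of least possible cardinality among the finite subsets of the unit ball of $\ell^2(\Lambda)$ such that each point of that unit ball is within $2^{-k}|\Lambda|^{1/2}$ of the set with respect to $\|\cdot\|_*$. Let $\mathcal F_k=\{z'-z:\ z\in Z_k,\ z'\in Z_{k+1},\ \|z'-z\|_*\le 2\cdot2^{-k}|\Lambda|^{1/2}\}$. For $b\in\mathcal F_k$, $b'\in\mathcal F_{k'}$, $y\in[0,1)^d$ and $\tau,\tau'\in B(0,10/R)$ let $$X_{b,b'}(y,\tau,\tau')=\sum_{j\in h\mathbb Z^d}\omega_j\sum_{i\in\mathbb Z^d:\ i+y\in j+[0,h)^d}\overline{V(i+y)\,\xi_i}\;\xi'_i,\qquad \xi_i=(\mathcal E_\tau b)(i+y-c),\quad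 \xi'_i=(\mathcal E_{\tau'}b')(i+y-c),$$ and let $m_{k,k'}=m_{k,k'}(y,\tau,\tau')=\max_{\mathcal F_k\times\mathcal F_{k'}}|X_{b,b'}|$. Let $d\mu(\tau)=R\,d\tau$ on $B(0,10/R)$, and $y\in[0,1)^d$ in all integrals. (0) For each $R\ge1$ such sets $\Lambda$ exist, and for each such $\Lambda$ such sets $Z_k$ exist. (1) For all such data and all $k,k'\ge0$, $$R^{d-1}\iiint\mathbf E\,m_{k,k'}\,dy\,d\mu(\tau)\,d\mu(\tau')\lesssim R^{1/2}(\ln\langle R\rangle)^{1/2}\langle h\rangle^{d/2}\|V\|_\infty ,$$ $$J_{k,k'}:=\int\Big(\iint\mathbf E\,m_{k,k'}^2\,d\mu(\tau)\,d\mu(\tau')\Big)^{1/2}dy\lesssim R^{1/2}(\ln\langle R\rangle)^{1/2}\langle h\rangle^{d/2}\|V\|_\infty .$$ Moreover, for each real sequence $\omega$ (with a constant depending only on $d$), $$\iiint m_{k,k'}\,dy\,d\mu(\tau)\,d\mu(\tau')\lesssim R\,2^{-k-k'}\|V\|_\infty\,\sup_j|\omega_j|,$$ the supremum being over those $j$ for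 which $j+[0,h)^d$ meets $B(c,R)$, and $$\iiint\mathbf E\,m_{k,k'}\,dy\,d\mu(\tau)\,d\mu(\tau')\lesssim R\,2^{-k-k'}\|V\|_\infty .$$ (2) For all such data, $$\mathbf E\|\mathcal E^*V_\omega\mathcal E\|\lesssim\sum_{k,k'\ge0}J_{k,k'}\lesssim R^{1/2}\langle h\rangle^{d/2}(\ln\langle R\rangle)^{5/2}\|V\|_\infty .$$ The bound $\mathbf E\|\mathcal E^*V_\omega\mathcal E\|\lesssim R^{1/2}\langle h\rangle^{d/2}(\ln\langle R\rangle)^{5/2}\|V\|_\infty$ holds for all $R\ge h>0$ and all $V\in L^\infty$ vanishing outside some ball $B(c,R)$. (3) For all $\epsilon>0$, $h>0$ and $V$ with $\langle x\rangle^{1/2+\epsilon}V\in L^\infty$, the operators $\mathcal E^*\mathbf 1_{B(0,r)}V_\omega\mathcal E$ converge, as $r\to\infty$, in $L^1(\mathbf P)$ with respect to the operator norm, to a random bounded operator on $L^2(M)$, denoted by $\mathcal E^*V_\omega\mathcal E$, and $$\mathbf E\|\mathcal E^*V_\omega\mathcal E\|\lesssim_\epsilon\langle h\rangle^{d/2}\,\|\langle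 x\rangle^{1/2+\epsilon}V\|_\infty .$$ -/

import Mathlib

open MeasureTheory ProbabilityTheory Filter Topology

namespace RandomExtension

noncomputable section

/-- Euclidean space `ℝ^d`. -/
abbrev Eu (d : ℕ) : Type := EuclideanSpace ℝ (Fin d)

/-- The unit sphere `M = S^{d-1}` in `ℝ^d`. -/
abbrev Sph (d : ℕ) : Type := Metric.sphere (0 : Eu d) 1

/-- The surface measure on the unit sphere. -/
def surf (d : ℕ) : Measure (Sph d) := (volume : Measure (Eu d)).toSphere

instance (d : ℕ) : IsFiniteMeasure (surf d) := by
  unfold surf; infer_instance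

/-- The Hilbert space `L²(M, dσ)`. -/
abbrev L2Sph (d : ℕ) : Type := Lp ℂ 2 (surf d)

/-- The plane wave `e(x·ξ) = exp(2πi x·ξ)`. -/
def wave {d : ℕ} (x ξ : Eu d) : ℂ :=
  Complex.exp (2 * (Real.pi : ℂ) * Complex.I * ((inner ℝ x ξ : ℝ) : ℂ))

/-- The Fourier extension operator `(𝓔 g)(x) = ∫_M e(x·ξ) g(ξ) dσ(ξ)`. -/
def extension {d : ℕ} (g : Sph d → ℂ) (x : Eu d) : ℂ :=
  ∫ ξ : Sph d, wave x (ξ : Eu d) * g ξ ∂(surf d)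

/-- The Fourier restriction operator `(𝓔^* f)(ξ) = ∫ e(-x·ξ) f(x) dx`, `ξ ∈ M`. -/
def restriction {d : ℕ} (f : Eu d → ℂ) (ξ : Sph d) : ℂ :=
  ∫ x : Eu d, wave (-x) (ξ : Eu d) * f x

section Operator

variable {d : ℕ}

theorem norm_wave (x ξ : Eu d) : ‖wave x ξ‖ = 1 := by
  have h : (2 * (Real.pi : ℂ) * Complex.I * ((inner ℝ x ξ : ℝ) : ℂ))
      = ((2 * Real.pi * inner ℝ x ξ : ℝ) : ℂ) * Complex.I := by
    push_cast; ring
  rw [wave, h, Complex.norm_exp_ofReal_mul_I]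

theorem continuous_wave : Continuous (fun p : Eu d × Eu d => wave p.1 p.2) := by
  unfold wave
  fun_prop

theorem continuous_wave_left (x : Eu d) : Continuous (fun ξ : Sph d => wave x (ξ : Eu d)) :=
  continuous_wave.comp (continuous_const.prodMk continuous_subtype_val)

theorem continuous_wave_right (ξ : Eu d) : Continuous (fun x : Eu d => wave x ξ) :=
  continuous_wave.comp (continuous_id.prodMk continuous_const)

theorem integrable_wave_mul {g : Sph d → ℂ} (hg : Integrable g (surf d)) (x : Eu d) :
    Integrable (fun ξ : Sph d => wave x (ξ : Eu d) * g ξ) (surf d) :=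
  hg.bdd_mul (continuous_wave_left x).aestronglyMeasurable (c := 1)
    (Eventually.of_forall fun _ => (norm_wave x _).le)

theorem integrable_wave_neg_mul {f : Eu d → ℂ} (hf : Integrable f) (ξ : Eu d) :
    Integrable (fun x : Eu d => wave (-x) ξ * f x) :=
  hf.bdd_mul ((continuous_wave_right ξ).comp continuous_neg).aestronglyMeasurable (c := 1)
    (Eventually.of_forall fun x => (norm_wave (-x) ξ).le)

theorem integrable_L2Sph (g : L2Sph d) : Integrable g (surf d) :=
  (Lp.memLp g).integrable (by norm_num)

theorem norm_extension_le (g : Sph d → ℂ) (x : Eu d) :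
    ‖extension g x‖ ≤ ∫ ξ, ‖g ξ‖ ∂(surf d) := by
  refine (norm_integral_le_integral_norm _).trans (le_of_eq ?_)
  simp [norm_wave]

theorem continuous_extension {g : Sph d → ℂ} (hg : Integrable g (surf d)) :
    Continuous (extension g) := by
  refine continuous_of_dominated (bound := fun ξ => ‖g ξ‖) (fun x => ?_) (fun x => ?_) hg.norm ?_
  · exact (integrable_wave_mul hg x).aestronglyMeasurable
  · exact Eventually.of_forall fun ξ => by simp [norm_wave]
  · exact Eventually.of_forall fun ξ => (continuous_wave_right _).mul continuous_const

theorem norm_restriction_le (f : Eu d → ℂ) (ξ : Sph d) :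
    ‖restriction f ξ‖ ≤ ∫ x, ‖f x‖ := by
  refine (norm_integral_le_integral_norm _).trans (le_of_eq ?_)
  simp [norm_wave]

theorem continuous_restriction {f : Eu d → ℂ} (hf : Integrable f) :
    Continuous (restriction f) := by
  refine continuous_of_dominated (bound := fun x => ‖f x‖) (fun ξ => ?_) (fun ξ => ?_) hf.norm ?_
  · exact (integrable_wave_neg_mul hf _).aestronglyMeasurable
  · exact Eventually.of_forall fun x => by simp [norm_wave]
  · exact Eventually.of_forall fun x => (continuous_wave_left _).mul continuous_const

theorem memLp_restriction {f : Eu d → ℂ} (hf : Integrable f) :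
    MemLp (restriction f) 2 (surf d) :=
  MemLp.of_bound (continuous_restriction hf).aestronglyMeasurable _
    (Eventually.of_forall (norm_restriction_le f))

theorem integrable_mul_extension {W : Eu d → ℂ} (hW : Integrable W) {g : Sph d → ℂ}
    (hg : Integrable g (surf d)) : Integrable (fun x => W x * extension g x) := by
  refine hW.mul_bdd (c := ∫ ξ, ‖g ξ‖ ∂(surf d)) (continuous_extension hg).aestronglyMeasurable ?_
  exact Eventually.of_forall (norm_extension_le g)

theorem extension_add {f g : Sph d → ℂ} (hf : Integrable f (surf d))
    (hg : Integrable g (surf d)) (x : Eu d) :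
    extension (f + g) x = extension f x + extension g x := by
  unfold extension
  rw [← integral_add (integrable_wave_mul hf x) (integrable_wave_mul hg x)]
  simp [mul_add]

theorem extension_smul (c : ℂ) (g : Sph d → ℂ) (x : Eu d) :
    extension (c • g) x = c * extension g x := by
  unfold extension
  rw [← integral_const_mul]
  congr 1; ext ξ; simp; ring

theorem extension_congr {f g : Sph d → ℂ} (h : f =ᵐ[surf d] g) : extension f = extension g := by
  ext x
  exact integral_congr_ae (h.mono fun ξ hξ => by simp [hξ])

theorem restriction_add {f g : Eu d → ℂ} (hf : Integrable f) (hg : Integrable g) (ξ : Sph d) :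
    restriction (f + g) ξ = restriction f ξ + restriction g ξ := by
  unfold restriction
  rw [← integral_add (integrable_wave_neg_mul hf ξ) (integrable_wave_neg_mul hg ξ)]
  simp [mul_add]

theorem restriction_smul (c : ℂ) (f : Eu d → ℂ) (ξ : Sph d) :
    restriction (c • f) ξ = c * restriction f ξ := by
  unfold restriction
  rw [← integral_const_mul]
  congr 1; ext x; simp; ring

theorem integral_norm_L2Sph_le (g : L2Sph d) :
    ∫ ξ, ‖g ξ‖ ∂(surf d) ≤ ((surf d Set.univ) ^ (1 / 2 : ℝ)).toReal * ‖g‖ := by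
  have h1 := eLpNorm_le_eLpNorm_mul_rpow_measure_univ (μ := surf d) (p := 1) (q := 2)
    (by norm_num) (Lp.aestronglyMeasurable g)
  rw [integral_norm_eq_lintegral_enorm (Lp.aestronglyMeasurable g),
    ← eLpNorm_one_eq_lintegral_enorm, Lp.norm_def, mul_comm, ← ENNReal.toReal_mul]
  refine ENNReal.toReal_mono ?_ (h1.trans (le_of_eq ?_))
  · exact ENNReal.mul_ne_top (Lp.eLpNorm_ne_top g)
      (ENNReal.rpow_ne_top_of_nonneg (by norm_num) (measure_ne_top _ _))
  · norm_num

/-- The operator `𝓔^* W 𝓔` on `L²(M)`, for integrable `W`. -/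
def sandwichOfIntegrable (W : Eu d → ℂ) (hW : Integrable W) : L2Sph d →L[ℂ] L2Sph d :=
  LinearMap.mkContinuous
    { toFun := fun g =>
        (memLp_restriction (integrable_mul_extension hW (integrable_L2Sph g))).toLp _
      map_add' := by
        intro f g
        rw [← MemLp.toLp_add]
        refine MemLp.toLp_congr _ _ (Eventually.of_forall fun ξ => ?_)
        rw [Pi.add_apply, ← restriction_add
          (integrable_mul_extension hW (integrable_L2Sph f))
          (integrable_mul_extension hW (integrable_L2Sph g)), extension_congr (Lp.coeFn_add f g)]
        congr 1; ext x
        rw [extension_add (integrable_L2Sph f) (integrable_L2Sph g)]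
        simp [mul_add]
      map_smul' := by
        intro c g
        rw [RingHom.id_apply, ← MemLp.toLp_const_smul]
        refine MemLp.toLp_congr _ _ (Eventually.of_forall fun ξ => ?_)
        rw [Pi.smul_apply, smul_eq_mul, ← restriction_smul, extension_congr (Lp.coeFn_smul c g)]
        congr 1; ext x
        rw [extension_smul]
        simp; ring }
    ((measureUnivNNReal (surf d) : ℝ) ^ ((2 : ENNReal).toReal⁻¹) *
      ((∫ x, ‖W x‖) * ((surf d Set.univ) ^ (1 / 2 : ℝ)).toReal))
    (by
      intro g
      rw [mul_assoc]
      refine Lp.norm_le_of_ae_bound (by positivity) ?_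
      refine (MemLp.coeFn_toLp
        (memLp_restriction (integrable_mul_extension hW (integrable_L2Sph g)))).mono fun ξ hξ => ?_
      simp only [LinearMap.coe_mk, AddHom.coe_mk]
      rw [hξ]
      refine (norm_restriction_le _ ξ).trans ?_
      have hle : ∀ x, ‖W x * extension g x‖ ≤
          ‖W x‖ * (((surf d Set.univ) ^ (1 / 2 : ℝ)).toReal * ‖g‖) := fun x => by
        rw [norm_mul]
        exact mul_le_mul_of_nonneg_left
          ((norm_extension_le _ x).trans (integral_norm_L2Sph_le g)) (norm_nonneg _)
      refine (integral_mono_of_nonneg (Eventually.of_forall fun x => norm_nonneg _)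
        (hW.norm.mul_const _) (Eventually.of_forall hle)).trans (le_of_eq ?_)
      rw [integral_mul_const, mul_assoc])

open Classical in
/-- The operator `𝓔^* W 𝓔` on `L²(M)`; it is only used for integrable `W`
(bounded with bounded support) and is set to be `0` otherwise. -/
def sandwich (W : Eu d → ℂ) : L2Sph d →L[ℂ] L2Sph d :=
  if hW : Integrable W then sandwichOfIntegrable W hW else 0

end Operator

/-! ### The Anderson randomization -/

/-- The index `n ∈ ℤ^d` of the unique cell `h n + [0,h)^d` that contains `x`. -/
def cell {d : ℕ} (h : ℝ) (x : Eu d) : Fin d → ℤ := fun i => ⌊x i / h⌋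

theorem cell_eq_iff {d : ℕ} {h : ℝ} (hh : 0 < h) (x : Eu d) (n : Fin d → ℤ) :
    cell h x = n ↔ ∀ i, (x i - h * n i) / h ∈ Set.Ico (0 : ℝ) 1 := by
  unfold cell
  rw [funext_iff]
  refine forall_congr' fun i => ?_
  rw [Int.floor_eq_iff, Set.mem_Ico, sub_div, mul_div_cancel_left₀ _ hh.ne']
  constructor <;> rintro ⟨h1, h2⟩ <;> constructor <;> linarith

/-- `V_w(x) = ∑_{n} w_n V(x) 1_{[0,1)^d}((x - h n)/h)`: exactly one summand is present, the one
of the cell of `x`. -/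
def anderson {d : ℕ} (h : ℝ) (w : (Fin d → ℤ) → ℝ) (V : Eu d → ℂ) (x : Eu d) : ℂ :=
  (w (cell h x) : ℂ) * V x

/-- The admissible laws of a single random variable: centred Gaussian, or symmetric Bernoulli
(the values `1` and `-1` with probability `1/2` each). -/
def IsNoiseLaw (μ : Measure ℝ) : Prop :=
  (∃ v : NNReal, μ = gaussianReal 0 v) ∨
    μ = (2⁻¹ : ENNReal) • (Measure.dirac 1 + Measure.dirac (-1))

/-- The probability space of the i.i.d. family `(ω_n)_{n ∈ ℤ^d}` with common law `μ`;
`ω_n` is the `n`-th coordinate. -/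
def noise (d : ℕ) (μ : Measure ℝ) : Measure ((Fin d → ℤ) → ℝ) :=
  Measure.infinitePi fun _ => μ

/-! ### Discretization and chaining -/

/-- `Λ` is a `1/R`-net of the sphere: a `1/R`-separated subset such that each point of the sphere
has distance at most `1/R` to it. -/
def IsSphereNet {d : ℕ} (R : ℝ) (Λ : Finset (Eu d)) : Prop :=
  (∀ η ∈ Λ, ‖η‖ = 1) ∧ (∀ η ∈ Λ, ∀ η' ∈ Λ, η ≠ η' → 1 / R ≤ dist η η') ∧
    ∀ ξ : Eu d, ‖ξ‖ = 1 → ∃ η ∈ Λ, dist ξ η ≤ 1 / R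

/-- The net point `η` moved along the sphere by `τ`, that is, `(η + τ) / |η + τ|`. -/
def shift {d : ℕ} (η τ : Eu d) : Eu d := ‖η + τ‖⁻¹ • (η + τ)

/-- The discrete extension operator of the shifted net:
`(𝓔_τ a)(u) = ∑_{η ∈ Λ} a_η e(u · shift η τ)`. -/
def discExt {d : ℕ} (Λ : Finset (Eu d)) (τ : Eu d) (a : EuclideanSpace ℂ Λ) (u : Eu d) : ℂ :=
  ∑ η : Λ, a η * wave u (shift (η : Eu d) τ)

/-- The sup norm of the discrete extensions of `a` on the ball of radius `R`, uniformly in the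
shift `τ ∈ B(0, 10/R)`. -/
def chainNorm {d : ℕ} (R : ℝ) (Λ : Finset (Eu d)) (a : EuclideanSpace ℂ Λ) : ENNReal :=
  ⨆ τ ∈ Metric.ball (0 : Eu d) (10 / R), ⨆ u ∈ Metric.ball (0 : Eu d) R, ‖discExt Λ τ a u‖ₑ

/-- The resolution `2^{-k} |Λ|^{1/2}` of the `k`-th step. Note `|Λ|^{1/2} ∼ R^{(d-1)/2}` for a
`1/R`-net with `R ≥ 1`, and that the chain norm on the unit ball of `ℓ²(Λ)` is at most
`|Λ|^{1/2}`. -/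
def chainScale {d : ℕ} (Λ : Finset (Eu d)) (k : ℕ) : ENNReal :=
  ENNReal.ofReal ((2 : ℝ)⁻¹ ^ k * Real.sqrt (Λ.card : ℝ))

/-- The centers `Z` lie in the unit ball of `ℓ²(Λ)`, and the balls of radius `2^{-k} |Λ|^{1/2}`
about them, in the chain norm, cover that unit ball. -/
def IsChainCover {d : ℕ} (R : ℝ) (Λ : Finset (Eu d)) (k : ℕ)
    (Z : Finset (EuclideanSpace ℂ Λ)) : Prop :=
  (∀ z ∈ Z, ‖z‖ ≤ 1) ∧
    ∀ a : EuclideanSpace ℂ Λ, ‖a‖ ≤ 1 → ∃ z ∈ Z, chainNorm R Λ (a - z) ≤ chainScale Λ k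

/-- A chain of covers: it starts at the origin, and the `k`-th cover has the least possible
number of centers. -/
def IsChain {d : ℕ} (R : ℝ) (Λ : Finset (Eu d)) (Z : ℕ → Finset (EuclideanSpace ℂ Λ)) : Prop :=
  Z 0 = {0} ∧ ∀ k, IsChainCover R Λ k (Z k) ∧
    ∀ Z' : Finset (EuclideanSpace ℂ Λ), IsChainCover R Λ k Z' → (Z k).card ≤ Z'.card

/-- The links `𝓕_k`: differences of centers of two consecutive covers that are close to each
other. -/
def links {d : ℕ} (R : ℝ) (Λ : Finset (Eu d)) (Z : ℕ → Finset (EuclideanSpace ℂ Λ)) (k : ℕ) :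
    Set (EuclideanSpace ℂ Λ) :=
  {b | ∃ z ∈ Z k, ∃ z' ∈ Z (k + 1), b = z' - z ∧ chainNorm R Λ b ≤ 2 * chainScale Λ k}

/-- The point `i` of the integer lattice, as a point of `ℝ^d`. -/
def latticePt {d : ℕ} (i : Fin d → ℤ) : Eu d := WithLp.toLp 2 fun j => (i j : ℝ)

/-- The unit cell `[0,1)^d`. -/
def unitCell (d : ℕ) : Set (Eu d) := {y | ∀ i, y i ∈ Set.Ico (0 : ℝ) 1}

/-- The chaining term
`X_{ξ,ξ'}(y,τ,τ') = ∑_n w_n ∑_{i : i + y ∈ h n + [0,h)^d} conj(V(i + y) ξ_i) ξ'_i`,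
where `i` runs through `ℤ^d` and `ξ_i = (𝓔_τ b)(i + y - c)`, `ξ'_i = (𝓔_{τ'} b')(i + y - c)`.
The two sums are merged into one. For `V` of bounded support the sum is finite. -/
def chainTerm {d : ℕ} (h : ℝ) (w : (Fin d → ℤ) → ℝ) (V : Eu d → ℂ) (c : Eu d)
    (Λ : Finset (Eu d)) (b b' : EuclideanSpace ℂ Λ) (y τ τ' : Eu d) : ℂ :=
  ∑' i : Fin d → ℤ,
    starRingEnd ℂ (anderson h w V (latticePt i + y) * discExt Λ τ b (latticePt i + y - c)) *
      discExt Λ τ' b' (latticePt i + y - c)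

/-- `max_{𝓕_k × 𝓕_{k'}} |X_{ξ,ξ'}(y,τ,τ')|`. -/
def maxTerm {d : ℕ} (R h : ℝ) (w : (Fin d → ℤ) → ℝ) (V : Eu d → ℂ) (c : Eu d)
    (Λ : Finset (Eu d)) (Z : ℕ → Finset (EuclideanSpace ℂ Λ)) (k k' : ℕ) (y τ τ' : Eu d) :
    ENNReal :=
  ⨆ b ∈ links R Λ Z k, ⨆ b' ∈ links R Λ Z k', ‖chainTerm h w V c Λ b b' y τ τ'‖ₑ

/-- The measure `R dτ` on `B(0, 10/R)`. The factor `R` is the inverse of the thickness of the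
ball in the direction normal to the sphere; the total mass is a multiple of `R^{-(d-1)}`. -/
def shiftMeasure (d : ℕ) (R : ℝ) : Measure (Eu d) :=
  ENNReal.ofReal R • (volume : Measure (Eu d)).restrict (Metric.ball 0 (10 / R))

end

end RandomExtension

/-! The quadratic form of `𝓔^* V_ω 𝓔` is linear in the noise, so its norm is the supremum of a
subgaussian process indexed by two functions on the sphere. The supremum is bounded by chaining in
both functions, with entropy numbers supplied by the dual Sudakov inequality.

Discretization. For a net point `η`, the direction of `η + τ` with `τ` uniform in a thin shell is
distributed according to the surface measure. With a partition of unity subordinate to the net, `𝓔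
g` near `c` becomes an average over `τ` of discrete extensions `𝓔_τ (A τ)`, and the mean square of
`‖A τ‖` against `shiftMeasure` is at most `‖g‖²` (`exists_extension_eq_integral_discExt`). Cutting
the space into lattice translates of the unit cell turns the quadratic form into an average of the
sums `chainTerm`.

Entropy. Polynomially many (in `R`) functionals of norm `|Λ|^{1/2}` determine the chain norm up to a
constant (`exists_norming_functionals`). A Gaussian vector is therefore of size `(|Λ| log R)^{1/2}`
in that norm, and dual Sudakov (`card_le_of_slab_separated`) covers the unit ball at resolution
`2^{-k} |Λ|^{1/2}` with log-cardinality of order at most `4^k log R`.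

Variance. In `∑ |ξ_i|² |ξ'_i|²` the link of higher order is estimated in the sup norm, of square `≲
4^{-max(k,k')} R^{d-1}`, and the other one in `ℓ²`, of square `≲ R^d` by the large sieve
(`exists_sum_sq_discExt_le`). Summation inside a noise cell costs the number of lattice points in
it, `(h+1)^d`. In the second moment of the maximum the entropy factor `4^{max(k,k')}` cancels
against the variance, leaving `R^{2d-1} log R ⟨h⟩^d` for all `k, k'`
(`exists_lintegral_maxTerm_sq_le`). The root of this, divided by `R^{d-1}` from the mass of
`shiftMeasure`, is `R^{1/2} (log R)^{1/2} ⟨h⟩^{d/2}`.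

Summation. Without any cancellation, the sup norm of both links bounds the same quantity by `R^d
2^{-k-k'}`. Hence only about `log R` values of each index matter, and the square of that number
times `(log R)^{1/2}` is the power `5/2` of the logarithm (`exists_tsum_chain_le`). For `R < 1` the
trivial bound by the `L¹` norm suffices. A potential that decays faster than `|x|^{-1/2}` is cut
into dyadic annuli, whose contributions form a convergent series (`exists_operator_of_decay`). -/

namespace RandomExtension

/-! ### Counting lattice points in boxes and in noise cells. -/

section Counting

variable {d : ℕ}

theorem card_Icc_ceil_floor_le {a b : ℝ} (hab : a ≤ b) :
    ((Finset.Icc ⌈a⌉ ⌊b⌋).card : ℝ) ≤ b - a + 1 := by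
  rw [Int.card_Icc]
  have h1 := Int.le_ceil a
  have h2 := Int.floor_le b
  rcases le_total 0 (⌊b⌋ + 1 - ⌈a⌉) with h | h
  · have h3 : (((⌊b⌋ + 1 - ⌈a⌉).toNat : ℤ) : ℝ) = ((⌊b⌋ + 1 - ⌈a⌉ : ℤ) : ℝ) := by
      rw [Int.toNat_of_nonneg h]
    push_cast at h3
    rw [h3]; linarith
  · rw [Int.toNat_of_nonpos h]; push_cast; linarith

/-- The lattice points `i` such that all coordinates of `i + v` are at most `R` in modulus. -/
noncomputable def latticeBox (R : ℝ) (v : Eu d) : Finset (Fin d → ℤ) :=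
  Fintype.piFinset fun j => Finset.Icc ⌈-R - v j⌉ ⌊R - v j⌋

theorem mem_latticeBox {R : ℝ} {v : Eu d} {i : Fin d → ℤ} (h : ‖latticePt i + v‖ ≤ R) :
    i ∈ latticeBox R v := by
  rw [latticeBox, Fintype.mem_piFinset]
  intro j
  have h1 := (PiLp.norm_apply_le (latticePt i + v) j).trans h
  have h2 : (latticePt i + v) j = i j + v j := rfl
  rw [h2, Real.norm_eq_abs, abs_le] at h1
  rw [Finset.mem_Icc, Int.ceil_le, Int.le_floor]
  constructor <;> linarith [h1.1, h1.2]

theorem card_latticeBox_le {R : ℝ} (hR : 0 ≤ R) (v : Eu d) :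
    ((latticeBox R v).card : ℝ) ≤ (2 * R + 1) ^ d := by
  rw [latticeBox, Fintype.card_piFinset]
  push_cast
  calc _ ≤ ∏ _j : Fin d, (2 * R + 1) := by
        refine Finset.prod_le_prod (fun _ _ => by positivity) fun j _ => ?_
        refine (card_Icc_ceil_floor_le (by linarith)).trans (by linarith)
    _ = _ := by simp

/-- An interval of length `h` contains at most `h + 1` translates of integers. This count is the
only source of the factor `⟨h⟩^{d/2}` in the final estimates. -/
theorem card_le_of_cell_eq {h : ℝ} (hh : 0 < h) (y : Eu d) (n : Fin d → ℤ)
    (S : Finset (Fin d → ℤ)) (hS : ∀ i ∈ S, cell h (latticePt i + y) = n) :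
    (S.card : ℝ) ≤ (h + 1) ^ d := by
  have hsub : S ⊆ Fintype.piFinset fun j => Finset.Icc ⌈h * n j - y j⌉ ⌊h * n j + h - y j⌋ := by
    intro i hi
    rw [Fintype.mem_piFinset]
    intro j
    have h1 := (cell_eq_iff hh _ n).1 (hS i hi) j
    have h2 : (latticePt i + y) j = i j + y j := rfl
    rw [h2, Set.mem_Ico, div_lt_one hh, le_div_iff₀ hh] at h1
    rw [Finset.mem_Icc, Int.ceil_le, Int.le_floor]
    constructor <;> linarith [h1.1, h1.2]
  calc (S.card : ℝ) ≤ ((Fintype.piFinset fun j =>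
        Finset.Icc ⌈h * n j - y j⌉ ⌊h * n j + h - y j⌋).card : ℝ) := by
        exact_mod_cast Finset.card_le_card hsub
    _ = ∏ j : Fin d, ((Finset.Icc ⌈h * n j - y j⌉ ⌊h * n j + h - y j⌋).card : ℝ) := by
        rw [Fintype.card_piFinset]; push_cast; rfl
    _ ≤ ∏ _j : Fin d, (h + 1) := by
        refine Finset.prod_le_prod (fun _ _ => by positivity) fun j _ => ?_
        refine (card_Icc_ceil_floor_le (by linarith)).trans (by linarith)
    _ = _ := by simp

end Counting

/-! ### Separated sets and nets on the sphere. -/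

section Separated

/-- If the finite subsets of `A` that are pairwise related have bounded cardinality, then one of
them is maximal. -/
theorem exists_maximal_pairwise {α : Type*} (A : Set α) (r : α → α → Prop)
    (hr : ∀ x y, r x y → r y x) (N : ℕ)
    (hN : ∀ S : Finset α, ↑S ⊆ A → (∀ x ∈ S, ∀ y ∈ S, x ≠ y → r x y) → S.card ≤ N) :
    ∃ S : Finset α, ↑S ⊆ A ∧ (∀ x ∈ S, ∀ y ∈ S, x ≠ y → r x y) ∧
      ∀ a ∈ A, a ∈ S ∨ ∃ s ∈ S, ¬ r a s := by
  classical
  let P : ℕ → Prop := fun n => ∃ S : Finset α, ↑S ⊆ A ∧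
    (∀ x ∈ S, ∀ y ∈ S, x ≠ y → r x y) ∧ S.card = n
  have hP0 : P 0 := ⟨∅, by simp, by simp, by simp⟩
  have hPN : ∀ n, P n → n ≤ N := by
    rintro n ⟨S, h1, h2, rfl⟩
    exact hN S h1 h2
  obtain ⟨S, h1, h2, h3⟩ := Nat.findGreatest_spec (P := P) (Nat.zero_le N) hP0
  refine ⟨S, h1, h2, fun a ha => ?_⟩
  by_contra! hcon
  obtain ⟨haS, har⟩ := hcon
  have hP : P (S.card + 1) := by
    refine ⟨insert a S, ?_, ?_, by simp [haS]⟩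
    · rw [Finset.coe_insert]; exact Set.insert_subset ha h1
    · intro x hx y hy hxy
      rw [Finset.mem_insert] at hx hy
      rcases hx with rfl | hx <;> rcases hy with rfl | hy
      · exact absurd rfl hxy
      · exact har y hy
      · exact hr _ _ (har x hx)
      · exact h2 x hx y hy hxy
  have := Nat.le_findGreatest (hPN _ hP) hP
  omega

variable {d : ℕ}

/-- Positive dimension matters for `r = 0`: in dimension zero the open ball is empty while `0 ^ 0 =
1`. -/
theorem volume_real_ball (hd : 1 ≤ d) (x : Eu d) {r : ℝ} (hr : 0 ≤ r) :
    (volume : Measure (Eu d)).real (Metric.ball x r) =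
      r ^ d * (volume : Measure (Eu d)).real (Metric.ball 0 1) := by
  have : Nonempty (Fin d) := ⟨⟨0, hd⟩⟩
  rw [Measure.real, Measure.addHaar_ball _ _ hr, ENNReal.toReal_mul, finrank_euclideanSpace,
    Fintype.card_fin, ENNReal.toReal_ofReal (by positivity), Measure.real]

theorem volume_real_ball_pos (x : Eu d) {r : ℝ} (hr : 0 < r) :
    0 < (volume : Measure (Eu d)).real (Metric.ball x r) :=
  ENNReal.toReal_pos (Metric.measure_ball_pos _ _ hr).ne' measure_ball_lt_top.ne

/-- Volume comparison: disjoint balls of radius `1/(2R)` about the points fit into a spherical shell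
of thickness `1/R`, whose volume is `O(1/R)`. -/
theorem card_le_of_sphere_separated (hd : 1 ≤ d) {R : ℝ} (hR : 1 ≤ R) (S : Finset (Eu d))
    (hS : ∀ η ∈ S, ‖η‖ = 1) (hsep : ∀ η ∈ S, ∀ η' ∈ S, η ≠ η' → 1 / R ≤ dist η η') :
    (S.card : ℝ) ≤ d * 4 ^ d * R ^ (d - 1) := by
  obtain ⟨e, rfl⟩ : ∃ e, d = e + 1 := ⟨d - 1, by omega⟩
  set s : ℝ := 1 / (2 * R) with hs
  have hs0 : 0 < s := by positivity
  have hs1 : s ≤ 1 / 2 := by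
    rw [hs, div_le_div_iff₀ (by positivity) (by norm_num)]; linarith
  set v := (volume : Measure (Eu (e + 1))).real (Metric.ball 0 1) with hv
  have hv0 : 0 < v := volume_real_ball_pos _ one_pos
  have hdisj : (↑S : Set (Eu (e + 1))).PairwiseDisjoint fun η => Metric.ball η s := by
    intro x hx y hy hxy
    refine Metric.ball_disjoint_ball ?_
    refine le_trans (le_of_eq ?_) (hsep x hx y hy hxy)
    rw [hs]; field_simp; norm_num
  have hsub : (⋃ η ∈ S, Metric.ball η s) ⊆
      Metric.ball (0 : Eu (e + 1)) (1 + s) \ Metric.ball 0 (1 - s) := by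
    intro x hx
    simp only [Set.mem_iUnion, exists_prop] at hx
    obtain ⟨η, hη, hx⟩ := hx
    have h1 := hS η hη
    rw [Metric.mem_ball, dist_eq_norm] at hx
    have h2 : ‖x‖ ≤ ‖x - η‖ + ‖η‖ := by simpa using norm_add_le (x - η) η
    have h3 : ‖η‖ ≤ ‖x‖ + ‖x - η‖ := by
      simpa using norm_sub_le x (x - η)
    simp only [Set.mem_sdiff, Metric.mem_ball, dist_zero_right, not_lt]
    constructor <;> linarith
  have h1 := measureReal_mono (μ := (volume : Measure (Eu (e + 1)))) hsub
    ((measure_mono Set.sdiff_subset).trans_lt measure_ball_lt_top).ne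
  rw [measureReal_sdiff (Metric.ball_subset_ball (by linarith)) Metric.isOpen_ball.measurableSet
      measure_ball_lt_top.ne,
    measureReal_biUnion_finset hdisj (fun _ _ => Metric.isOpen_ball.measurableSet)
      (fun _ _ => measure_ball_lt_top.ne)] at h1
  rw [Finset.sum_congr rfl fun η _ => volume_real_ball (Nat.le_add_left 1 e) η hs0.le,
    volume_real_ball (Nat.le_add_left 1 e) 0 (show 0 ≤ 1 + s by linarith),
    volume_real_ball (Nat.le_add_left 1 e) 0 (show 0 ≤ 1 - s by linarith), Finset.sum_const, nsmul_eq_mul,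
    ← sub_mul, ← mul_assoc] at h1
  have h2 := le_of_mul_le_mul_right h1 hv0
  -- Factoring the difference of powers exposes the thickness `2 * s`. This factor `s` lowers the
  -- exponent of `R` from `d` to `d - 1`.
  have h3 : (1 + s) ^ (e + 1) - (1 - s) ^ (e + 1) ≤ 2 * s * ((e + 1) * 2 ^ e) := by
    have hgeom := (Commute.all (1 + s) (1 - s)).mul_geom_sum₂ (e + 1)
    rw [← hgeom]
    have : ∑ i ∈ Finset.range (e + 1), (1 + s) ^ i * (1 - s) ^ (e + 1 - 1 - i)
        ≤ ∑ i ∈ Finset.range (e + 1), (2 : ℝ) ^ e := by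
      refine Finset.sum_le_sum fun i hi => ?_
      rw [Finset.mem_range] at hi
      calc (1 + s) ^ i * (1 - s) ^ (e + 1 - 1 - i) ≤ 2 ^ i * 1 := by
            refine mul_le_mul (pow_le_pow_left₀ (by linarith) (by linarith) _)
              (pow_le_one₀ (by linarith) (by linarith)) (pow_nonneg (by linarith) _) (by positivity)
        _ ≤ 2 ^ e := by
            rw [mul_one]; exact pow_le_pow_right₀ (by norm_num) (by omega)
    rw [Finset.sum_const, Finset.card_range, nsmul_eq_mul, Nat.cast_add_one] at this
    rw [show 1 + s - (1 - s) = 2 * s by ring]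
    exact mul_le_mul_of_nonneg_left this (by positivity)
  have h4 : (S.card : ℝ) * s ^ e ≤ 2 * ((e + 1) * 2 ^ e) := by
    have := h2.trans h3
    have h5 : (S.card : ℝ) * s ^ e * s ≤ 2 * ((e + 1) * 2 ^ e) * s := by
      calc _ = (S.card : ℝ) * s ^ (e + 1) := by ring
        _ ≤ _ := this
        _ = _ := by ring
    exact le_of_mul_le_mul_right h5 hs0
  have h6 : s ^ e * (2 * R) ^ e = 1 := by
    rw [← mul_pow, hs]; field_simp; simp
  calc (S.card : ℝ) = S.card * s ^ e * (2 * R) ^ e := by rw [mul_assoc, h6, mul_one]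
    _ ≤ 2 * ((e + 1) * 2 ^ e) * (2 * R) ^ e := by gcongr
    _ = (e + 1) * (2 * 2 ^ e * 2 ^ e) * R ^ e := by rw [mul_pow]; ring
    _ ≤ (e + 1) * 4 ^ (e + 1) * R ^ e := by
        gcongr
        rw [pow_succ, show (4 : ℝ) = 2 * 2 by norm_num, mul_pow]
        nlinarith [mul_pos (pow_pos (two_pos (α := ℝ)) e) (pow_pos (two_pos (α := ℝ)) e)]
    _ = _ := by push_cast; simp

theorem IsSphereNet.card_le (hd : 1 ≤ d) {R : ℝ} (hR : 1 ≤ R) {Λ : Finset (Eu d)}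
    (hΛ : IsSphereNet R Λ) : (Λ.card : ℝ) ≤ d * 4 ^ d * R ^ (d - 1) :=
  card_le_of_sphere_separated hd hR Λ hΛ.1 hΛ.2.1

theorem IsSphereNet.one_le_card (hd : 1 ≤ d) {R : ℝ} {Λ : Finset (Eu d)}
    (hΛ : IsSphereNet R Λ) : 1 ≤ Λ.card := by
  obtain ⟨η, hη, -⟩ := hΛ.2.2 (EuclideanSpace.single ⟨0, hd⟩ 1) (by simp)
  exact Finset.card_pos.2 ⟨η, hη⟩

/-- A maximal separated subset of the sphere is a net; the volume bound on separated subsets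
guarantees that a maximal one exists. -/
theorem exists_isSphereNet (hd : 1 ≤ d) {R : ℝ} (hR : 1 ≤ R) :
    ∃ Λ : Finset (Eu d), IsSphereNet R Λ := by
  obtain ⟨S, h1, h2, h3⟩ := exists_maximal_pairwise (Metric.sphere (0 : Eu d) 1)
    (fun η η' => 1 / R ≤ dist η η') (fun x y h => by rwa [dist_comm])
    ⌊(d * 4 ^ d * R ^ (d - 1) : ℝ)⌋₊ (fun S hS hsep => Nat.le_floor
      (card_le_of_sphere_separated hd hR S (fun η hη => by simpa using hS hη) hsep))
  refine ⟨S, fun η hη => by simpa using h1 hη, h2, fun ξ hξ => ?_⟩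
  rcases h3 ξ (by simpa using hξ) with h | ⟨s, hs, h⟩
  · exact ⟨ξ, h, by rw [dist_self]; positivity⟩
  · exact ⟨s, hs, (not_le.1 h).le⟩

end Separated

/-! ### Shifted nets and elementary bounds for the discrete extension. -/

section Shift

variable {d : ℕ}

theorem norm_shift_le (η τ : Eu d) : ‖shift η τ‖ ≤ 1 := by
  rw [shift, norm_smul, norm_inv, norm_norm]
  exact inv_mul_le_one

theorem norm_shift {η τ : Eu d} (h : η + τ ≠ 0) : ‖shift η τ‖ = 1 := by
  rw [shift, norm_smul, norm_inv, norm_norm, inv_mul_cancel₀ (norm_ne_zero_iff.2 h)]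

theorem measurable_shift (η : Eu d) : Measurable (shift η) := by
  unfold shift; fun_prop

/-- The chord between the directions of two vectors. -/
theorem norm_sub_direction_sq {x y : Eu d} (hx : x ≠ 0) (hy : y ≠ 0) :
    ‖x‖ * ‖y‖ * ‖‖x‖⁻¹ • x - ‖y‖⁻¹ • y‖ ^ 2 = ‖x - y‖ ^ 2 - (‖x‖ - ‖y‖) ^ 2 := by
  have hx' := norm_ne_zero_iff.2 hx
  have hy' := norm_ne_zero_iff.2 hy
  rw [norm_sub_sq_real, norm_sub_sq_real, norm_smul, norm_smul, norm_inv, norm_norm, norm_inv,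
    norm_norm, inv_mul_cancel₀ hx', inv_mul_cancel₀ hy', inner_smul_left, inner_smul_right]
  simp only [conj_trivial]
  field_simp
  ring

theorem norm_add_bounds {η τ : Eu d} (hη : ‖η‖ = 1) (hτ : ‖τ‖ ≤ 1 / 4) :
    3 / 4 ≤ ‖η + τ‖ ∧ ‖η + τ‖ ≤ 5 / 4 := by
  have h1 := norm_add_le η τ
  have h2 : ‖η‖ ≤ ‖η + τ‖ + ‖τ‖ := by simpa using norm_sub_le (η + τ) τ
  constructor <;> linarith

/-- The vectors `η + τ` stay away from the origin, where the radial projection is Lipschitz. This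
allows a finite grid of shifts to replace the supremum in the chain norm. -/
theorem norm_shift_sub_le {η τ τ' : Eu d} (hη : ‖η‖ = 1) (hτ : ‖τ‖ ≤ 1 / 4) (hτ' : ‖τ'‖ ≤ 1 / 4) :
    ‖shift η τ - shift η τ'‖ ≤ 2 * ‖τ - τ'‖ := by
  obtain ⟨h1, -⟩ := norm_add_bounds hη hτ
  obtain ⟨h2, -⟩ := norm_add_bounds hη hτ'
  have h3 := norm_sub_direction_sq (x := η + τ) (y := η + τ')
    (norm_pos_iff.1 (by linarith)) (norm_pos_iff.1 (by linarith))
  rw [add_sub_add_left_eq_sub] at h3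
  change _ * ‖shift η τ - shift η τ'‖ ^ 2 = _ at h3
  refine le_of_sq_le_sq ?_ (by positivity)
  have h4 : (1 / 4 : ℝ) ≤ ‖η + τ‖ * ‖η + τ'‖ := by nlinarith
  nlinarith [sq_nonneg ‖shift η τ - shift η τ'‖, sq_nonneg (‖η + τ‖ - ‖η + τ'‖)]

/-- A common small shift moves two points of the sphere to almost equal radii, so projecting back
loses only a constant. The shifted nets thus remain separated, as the large sieve requires. -/
theorem norm_sub_le_shift {η η' τ : Eu d} (hη : ‖η‖ = 1) (hη' : ‖η'‖ = 1) (hτ : ‖τ‖ ≤ 1 / 4) :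
    ‖η - η'‖ ≤ 2 * ‖shift η τ - shift η' τ‖ := by
  obtain ⟨h1, h1'⟩ := norm_add_bounds hη hτ
  obtain ⟨h2, h2'⟩ := norm_add_bounds hη' hτ
  have h3 := norm_sub_direction_sq (x := η + τ) (y := η' + τ)
    (norm_pos_iff.1 (by linarith)) (norm_pos_iff.1 (by linarith))
  rw [add_sub_add_right_eq_sub] at h3
  change _ * ‖shift η τ - shift η' τ‖ ^ 2 = _ at h3
  -- Because `η` and `η'` have equal norms, the radii differ only through the inner product with
  -- `τ`. The difference of radii is at most a third of the chord.
  have h4 : (‖η + τ‖ - ‖η' + τ‖) * (‖η + τ‖ + ‖η' + τ‖) = 2 * inner ℝ τ (η - η') := by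
    have : ‖η + τ‖ ^ 2 - ‖η' + τ‖ ^ 2 = 2 * inner ℝ τ (η - η') := by
      rw [norm_add_sq_real, norm_add_sq_real, hη, hη', inner_sub_right, real_inner_comm,
        real_inner_comm η']
      ring
    linarith
  have h5 := abs_real_inner_le_norm τ (η - η')
  have h6 : |‖η + τ‖ - ‖η' + τ‖| * (3 / 2) ≤ 2 * (1 / 4 * ‖η - η'‖) := by
    calc _ ≤ |‖η + τ‖ - ‖η' + τ‖| * (‖η + τ‖ + ‖η' + τ‖) := by gcongr; linarith
      _ = |(‖η + τ‖ - ‖η' + τ‖) * (‖η + τ‖ + ‖η' + τ‖)| := by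
          rw [abs_mul, abs_of_nonneg (a := ‖η + τ‖ + ‖η' + τ‖) (by positivity)]
      _ = 2 * |inner ℝ τ (η - η')| := by rw [h4, abs_mul]; norm_num
      _ ≤ 2 * (‖τ‖ * ‖η - η'‖) := by gcongr
      _ ≤ _ := by gcongr
  have h7 : (‖η + τ‖ - ‖η' + τ‖) ^ 2 ≤ (1 / 3 * ‖η - η'‖) ^ 2 := by
    rw [← sq_abs (‖η + τ‖ - ‖η' + τ‖)]
    refine pow_le_pow_left₀ (abs_nonneg _) (by linarith) 2
  have h8 : ‖η + τ‖ * ‖η' + τ‖ ≤ 25 / 16 := by nlinarith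
  refine le_of_sq_le_sq ?_ (by positivity)
  nlinarith [sq_nonneg ‖shift η τ - shift η' τ‖, sq_nonneg ‖η - η'‖]

theorem norm_coe_sum_le {Λ : Finset (Eu d)} (a : EuclideanSpace ℂ Λ) :
    ∑ η : Λ, ‖a η‖ ≤ Real.sqrt Λ.card * ‖a‖ := by
  have h' := Finset.sum_mul_sq_le_sq_mul_sq Finset.univ (fun _ : Λ => (1 : ℝ)) (fun η => ‖a η‖)
  simp only [one_mul, one_pow, Finset.sum_const, Finset.card_univ, Fintype.card_coe,
    nsmul_eq_mul, mul_one] at h'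
  rw [EuclideanSpace.norm_eq, ← Real.sqrt_mul (by positivity)]
  exact Real.le_sqrt_of_sq_le h'

theorem norm_discExt_le {Λ : Finset (Eu d)} (τ : Eu d) (a : EuclideanSpace ℂ Λ) (u : Eu d) :
    ‖discExt Λ τ a u‖ ≤ Real.sqrt Λ.card * ‖a‖ := by
  refine (norm_sum_le _ _).trans (le_trans (le_of_eq ?_) (norm_coe_sum_le a))
  simp [norm_wave]

theorem discExt_sub {Λ : Finset (Eu d)} (τ : Eu d) (a b : EuclideanSpace ℂ Λ) (u : Eu d) :
    discExt Λ τ (a - b) u = discExt Λ τ a u - discExt Λ τ b u := by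
  simp [discExt, sub_mul]

theorem discExt_add {Λ : Finset (Eu d)} (τ : Eu d) (a b : EuclideanSpace ℂ Λ) (u : Eu d) :
    discExt Λ τ (a + b) u = discExt Λ τ a u + discExt Λ τ b u := by
  simp [discExt, add_mul, Finset.sum_add_distrib]

theorem discExt_smul {Λ : Finset (Eu d)} (τ : Eu d) (t : ℂ) (a : EuclideanSpace ℂ Λ) (u : Eu d) :
    discExt Λ τ (t • a) u = t * discExt Λ τ a u := by
  simp [discExt, Finset.mul_sum, mul_assoc]

theorem chainNorm_le_ofReal_iff {R : ℝ} {Λ : Finset (Eu d)} {a : EuclideanSpace ℂ Λ} {s : ℝ}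
    (hs : 0 ≤ s) : chainNorm R Λ a ≤ ENNReal.ofReal s ↔
      ∀ τ, ‖τ‖ < 10 / R → ∀ u, ‖u‖ < R → ‖discExt Λ τ a u‖ ≤ s := by
  unfold chainNorm
  simp only [iSup_le_iff, Metric.mem_ball, dist_zero_right, ← ofReal_norm,
    ENNReal.ofReal_le_ofReal_iff hs]

theorem lintegral_shiftMeasure_one (hd : 1 ≤ d) {R : ℝ} (hR : 0 < R) :
    shiftMeasure d R Set.univ = ENNReal.ofReal
      (10 ^ d * (volume : Measure (Eu d)).real (Metric.ball 0 1) / R ^ (d - 1)) := by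
  have h : (volume : Measure (Eu d)) (Metric.ball 0 (10 / R)) =
      ENNReal.ofReal ((volume : Measure (Eu d)).real (Metric.ball 0 (10 / R))) :=
    (ENNReal.ofReal_toReal measure_ball_lt_top.ne).symm
  rw [shiftMeasure, Measure.smul_apply, Measure.restrict_apply_univ, smul_eq_mul, h,
    volume_real_ball hd _ (by positivity), ← ENNReal.ofReal_mul hR.le]
  congr 1
  obtain ⟨e, rfl⟩ : ∃ e, d = e + 1 := ⟨d - 1, by omega⟩
  rw [Nat.add_sub_cancel, div_pow]
  field_simp
  ring

end Shift

end RandomExtension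

namespace RandomExtension

/-! ### The dual Sudakov inequality via Gaussian measure. -/

section DualSudakov

theorem measurable_gaussDensity {E : Type*} [NormedAddCommGroup E] [MeasurableSpace E]
    [BorelSpace E] : Measurable fun x : E => ENNReal.ofReal (Real.exp (-‖x‖ ^ 2 / 2)) := by
  fun_prop

variable {E : Type*} [NormedAddCommGroup E] [InnerProductSpace ℝ E] [FiniteDimensional ℝ E]
  [MeasurableSpace E] [BorelSpace E]

/-- The unnormalized Gaussian measure `exp(-|x|²/2) dx`. -/
noncomputable def gaussMeasure (E : Type*) [NormedAddCommGroup E] [InnerProductSpace ℝ E]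
    [FiniteDimensional ℝ E] [MeasurableSpace E] [BorelSpace E] : Measure E :=
  (volume : Measure E).withDensity fun x => ENNReal.ofReal (Real.exp (-‖x‖ ^ 2 / 2))

theorem gaussMeasure_univ_ne_top : gaussMeasure E Set.univ ≠ ⊤ := by
  have h := GaussianFourier.integrable_cexp_neg_mul_sq_norm_add (V := E) (b := 1 / 2)
    (by norm_num) 0 0
  have h2 : Integrable fun x : E => Real.exp (-‖x‖ ^ 2 / 2) := by
    refine h.norm.congr (Eventually.of_forall fun x => ?_)
    simp only [Complex.norm_exp]
    congr 1
    simp [← Complex.ofReal_pow]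
    ring
  rw [gaussMeasure, withDensity_apply _ MeasurableSet.univ, Measure.restrict_univ]
  exact h2.lintegral_lt_top.ne

theorem gaussMeasure_univ_ne_zero : gaussMeasure E Set.univ ≠ 0 := by
  rw [gaussMeasure, withDensity_apply _ MeasurableSet.univ, Measure.restrict_univ]
  intro h
  rw [lintegral_eq_zero_iff measurable_gaussDensity] at h
  have h2 : (volume : Measure E) Set.univ = 0 := by
    have h3 : ∀ᵐ _x : E, False := h.mono fun x hx => by
      rw [Pi.zero_apply, ENNReal.ofReal_eq_zero] at hx
      exact absurd (Real.exp_pos _) hx.not_gt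
    simpa [ae_iff] using h3
  exact (isOpen_univ.measure_ne_zero (μ := (volume : Measure E)) Set.univ_nonempty) h2

/-- Completing the square identifies the exponentially tilted Gaussian with a translate, up to the
factor `exp(‖v‖²/2)`. -/
theorem lintegral_exp_inner_gaussMeasure (v : E) :
    ∫⁻ x, ENNReal.ofReal (Real.exp (inner ℝ x v)) ∂(gaussMeasure E) =
      ENNReal.ofReal (Real.exp (‖v‖ ^ 2 / 2)) * gaussMeasure E Set.univ := by
  rw [gaussMeasure, lintegral_withDensity_eq_lintegral_mul _ measurable_gaussDensity (by fun_prop),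
    withDensity_apply _ MeasurableSet.univ, Measure.restrict_univ,
    ← lintegral_const_mul _ measurable_gaussDensity,
    ← lintegral_sub_right_eq_self
      (fun x => ENNReal.ofReal (Real.exp (‖v‖ ^ 2 / 2)) *
        ENNReal.ofReal (Real.exp (-‖x‖ ^ 2 / 2))) v]
  refine lintegral_congr fun x => ?_
  rw [Pi.mul_apply, ← ENNReal.ofReal_mul (Real.exp_pos _).le,
    ← ENNReal.ofReal_mul (Real.exp_pos _).le, ← Real.exp_add, ← Real.exp_add,
    norm_sub_sq_real]
  congr 2
  ring

theorem gaussMeasure_halfspace_le {v : E} {A s : ℝ} (hA : 0 < A) (hv : ‖v‖ ≤ A) (hs : 0 ≤ s) :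
    gaussMeasure E {x | s < inner ℝ x v} ≤
      ENNReal.ofReal (Real.exp (-s ^ 2 / (2 * A ^ 2))) * gaussMeasure E Set.univ := by
  -- The optimal parameter in Chernoff's bound: it minimizes `-t s + t² A² / 2`.
  set t := s / A ^ 2 with ht
  have ht0 : 0 ≤ t := by positivity
  have h1 := lintegral_exp_inner_gaussMeasure (t • v)
  have h2 : ENNReal.ofReal (Real.exp (t * s)) * gaussMeasure E {x | s < inner ℝ x v} ≤
      ∫⁻ x, ENNReal.ofReal (Real.exp (inner ℝ x (t • v))) ∂(gaussMeasure E) := by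
    refine le_trans ?_ (mul_meas_ge_le_lintegral₀ (by fun_prop)
      (ENNReal.ofReal (Real.exp (t * s))))
    gcongr
    rw [inner_smul_right]
    exact fun hx => ENNReal.ofReal_le_ofReal
      (Real.exp_le_exp.2 (mul_le_mul_of_nonneg_left (le_of_lt hx) ht0))
  rw [h1, norm_smul, Real.norm_of_nonneg ht0] at h2
  have h3 : ENNReal.ofReal (Real.exp (-(t * s))) * ENNReal.ofReal (Real.exp (t * s)) = 1 := by
    rw [← ENNReal.ofReal_mul (Real.exp_pos _).le, ← Real.exp_add]; simp
  calc gaussMeasure E {x | s < inner ℝ x v}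
      = ENNReal.ofReal (Real.exp (-(t * s))) * (ENNReal.ofReal (Real.exp (t * s)) *
          gaussMeasure E {x | s < inner ℝ x v}) := by rw [← mul_assoc, h3, one_mul]
    _ ≤ ENNReal.ofReal (Real.exp (-(t * s))) *
          (ENNReal.ofReal (Real.exp ((t * ‖v‖) ^ 2 / 2)) * gaussMeasure E Set.univ) := by gcongr
    _ ≤ _ := by
        rw [← mul_assoc, ← ENNReal.ofReal_mul (Real.exp_pos _).le, ← Real.exp_add]
        gcongr
        have : (t * ‖v‖) ^ 2 ≤ (t * A) ^ 2 := by gcongr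
        have h4 : -s ^ 2 / (2 * A ^ 2) = -(t * s) + (t * A) ^ 2 / 2 := by
          rw [ht]; field_simp; ring
        rw [h4]; linarith

/-- A union bound: at height `A * √(2L)` each half-space has relative mass at most `exp(-L)`, and
there are two per functional, so the complement of the slabs has at most half of the mass. -/
theorem gaussMeasure_slabs_ge (P : Finset E) {A L : ℝ} (hA : 0 < A) (hL : 0 ≤ L)
    (hP : ∀ v ∈ P, ‖v‖ ≤ A) (hcard : 4 * (P.card : ℝ) ≤ Real.exp L) :
    gaussMeasure E Set.univ ≤
      2 * gaussMeasure E {x | ∀ v ∈ P, |inner ℝ x v| ≤ A * Real.sqrt (2 * L)} := by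
  set s := A * Real.sqrt (2 * L) with hs
  have hs0 : 0 ≤ s := by positivity
  have hexp : -s ^ 2 / (2 * A ^ 2) = -L := by
    rw [hs, mul_pow, Real.sq_sqrt (by positivity)]; field_simp
  set K := {x : E | ∀ v ∈ P, |inner ℝ x v| ≤ s} with hK
  have hKm : MeasurableSet K := by
    have : K = ⋂ v ∈ P, {x : E | |inner ℝ x v| ≤ s} := by ext; simp [hK]
    rw [this]
    refine Finset.measurableSet_biInter _ fun v _ => measurableSet_le (by fun_prop) (by fun_prop)
  set Z := gaussMeasure E Set.univ with hZ
  have hc : gaussMeasure E Kᶜ ≤ 2⁻¹ * Z := by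
    calc gaussMeasure E Kᶜ
        ≤ gaussMeasure E (⋃ v ∈ P, ({x | s < inner ℝ x v} ∪ {x | s < inner ℝ x (-v)})) := by
          refine measure_mono fun x hx => ?_
          simp only [hK, Set.mem_compl_iff, Set.mem_ofPred_eq, not_forall, not_le] at hx
          obtain ⟨v, hv, hx⟩ := hx
          simp only [Set.mem_iUnion, Set.mem_union, Set.mem_ofPred_eq, inner_neg_right, exists_prop]
          exact ⟨v, hv, lt_abs.1 hx⟩
      _ ≤ ∑ v ∈ P, gaussMeasure E ({x | s < inner ℝ x v} ∪ {x | s < inner ℝ x (-v)}) :=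
          measure_biUnion_finset_le _ _
      _ ≤ ∑ _v ∈ P, 2 * (ENNReal.ofReal (Real.exp (-L)) * Z) := by
          refine Finset.sum_le_sum fun v hv => (measure_union_le _ _).trans ?_
          rw [two_mul, ← hexp]
          exact add_le_add (gaussMeasure_halfspace_le hA (hP v hv) hs0)
            (gaussMeasure_halfspace_le hA (by rw [norm_neg]; exact hP v hv) hs0)
      _ = ENNReal.ofReal (P.card * 2 * Real.exp (-L)) * Z := by
          rw [Finset.sum_const, nsmul_eq_mul, ENNReal.ofReal_mul (by positivity),
            ENNReal.ofReal_mul (by positivity), ENNReal.ofReal_natCast,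
            ENNReal.ofReal_ofNat]
          ring
      _ ≤ ENNReal.ofReal (2⁻¹) * Z := by
          gcongr
          rw [Real.exp_neg]
          have := Real.exp_pos L
          rw [mul_inv_le_iff₀ this]
          linarith
      _ = _ := by rw [ENNReal.ofReal_inv_of_pos two_pos, ENNReal.ofReal_ofNat]
  have hadd := measure_add_measure_compl (μ := gaussMeasure E) hKm
  have hfin : 2⁻¹ * Z ≠ ⊤ := ENNReal.mul_ne_top (by simp) gaussMeasure_univ_ne_top
  have h1 : 2⁻¹ * Z + 2⁻¹ * Z ≤ gaussMeasure E K + 2⁻¹ * Z := by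
    calc _ = Z := by rw [← add_mul, ENNReal.inv_two_add_inv_two, one_mul]
      _ = _ := hadd.symm
      _ ≤ _ := by gcongr
  have h2 := (ENNReal.add_le_add_iff_right hfin).1 h1
  calc Z = 2 * (2⁻¹ * Z) := by
        rw [← mul_assoc, ENNReal.mul_inv_cancel (by simp) (by simp), one_mul]
    _ ≤ _ := by gcongr

/-- The translate has relative density `exp(-‖v‖²/2) exp(-⟨x, v⟩)` on `K`. By symmetry the second
exponential may be replaced by `cosh ⟨x, v⟩ ≥ 1`. -/
theorem gaussMeasure_translate_ge {K : Set E} (hK : MeasurableSet K) (hsymm : ∀ x ∈ K, -x ∈ K)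
    (v : E) : ENNReal.ofReal (Real.exp (-‖v‖ ^ 2 / 2)) * gaussMeasure E K ≤
      gaussMeasure E ((fun x => x - v) ⁻¹' K) := by
  have hneg : (fun x : E => -x) ⁻¹' K = K := by
    ext x
    exact ⟨fun h => by simpa using hsymm _ h, fun h => hsymm _ h⟩
  have key : ∀ f : E → ENNReal, Measurable f →
      ∫⁻ x in K, f x ∂volume = ∫⁻ x in K, f (-x) ∂volume := by
    intro f hf
    rw [← lintegral_indicator hK, ← lintegral_indicator hK,
      ← lintegral_neg_eq_self (μ := (volume : Measure E))]
    refine lintegral_congr fun x => ?_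
    simp only [Set.indicator]
    congr 1
    exact propext (Set.ext_iff.1 hneg x)
  have hm : MeasurableSet ((fun x => x - v) ⁻¹' K) := hK.preimage (by fun_prop)
  have h1 : gaussMeasure E ((fun x => x - v) ⁻¹' K) =
      ∫⁻ x in K, ENNReal.ofReal (Real.exp (-‖x + v‖ ^ 2 / 2)) := by
    rw [gaussMeasure, withDensity_apply _ hm, ← lintegral_indicator hm, ← lintegral_indicator hK,
      ← lintegral_add_right_eq_self _ v]
    refine lintegral_congr fun x => ?_
    have hx : x + v ∈ (fun x => x - v) ⁻¹' K ↔ x ∈ K := by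
      rw [Set.mem_preimage, add_sub_cancel_right]
    by_cases h : x ∈ K
    · rw [Set.indicator_of_mem h, Set.indicator_of_mem (hx.2 h)]
    · rw [Set.indicator_of_notMem h, Set.indicator_of_notMem (fun h' => h (hx.1 h'))]
  have h2 : gaussMeasure E ((fun x => x - v) ⁻¹' K) =
      ∫⁻ x in K, ENNReal.ofReal (Real.exp (-‖-x + v‖ ^ 2 / 2)) := by
    rw [h1]; exact key _ (by fun_prop)
  -- The expressions `h1` and `h2` for the same mass are added. Their integrands carry reciprocal
  -- exponentials, whose sum is at least `2`.
  have h3 : 2 * (ENNReal.ofReal (Real.exp (-‖v‖ ^ 2 / 2)) * gaussMeasure E K) ≤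
      2 * gaussMeasure E ((fun x => x - v) ⁻¹' K) := by
    nth_rewrite 2 [two_mul]
    nth_rewrite 1 [h1]
    rw [h2, ← lintegral_add_left (by fun_prop), gaussMeasure, withDensity_apply _ hK,
      ← lintegral_const_mul _ (by fun_prop), ← lintegral_const_mul _ (by fun_prop)]
    refine lintegral_mono fun x => ?_
    rw [← ENNReal.ofReal_mul (Real.exp_pos _).le, ← ENNReal.ofReal_add (Real.exp_pos _).le
      (Real.exp_pos _).le, ← ENNReal.ofReal_ofNat, ← ENNReal.ofReal_mul zero_le_two]
    refine ENNReal.ofReal_le_ofReal ?_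
    have e1 : -‖x + v‖ ^ 2 / 2 = -‖v‖ ^ 2 / 2 + -‖x‖ ^ 2 / 2 - inner ℝ x v := by
      rw [norm_add_sq_real]; ring
    have e2 : -‖-x + v‖ ^ 2 / 2 = -‖v‖ ^ 2 / 2 + -‖x‖ ^ 2 / 2 + inner ℝ x v := by
      rw [norm_add_sq_real, inner_neg_left, norm_neg]; ring
    rw [e1, e2, ← Real.exp_add, Real.exp_sub, Real.exp_add _ (inner ℝ x v)]
    set t := Real.exp (inner ℝ x v) with ht
    have ht0 : 0 < t := Real.exp_pos _
    have h5 : 2 ≤ t⁻¹ + t := by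
      have : t⁻¹ + t - 2 = (t - 1) ^ 2 / t := by field_simp; ring
      have h6 : 0 ≤ (t - 1) ^ 2 / t := by positivity
      linarith
    have := mul_le_mul_of_nonneg_left h5 (Real.exp_pos (-‖v‖ ^ 2 / 2 + -‖x‖ ^ 2 / 2)).le
    simp only [div_eq_mul_inv] at this ⊢
    rw [← mul_add, mul_comm 2]
    exact this
  exact (ENNReal.mul_le_mul_iff_right (by simp) (by simp)).1 h3

/-- The dual Sudakov inequality, for a seminorm that is a maximum of finitely many functionals. -/
theorem card_le_of_slab_separated (P : Finset E) {A L ρ : ℝ} (hA : 0 < A) (hL : 0 ≤ L)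
    (hP : ∀ v ∈ P, ‖v‖ ≤ A) (hcard : 4 * (P.card : ℝ) ≤ Real.exp L) (hρ : 0 ≤ ρ)
    (S : Finset E) (hS : ∀ z ∈ S, ‖z‖ ≤ 1)
    (hsep : ∀ z ∈ S, ∀ z' ∈ S, z ≠ z' →
      ∃ v ∈ P, 2 * (A * Real.sqrt (2 * L)) < ρ * |inner ℝ (z - z') v|) :
    (S.card : ℝ) ≤ 2 * Real.exp (ρ ^ 2 / 2) := by
  set s := A * Real.sqrt (2 * L) with hs
  set K := {x : E | ∀ v ∈ P, |inner ℝ x v| ≤ s} with hK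
  have hKm : MeasurableSet K := by
    have : K = ⋂ v ∈ P, {x : E | |inner ℝ x v| ≤ s} := by ext; simp [hK]
    rw [this]
    refine Finset.measurableSet_biInter _ fun v _ => measurableSet_le (by fun_prop) (by fun_prop)
  have hsymm : ∀ x ∈ K, -x ∈ K := fun x hx v hv => by
    rw [inner_neg_left, abs_neg]; exact hx v hv
  set Z := gaussMeasure E Set.univ with hZ
  have hZK : Z ≤ 2 * gaussMeasure E K := gaussMeasure_slabs_ge P hA hL hP hcard
  -- A common point of two translates would bound every functional of `ρ (z - z')` by twice the slab
  -- height. The translates are therefore disjoint, and each has at least `exp(-ρ²/2)` times the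
  -- mass of `K`, which is at least half of the total.
  have hdisj : (↑S : Set E).PairwiseDisjoint fun z => (fun x => x - ρ • z) ⁻¹' K := by
    intro z hz z' hz' hne
    rw [Function.onFun, Set.disjoint_left]
    intro x hx hx'
    obtain ⟨v, hv, hlt⟩ := hsep z hz z' hz' hne
    have h1 := hx v hv
    have h2 := hx' v hv
    have h3 : ρ * inner ℝ (z - z') v = inner ℝ (x - ρ • z') v - inner ℝ (x - ρ • z) v := by
      simp only [inner_sub_left, inner_smul_left, conj_trivial]; ring
    have h4 : ρ * |inner ℝ (z - z') v| ≤ s + s := by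
      rw [← abs_of_nonneg hρ, ← abs_mul, h3]
      exact (abs_sub _ _).trans (add_le_add h2 h1)
    linarith
  have h1 : (S.card : ENNReal) * (ENNReal.ofReal (Real.exp (-ρ ^ 2 / 2)) * gaussMeasure E K) ≤
      Z := by
    calc _ = ∑ _z ∈ S, ENNReal.ofReal (Real.exp (-ρ ^ 2 / 2)) * gaussMeasure E K := by
          rw [Finset.sum_const, nsmul_eq_mul]
      _ ≤ ∑ z ∈ S, gaussMeasure E ((fun x => x - ρ • z) ⁻¹' K) := by
          refine Finset.sum_le_sum fun z hz => ?_
          refine le_trans ?_ (gaussMeasure_translate_ge hKm hsymm (ρ • z))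
          gcongr
          rw [norm_smul, Real.norm_of_nonneg hρ]
          exact mul_le_of_le_one_right hρ (hS z hz)
      _ = gaussMeasure E (⋃ z ∈ S, (fun x => x - ρ • z) ⁻¹' K) := by
          rw [measure_biUnion_finset hdisj fun z _ => hKm.preimage (by fun_prop)]
      _ ≤ Z := measure_mono (Set.subset_univ _)
  have hZ0 : Z ≠ 0 := gaussMeasure_univ_ne_zero
  have hZt : Z ≠ ⊤ := gaussMeasure_univ_ne_top
  have hKt : gaussMeasure E K ≠ ⊤ := measure_ne_top_of_subset (Set.subset_univ _) hZt
  have hK0 : gaussMeasure E K ≠ 0 := by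
    intro h; rw [h, mul_zero, nonpos_iff_eq_zero] at hZK; exact hZ0 hZK
  have h2 := ENNReal.toReal_mono (ENNReal.mul_ne_top (by simp) hKt) (h1.trans hZK)
  rw [ENNReal.toReal_mul, ENNReal.toReal_mul, ENNReal.toReal_mul, ENNReal.toReal_natCast,
    ENNReal.toReal_ofReal (Real.exp_pos _).le, ENNReal.toReal_ofNat, ← mul_assoc] at h2
  have h3 := le_of_mul_le_mul_right h2 (ENNReal.toReal_pos hK0 hKt)
  rw [neg_div, Real.exp_neg, mul_inv_le_iff₀ (Real.exp_pos _)] at h3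
  exact h3

end DualSudakov

end RandomExtension

namespace RandomExtension

/-! ### Covering numbers of the unit ball in the chain norm. -/

section Entropy

variable {d : ℕ}

theorem one_le_log {R : ℝ} (hR : 1 ≤ R) : 1 ≤ Real.log (2 + R) := by
  rw [Real.le_log_iff_exp_le (by linarith)]
  linarith [Real.exp_one_lt_d9]

/-- Converts polynomial cardinalities to the form `exp(C log(2 + R))`; the constant `K` is absorbed
because `log(2 + R) ≥ 1`. -/
theorem mul_pow_le_exp_log {K R : ℝ} (hK : 1 ≤ K) (hR : 1 ≤ R) (m : ℕ) :
    K * R ^ m ≤ Real.exp ((Real.log K + m) * Real.log (2 + R)) := by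
  have hl := one_le_log hR
  rw [add_mul, Real.exp_add]
  have h1 : K ≤ Real.exp (Real.log K * Real.log (2 + R)) := by
    calc K = Real.exp (Real.log K) := (Real.exp_log (by linarith)).symm
      _ ≤ _ := Real.exp_le_exp.2 (le_mul_of_one_le_right (Real.log_nonneg hK) hl)
  have h2 : R ^ m ≤ Real.exp (m * Real.log (2 + R)) := by
    rw [mul_comm, Real.exp_mul, Real.exp_log (by linarith), Real.rpow_natCast]
    gcongr; linarith
  gcongr

theorem exists_grid (hd : 1 ≤ d) {ρ ε : ℝ} (hρ : 0 ≤ ρ) (hε : 0 < ε) :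
    ∃ G : Finset (Eu d), (G.card : ℝ) ≤ (2 * d * ρ / ε + 5) ^ d ∧
      ∀ u : Eu d, ‖u‖ ≤ ρ → ∃ g ∈ G, ‖u - g‖ ≤ ε := by
  classical
  have hd0 : (1 : ℝ) ≤ d := by exact_mod_cast hd
  -- Rounding each coordinate to mesh `ε / d` gives an error of at most `√d * s ≤ ε` without square
  -- roots in the cardinality.
  set s : ℝ := ε / d with hs
  have hs0 : 0 < s := by positivity
  set m : ℕ := ⌈ρ / s⌉₊ + 1 with hm
  have hm1 : ρ / s + 1 ≤ m := by rw [hm]; push_cast; linarith [Nat.le_ceil (ρ / s)]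
  have hm2 : (m : ℝ) ≤ ρ / s + 2 := by
    rw [hm]; push_cast; linarith [Nat.ceil_lt_add_one (a := ρ / s) (by positivity)]
  refine ⟨(Fintype.piFinset fun _ : Fin d => Finset.Icc (-(m : ℤ)) m).image
    (fun i => s • latticePt i), ?_, fun u hu => ?_⟩
  · calc _ ≤ ((Fintype.piFinset fun _ : Fin d => Finset.Icc (-(m : ℤ)) m).card : ℝ) := by
          exact_mod_cast Finset.card_image_le
      _ = (2 * m + 1 : ℝ) ^ d := by
          rw [Fintype.card_piFinset, Finset.prod_const, Int.card_Icc, Finset.card_univ,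
            Fintype.card_fin]
          have : ((m : ℤ) + 1 - -(m : ℤ)).toNat = 2 * m + 1 := by omega
          rw [this]; push_cast; rfl
      _ ≤ _ := by
          have : 2 * d * ρ / ε = 2 * (ρ / s) := by rw [hs]; field_simp
          rw [this]
          exact pow_le_pow_left₀ (by positivity) (by linarith) d
  · refine ⟨s • latticePt fun j => ⌊u j / s⌋, Finset.mem_image_of_mem _ ?_, ?_⟩
    · rw [Fintype.mem_piFinset]
      intro j
      have h1 := (PiLp.norm_apply_le u j).trans hu
      rw [Real.norm_eq_abs, abs_le] at h1
      have h2 : u j / s ≤ ρ / s := by gcongr; exact h1.2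
      have h3 : -(ρ / s) ≤ u j / s := by rw [← neg_div]; gcongr; exact h1.1
      rw [Finset.mem_Icc, Int.le_floor]
      refine ⟨by push_cast; linarith, ?_⟩
      have h4 : ((⌊u j / s⌋ : ℤ) : ℝ) ≤ ((m : ℤ) : ℝ) := by
        push_cast
        linarith [Int.floor_le (u j / s)]
      exact_mod_cast h4
    · rw [EuclideanSpace.norm_eq]
      refine Real.sqrt_le_iff.2 ⟨hε.le, ?_⟩
      calc _ ≤ ∑ _j : Fin d, s ^ 2 := by
            refine Finset.sum_le_sum fun j _ => ?_
            have h1 : (u - s • latticePt fun j => ⌊u j / s⌋) j = u j - s * ⌊u j / s⌋ := rfl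
            have h2 := Int.floor_le (u j / s)
            have h3 := Int.lt_floor_add_one (u j / s)
            rw [le_div_iff₀ hs0] at h2
            rw [div_lt_iff₀ hs0] at h3
            rw [h1, Real.norm_eq_abs]
            refine pow_le_pow_left₀ (abs_nonneg _) (abs_le.2 ⟨?_, ?_⟩) 2 <;> linarith
        _ = d * s ^ 2 := by simp
        _ ≤ ε ^ 2 := by
            have : ε = d * s := by rw [hs]; field_simp
            rw [this, mul_pow]
            gcongr
            nlinarith

theorem wave_add (x y ξ : Eu d) : wave (x + y) ξ = wave x ξ * wave y ξ := by
  rw [wave, wave, wave, ← Complex.exp_add, inner_add_left]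
  push_cast; ring_nf

theorem wave_neg (x ξ : Eu d) : wave (-x) ξ = starRingEnd ℂ (wave x ξ) := by
  rw [wave, wave, ← Complex.exp_conj, inner_neg_left]
  congr 1
  simp [Complex.conj_ofNat]

theorem norm_wave_sub_le (u u' ζ ζ' : Eu d) :
    ‖wave u ζ - wave u' ζ'‖ ≤ 2 * Real.pi * |inner ℝ u ζ - inner ℝ u' ζ'| := by
  have h : wave u ζ - wave u' ζ' = wave u' ζ' * (Complex.exp (Complex.I *
      ((2 * Real.pi * (inner ℝ u ζ - inner ℝ u' ζ') : ℝ) : ℂ)) - 1) := by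
    rw [mul_sub, mul_one, wave, wave, ← Complex.exp_add]
    congr 2
    push_cast; ring
  rw [h, norm_mul, norm_wave, one_mul]
  refine Real.norm_exp_I_mul_ofReal_sub_one_le.trans (le_of_eq ?_)
  rw [Real.norm_eq_abs, abs_mul, abs_of_pos (by positivity)]

/-- The vector that represents the functional `a ↦ (𝓔_τ a)(u)`. -/
noncomputable def planeVec (Λ : Finset (Eu d)) (τ u : Eu d) : EuclideanSpace ℂ Λ :=
  WithLp.toLp 2 fun η => starRingEnd ℂ (wave u (shift (η : Eu d) τ))

theorem inner_planeVec {Λ : Finset (Eu d)} (τ u : Eu d) (a : EuclideanSpace ℂ Λ) :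
    inner ℝ a (planeVec Λ τ u) = (discExt Λ τ a u).re := by
  rw [PiLp.inner_apply, discExt, Complex.re_sum]
  refine Finset.sum_congr rfl fun η _ => ?_
  rw [planeVec, Complex.inner, ← map_mul, Complex.conj_re, mul_comm]

theorem inner_I_smul_planeVec {Λ : Finset (Eu d)} (τ u : Eu d) (a : EuclideanSpace ℂ Λ) :
    inner ℝ a (Complex.I • planeVec Λ τ u) = (discExt Λ τ a u).im := by
  rw [PiLp.inner_apply, discExt, Complex.im_sum]
  refine Finset.sum_congr rfl fun η _ => ?_
  rw [PiLp.smul_apply, planeVec, Complex.inner, smul_eq_mul, mul_assoc, ← map_mul, Complex.I_mul_re,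
    Complex.conj_im, neg_neg, mul_comm]

theorem norm_planeVec {Λ : Finset (Eu d)} (τ u : Eu d) :
    ‖planeVec Λ τ u‖ = Real.sqrt Λ.card := by
  rw [EuclideanSpace.norm_eq]
  simp [planeVec, norm_wave]

theorem norm_discExt_le_of_inner {Λ : Finset (Eu d)} {τ u : Eu d} {a : EuclideanSpace ℂ Λ} {s : ℝ}
    (h1 : |inner ℝ a (planeVec Λ τ u)| ≤ s) (h2 : |inner ℝ a (Complex.I • planeVec Λ τ u)| ≤ s) :
    ‖discExt Λ τ a u‖ ≤ 2 * s := by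
  rw [inner_planeVec] at h1
  rw [inner_I_smul_planeVec] at h2
  linarith [Complex.norm_le_abs_re_add_abs_im (discExt Λ τ a u)]

/-- Coordinate functionals of length `|Λ|^{1/2}` control the `ℓ²` norm, because bounding each of the
`|Λ|` coordinates by `s / |Λ|^{1/2}` leaves a total of order `s`. -/
theorem norm_le_of_coords {Λ : Finset (Eu d)} {a : EuclideanSpace ℂ Λ} {s : ℝ} (hs : 0 ≤ s)
    (hΛ : 1 ≤ Λ.card)
    (h : ∀ η : Λ, |inner ℝ a ((Real.sqrt Λ.card : ℂ) • EuclideanSpace.single η (1 : ℂ))| ≤ s ∧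
      |inner ℝ a ((Real.sqrt Λ.card : ℂ) • EuclideanSpace.single η Complex.I)| ≤ s) :
    ‖a‖ ≤ 2 * s := by
  classical
  have hc : (0 : ℝ) < Λ.card := by exact_mod_cast hΛ
  have hcoord : ∀ (η : Λ) (z : ℂ), inner ℝ a ((Real.sqrt Λ.card : ℂ) • EuclideanSpace.single η z) =
      Real.sqrt Λ.card * (z * starRingEnd ℂ (a η)).re := by
    intro η z
    rw [PiLp.inner_apply, Finset.sum_eq_single η]
    · rw [PiLp.smul_apply, PiLp.single_apply, if_pos rfl, Complex.inner, smul_eq_mul,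
        mul_assoc, Complex.re_ofReal_mul]
    · intro b _ hb
      rw [PiLp.smul_apply, PiLp.single_apply, if_neg hb]; simp
    · simp
  rw [EuclideanSpace.norm_eq]
  refine Real.sqrt_le_iff.2 ⟨by positivity, ?_⟩
  have hη : ∀ η : Λ, ‖a η‖ ^ 2 ≤ 2 * s ^ 2 / Λ.card := by
    intro η
    obtain ⟨h1, h2⟩ := h η
    rw [hcoord, one_mul, Complex.conj_re, abs_mul, abs_of_nonneg (Real.sqrt_nonneg _)] at h1
    rw [hcoord, Complex.I_mul_re, Complex.conj_im, neg_neg, abs_mul,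
      abs_of_nonneg (Real.sqrt_nonneg _)] at h2
    have h3 := pow_le_pow_left₀ (by positivity) h1 2
    have h4 := pow_le_pow_left₀ (by positivity) h2 2
    rw [mul_pow, Real.sq_sqrt hc.le, sq_abs] at h3 h4
    rw [← Complex.normSq_eq_norm_sq, Complex.normSq_apply, le_div_iff₀ hc]
    nlinarith
  calc ∑ η : Λ, ‖a η‖ ^ 2 ≤ ∑ _η : Λ, 2 * s ^ 2 / Λ.card := Finset.sum_le_sum fun η _ => hη η
    _ = 2 * s ^ 2 := by
        rw [Finset.sum_const, Finset.card_univ, Fintype.card_coe, nsmul_eq_mul]; field_simp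
    _ ≤ _ := by nlinarith [sq_nonneg s]

/-- The Lipschitz dependence on the sample point and on the shift; the latter is multiplied by `R`
because the phase is `u · shift η τ` with `|u| ≤ R`. -/
theorem norm_discExt_sub_le {R : ℝ} {Λ : Finset (Eu d)} (hΛ : ∀ η ∈ Λ, ‖η‖ = 1)
    {τ τ' u u' : Eu d} (hτ : ‖τ‖ ≤ 1 / 4) (hτ' : ‖τ'‖ ≤ 1 / 4) (hu : ‖u‖ ≤ R)
    (a : EuclideanSpace ℂ Λ) :
    ‖discExt Λ τ a u - discExt Λ τ' a u'‖ ≤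
      Real.sqrt Λ.card * ‖a‖ * (2 * Real.pi * (‖u - u'‖ + R * (2 * ‖τ - τ'‖))) := by
  rw [discExt, discExt, ← Finset.sum_sub_distrib]
  refine (norm_sum_le _ _).trans ?_
  calc _ ≤ ∑ η : Λ, ‖a η‖ * (2 * Real.pi * (‖u - u'‖ + R * (2 * ‖τ - τ'‖))) := by
        refine Finset.sum_le_sum fun η _ => ?_
        rw [← mul_sub, norm_mul]
        refine mul_le_mul_of_nonneg_left ((norm_wave_sub_le _ _ _ _).trans ?_) (norm_nonneg _)
        refine mul_le_mul_of_nonneg_left ?_ (by positivity)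
        have h1 : inner ℝ u (shift (η : Eu d) τ) - inner ℝ u' (shift (η : Eu d) τ') =
            inner ℝ u (shift (η : Eu d) τ - shift (η : Eu d) τ') +
              inner ℝ (u - u') (shift (η : Eu d) τ') := by
          rw [inner_sub_right, inner_sub_left]; ring
        have h2 := abs_real_inner_le_norm u (shift (η : Eu d) τ - shift (η : Eu d) τ')
        have h3 := abs_real_inner_le_norm (u - u') (shift (η : Eu d) τ')
        have h4 := norm_shift_sub_le (hΛ η η.2) hτ hτ'
        have h5 : ‖u‖ * ‖shift (η : Eu d) τ - shift (η : Eu d) τ'‖ ≤ R * (2 * ‖τ - τ'‖) := by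
          have hR : 0 ≤ R := (norm_nonneg u).trans hu
          gcongr
        have h6 : ‖u - u'‖ * ‖shift (η : Eu d) τ'‖ ≤ ‖u - u'‖ :=
          mul_le_of_le_one_right (norm_nonneg _) (norm_shift_le _ _)
        rw [h1]
        refine (abs_add_le _ _).trans ?_
        linarith
    _ = (∑ η : Λ, ‖a η‖) * (2 * Real.pi * (‖u - u'‖ + R * (2 * ‖τ - τ'‖))) := by
        rw [Finset.sum_mul]
    _ ≤ _ := by
        have hR : 0 ≤ R := (norm_nonneg u).trans hu
        gcongr
        exact norm_coe_sum_le a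

theorem IsSphereNet.sqrt_card_le (hd : 1 ≤ d) {R : ℝ} (hR : 1 ≤ R) {Λ : Finset (Eu d)}
    (hΛ : IsSphereNet R Λ) : Real.sqrt Λ.card ≤ Real.sqrt (d * 4 ^ d) * R ^ d := by
  refine Real.sqrt_le_iff.2 ⟨by positivity, (hΛ.card_le hd hR).trans ?_⟩
  rw [mul_pow, Real.sq_sqrt (by positivity), ← pow_mul]
  gcongr
  omega

/-- The chain norm is controlled by polynomially many linear functionals of norm `|Λ|^{1/2}`. -/
theorem exists_norming_functionals (hd : 1 ≤ d) :
    ∃ C : ℝ, 1 ≤ C ∧ ∀ R : ℝ, 1 ≤ R → ∀ Λ : Finset (Eu d), IsSphereNet R Λ →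
      ∃ P : Finset (EuclideanSpace ℂ Λ), (∀ v ∈ P, ‖v‖ ≤ Real.sqrt Λ.card) ∧
        4 * (P.card : ℝ) ≤ Real.exp (C * Real.log (2 + R)) ∧
        ∀ (a : EuclideanSpace ℂ Λ) (s : ℝ), 0 ≤ s → (∀ v ∈ P, |inner ℝ a v| ≤ s) →
          chainNorm R Λ a ≤ ENNReal.ofReal (C * s) := by
  classical
  -- The factor `8` is the `4` required in front of the cardinality times the `2` for real and
  -- imaginary parts. The exponent `m` below comes from two grids of at most `((2d+5) R^{d+1})^d`
  -- points each.
  set K : ℝ := 8 * ((2 * d + 5) ^ (2 * d) + d * 4 ^ d) with hK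
  set m : ℕ := 2 * d * (d + 1) with hm
  set a₀ : ℝ := Real.sqrt (d * 4 ^ d) with ha₀
  have hd0 : (1 : ℝ) ≤ d := by exact_mod_cast hd
  have hK1 : 1 ≤ K := by
    have h1 : (1 : ℝ) ≤ (2 * d + 5) ^ (2 * d) := one_le_pow₀ (by linarith)
    have h2 : (0 : ℝ) ≤ d * 4 ^ d := by positivity
    rw [hK]; linarith
  have hlogK := Real.log_nonneg hK1
  set C : ℝ := 2 + 12 * Real.pi * a₀ + 2 * a₀ * 80 ^ d + (Real.log K + m) with hC
  have hp1 : 0 ≤ 12 * Real.pi * a₀ := by positivity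
  have hp2 : 0 ≤ 2 * a₀ * 80 ^ d := by positivity
  have hp3 : (0 : ℝ) ≤ m := by positivity
  refine ⟨C, by linarith, fun R hR Λ hΛ => ?_⟩
  have hlog := one_le_log hR
  have hcard := hΛ.card_le hd hR
  have hcard1 := hΛ.one_le_card hd
  have hsq := hΛ.sqrt_card_le hd hR
  -- These functionals bound `‖a‖`, and with it the error made when `(τ, u)` is replaced by a grid
  -- point.
  let coords : Finset (EuclideanSpace ℂ Λ) :=
    ((Finset.univ : Finset Λ) ×ˢ ({1, Complex.I} : Finset ℂ)).image
      fun p => (Real.sqrt Λ.card : ℂ) • EuclideanSpace.single p.1 p.2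
  have hcoords_norm : ∀ v ∈ coords, ‖v‖ ≤ Real.sqrt Λ.card := by
    intro v hv
    obtain ⟨⟨η, z⟩, hz, rfl⟩ := Finset.mem_image.1 hv
    have hz1 : ‖z‖ = 1 := by
      simp only [Finset.mem_product, Finset.mem_insert, Finset.mem_singleton] at hz
      rcases hz.2 with rfl | rfl <;> simp
    rw [norm_smul, PiLp.norm_single, hz1, mul_one, Complex.norm_real,
      Real.norm_of_nonneg (Real.sqrt_nonneg _)]
  have hcoords_card : (coords.card : ℝ) ≤ 2 * (d * 4 ^ d * R ^ m) := by
    calc (coords.card : ℝ) ≤ ((Λ.card * 2 : ℕ) : ℝ) := by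
          have h1 : coords.card ≤ Λ.card * 2 := by
            refine Finset.card_image_le.trans ?_
            rw [Finset.card_product, Finset.card_univ, Fintype.card_coe]
            exact Nat.mul_le_mul_left _ Finset.card_le_two
          exact_mod_cast h1
      _ = 2 * (Λ.card : ℝ) := by push_cast; ring
      _ ≤ 2 * (d * 4 ^ d * R ^ (d - 1)) := by gcongr
      _ ≤ _ := by
          gcongr
          rw [hm]; nlinarith [Nat.sub_le d 1]
  have hcoords : ∀ (a : EuclideanSpace ℂ Λ) (s : ℝ), 0 ≤ s → (∀ v ∈ coords, |inner ℝ a v| ≤ s) →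
      ‖a‖ ≤ 2 * s := by
    intro a s hs h
    refine norm_le_of_coords hs hcard1 fun η => ⟨h _ ?_, h _ ?_⟩
    · exact Finset.mem_image.2 ⟨(η, 1), by simp, rfl⟩
    · exact Finset.mem_image.2 ⟨(η, Complex.I), by simp, rfl⟩
  have hexp : K * R ^ m ≤ Real.exp (C * Real.log (2 + R)) := by
    refine (mul_pow_le_exp_log hK1 hR m).trans (Real.exp_le_exp.2 ?_)
    gcongr
    rw [hC]; linarith
  have hRm : (0 : ℝ) ≤ R ^ m := by positivity
  -- For `R ≥ 80` the shifts and the grid points near them have norm at most `1/4`, so that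
  -- `norm_shift_sub_le` applies. For smaller `R` the net has boundedly many points and the
  -- coordinates alone suffice.
  rcases lt_or_ge R 80 with hR80 | hR80
  · refine ⟨coords, hcoords_norm, ?_, fun a s hs h => ?_⟩
    · refine le_trans ?_ hexp
      have h2 : (0 : ℝ) ≤ (2 * d + 5) ^ (2 * d) * R ^ m := by positivity
      rw [hK]; linarith
    · rw [chainNorm_le_ofReal_iff (by positivity)]
      intro τ _ u _
      calc _ ≤ Real.sqrt Λ.card * ‖a‖ := norm_discExt_le τ a u
        _ ≤ (a₀ * 80 ^ d) * (2 * s) := by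
            refine mul_le_mul (hsq.trans ?_) (hcoords a s hs h) (norm_nonneg _) (by positivity)
            gcongr
        _ = (2 * a₀ * 80 ^ d) * s := by ring
        _ ≤ C * s := by gcongr; rw [hC]; linarith
  · have hR0 : 0 < R := by linarith
    -- The mesh `R^{-d}` for `u`, and `R^{-d-1}` for `τ`, compensates the crude bound `|Λ|^{1/2} ≲
    -- R^d` in the Lipschitz estimate, so that the discretization error is `O(s)`.
    obtain ⟨Gu, hGu, hGu'⟩ := exists_grid (d := d) hd hR0.le (ε := 1 / R ^ d) (by positivity)
    obtain ⟨Gt, hGt, hGt'⟩ := exists_grid (d := d) hd (ρ := 10 / R) (by positivity)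
      (ε := 1 / R ^ (d + 1)) (by positivity)
    have hGu2 : (Gu.card : ℝ) ≤ ((2 * d + 5) * R ^ (d + 1)) ^ d := by
      refine hGu.trans ?_
      gcongr
      have : (1 : ℝ) ≤ R ^ (d + 1) := one_le_pow₀ hR
      rw [div_div_eq_mul_div, div_one, add_mul, mul_assoc, ← pow_succ']
      linarith
    have hGt2 : (Gt.card : ℝ) ≤ ((2 * d + 5) * R ^ (d + 1)) ^ d := by
      refine hGt.trans ?_
      have : (1 : ℝ) ≤ R ^ (d + 1) := one_le_pow₀ hR
      have h1 : 10 / R ≤ 1 := by rw [div_le_one hR0]; linarith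
      rw [div_div_eq_mul_div, div_one, add_mul (2 * (d : ℝ))]
      refine pow_le_pow_left₀ (by positivity) (add_le_add ?_ (by linarith)) d
      exact mul_le_mul_of_nonneg_right (mul_le_of_le_one_right (by positivity) h1) (by positivity)
    let planes : Finset (EuclideanSpace ℂ Λ) :=
      ((Gt ×ˢ Gu) ×ˢ ({1, Complex.I} : Finset ℂ)).image fun p => p.2 • planeVec Λ p.1.1 p.1.2
    have hplanes_norm : ∀ v ∈ planes, ‖v‖ ≤ Real.sqrt Λ.card := by
      intro v hv
      obtain ⟨⟨p, z⟩, hz, rfl⟩ := Finset.mem_image.1 hv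
      have hz1 : ‖z‖ = 1 := by
        simp only [Finset.mem_product, Finset.mem_insert, Finset.mem_singleton] at hz
        rcases hz.2 with rfl | rfl <;> simp
      rw [norm_smul, hz1, one_mul, norm_planeVec]
    have hplanes_card : (planes.card : ℝ) ≤ 2 * ((2 * d + 5) ^ (2 * d) * R ^ m) := by
      calc (planes.card : ℝ) ≤ ((Gt.card * Gu.card * 2 : ℕ) : ℝ) := by
            have h1 : planes.card ≤ Gt.card * Gu.card * 2 := by
              refine Finset.card_image_le.trans ?_
              rw [Finset.card_product, Finset.card_product]
              exact Nat.mul_le_mul_left _ Finset.card_le_two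
            exact_mod_cast h1
        _ = 2 * ((Gt.card : ℝ) * Gu.card) := by push_cast; ring
        _ ≤ 2 * (((2 * d + 5) * R ^ (d + 1)) ^ d * ((2 * d + 5) * R ^ (d + 1)) ^ d) := by gcongr
        _ = _ := by rw [hm, mul_pow, mul_assoc 2 d, pow_mul', pow_mul' R 2]; ring
    refine ⟨planes ∪ coords, ?_, ?_, fun a s hs h => ?_⟩
    · intro v hv
      rcases Finset.mem_union.1 hv with h | h
      exacts [hplanes_norm v h, hcoords_norm v h]
    · refine le_trans ?_ hexp
      have h1 : ((planes ∪ coords).card : ℝ) ≤ planes.card + coords.card := by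
        exact_mod_cast Finset.card_union_le _ _
      rw [hK]; linarith
    · have hna : ‖a‖ ≤ 2 * s := hcoords a s hs fun v hv => h v (Finset.mem_union_right _ hv)
      rw [chainNorm_le_ofReal_iff (by positivity)]
      intro τ hτ u hu
      obtain ⟨u', hu', huu⟩ := hGu' u hu.le
      obtain ⟨τ', hτ', hττ⟩ := hGt' τ hτ.le
      have ht8 : 10 / R ≤ 1 / 8 := by rw [div_le_div_iff₀ hR0 (by norm_num)]; linarith
      have hRd : 1 / R ^ (d + 1) ≤ 1 / 8 := by
        refine one_div_le_one_div_of_le (by norm_num) ?_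
        calc (8 : ℝ) ≤ R := by linarith
          _ ≤ R ^ (d + 1) := le_self_pow₀ hR (by omega)
      have hτ4 : ‖τ‖ ≤ 1 / 4 := by linarith
      have hτ4' : ‖τ'‖ ≤ 1 / 4 := by
        have : ‖τ'‖ ≤ ‖τ‖ + ‖τ - τ'‖ := by simpa using norm_sub_le τ (τ - τ')
        linarith
      have hmem : ∀ z ∈ ({1, Complex.I} : Finset ℂ), z • planeVec Λ τ' u' ∈ planes ∪ coords :=
        fun z hz => Finset.mem_union_left _ (Finset.mem_image.2 ⟨((τ', u'), z),
          Finset.mem_product.2 ⟨Finset.mem_product.2 ⟨hτ', hu'⟩, hz⟩, rfl⟩)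
      have h1 : ‖discExt Λ τ' a u'‖ ≤ 2 * s := by
        refine norm_discExt_le_of_inner ?_ (h _ (hmem _ (by simp)))
        simpa using h _ (hmem 1 (by simp))
      have h2 := norm_discExt_sub_le (R := R) hΛ.1 hτ4 hτ4' hu.le a (u' := u')
      have h3 : Real.sqrt Λ.card * ‖a‖ * (2 * Real.pi * (‖u - u'‖ + R * (2 * ‖τ - τ'‖))) ≤
          (a₀ * R ^ d) * (2 * s) *
            (2 * Real.pi * (1 / R ^ d + R * (2 * (1 / R ^ (d + 1))))) := by
        gcongr
      have h4 : (a₀ * R ^ d) * (2 * s) *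
            (2 * Real.pi * (1 / R ^ d + R * (2 * (1 / R ^ (d + 1))))) = 12 * Real.pi * a₀ * s := by
        rw [pow_succ]; field_simp; ring
      have h5 : ‖discExt Λ τ a u‖ ≤ ‖discExt Λ τ' a u'‖ + ‖discExt Λ τ a u - discExt Λ τ' a u'‖ :=
        by simpa using norm_add_le (discExt Λ τ' a u') (discExt Λ τ a u - discExt Λ τ' a u')
      calc ‖discExt Λ τ a u‖ ≤ (2 + 12 * Real.pi * a₀) * s := by linarith
        _ ≤ C * s := by gcongr; rw [hC]; linarith

theorem chainNorm_neg (R : ℝ) {Λ : Finset (Eu d)} (a : EuclideanSpace ℂ Λ) :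
    chainNorm R Λ (-a) = chainNorm R Λ a := by
  have : ∀ τ u, ‖discExt Λ τ (-a) u‖ₑ = ‖discExt Λ τ a u‖ₑ := by
    intro τ u
    have h : discExt Λ τ (-a) u = -discExt Λ τ a u := by simp [discExt]
    rw [h, enorm_neg]
  simp only [chainNorm, this]

theorem chainNorm_zero (R : ℝ) (Λ : Finset (Eu d)) : chainNorm R Λ 0 = 0 := by
  simp [chainNorm, discExt]

/-- A maximal separated subset of the unit ball is a cover. Separation in the chain norm is detected
by one of the norming functionals, so dual Sudakov bounds the cardinality. -/
theorem exists_isChainCover (hd : 1 ≤ d) :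
    ∃ C : ℝ, 1 ≤ C ∧ ∀ R : ℝ, 1 ≤ R → ∀ Λ : Finset (Eu d), IsSphereNet R Λ → ∀ k : ℕ,
      ∃ Z : Finset (EuclideanSpace ℂ Λ), IsChainCover R Λ k Z ∧
        (Z.card : ℝ) ≤ 2 * Real.exp (C * (4 ^ k * Real.log (2 + R))) := by
  obtain ⟨C, hC1, hC⟩ := exists_norming_functionals hd
  refine ⟨4 * C ^ 3, by nlinarith [one_le_pow₀ hC1 (n := 3)], fun R hR Λ hΛ k => ?_⟩
  obtain ⟨P, hP1, hP2, hP3⟩ := hC R hR Λ hΛ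
  have hlog := one_le_log hR
  have hcard1 : (0 : ℝ) < Λ.card := by exact_mod_cast hΛ.one_le_card hd
  set A := Real.sqrt Λ.card with hA
  have hA0 : 0 < A := Real.sqrt_pos.2 hcard1
  set L := C * Real.log (2 + R) with hL
  have hL0 : 0 < L := by positivity
  set t : ℝ := (2 : ℝ)⁻¹ ^ k * A with ht
  have ht0 : 0 < t := by positivity
  -- The dilation at which chain distance `t` forces some functional above `t / C`, that is, above
  -- twice the slab height after scaling. Then `ρ²/2` is of order `4^k log R`.
  set ρ : ℝ := 2 * Real.sqrt (2 * L) * C * 2 ^ k with hρ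
  have hρ0 : 0 < ρ := by positivity
  have hρt : ρ * (t / C) = 2 * (A * Real.sqrt (2 * L)) := by
    rw [hρ, ht, inv_pow]; field_simp
  have hρ2 : ρ ^ 2 / 2 = 4 * C ^ 3 * (4 ^ k * Real.log (2 + R)) := by
    rw [hρ, mul_pow, mul_pow, mul_pow, Real.sq_sqrt (by positivity), ← pow_mul, mul_comm k,
      pow_mul, hL]
    ring
  have hbound : ∀ S : Finset (EuclideanSpace ℂ Λ), (∀ z ∈ S, ‖z‖ ≤ 1) →
      (∀ z ∈ S, ∀ z' ∈ S, z ≠ z' → ¬ chainNorm R Λ (z - z') ≤ ENNReal.ofReal t) →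
      (S.card : ℝ) ≤ 2 * Real.exp (4 * C ^ 3 * (4 ^ k * Real.log (2 + R))) := by
    intro S hS hsep
    rw [← hρ2]
    refine card_le_of_slab_separated P hA0 hL0.le hP1 hP2 hρ0.le S hS fun z hz z' hz' hne => ?_
    by_contra! hcon
    refine hsep z hz z' hz' hne ?_
    have h1 := hP3 (z - z') (t / C) (by positivity) fun v hv => by
      have := hcon v hv
      rw [← hρt] at this
      exact le_of_mul_le_mul_left this hρ0
    rwa [mul_div_cancel₀ _ (by positivity)] at h1
  obtain ⟨Z, h1, h2, h3⟩ := exists_maximal_pairwise {z : EuclideanSpace ℂ Λ | ‖z‖ ≤ 1}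
    (fun z z' => ¬ chainNorm R Λ (z - z') ≤ ENNReal.ofReal t)
    (fun x y h => by rwa [← chainNorm_neg, neg_sub])
    ⌊2 * Real.exp (4 * C ^ 3 * (4 ^ k * Real.log (2 + R)))⌋₊
    (fun S hS hsep => Nat.le_floor (hbound S hS hsep))
  refine ⟨Z, ⟨h1, fun a ha => ?_⟩, hbound Z h1 h2⟩
  rcases h3 a ha with h | ⟨z, hz, h⟩
  · exact ⟨a, h, by rw [sub_self, chainNorm_zero]; exact zero_le⟩
  · exact ⟨z, hz, not_not.1 h⟩

/-- For `k = 0` the origin alone is a cover, as the chain norm is at most `|Λ|^{1/2}` on the unit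
ball, and it is minimal since a cover is nonempty. For other `k` a minimum exists because finite
covers do. -/
theorem exists_isChain (hd : 1 ≤ d) {R : ℝ} (hR : 1 ≤ R) {Λ : Finset (Eu d)}
    (hΛ : IsSphereNet R Λ) : ∃ Z : ℕ → Finset (EuclideanSpace ℂ Λ), IsChain R Λ Z := by
  classical
  obtain ⟨C, -, hC⟩ := exists_isChainCover hd
  have hmin : ∀ k, ∃ Z : Finset (EuclideanSpace ℂ Λ), IsChainCover R Λ k Z ∧
      ∀ Z' : Finset (EuclideanSpace ℂ Λ), IsChainCover R Λ k Z' → Z.card ≤ Z'.card := by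
    intro k
    have hex : ∃ n, ∃ Z : Finset (EuclideanSpace ℂ Λ), IsChainCover R Λ k Z ∧ Z.card = n := by
      obtain ⟨Z, hZ, -⟩ := hC R hR Λ hΛ k
      exact ⟨_, Z, hZ, rfl⟩
    obtain ⟨Z, hZ, hcard⟩ := Nat.find_spec hex
    exact ⟨Z, hZ, fun Z' hZ' => hcard ▸ Nat.find_min' hex ⟨Z', hZ', rfl⟩⟩
  choose Z hZ using hmin
  refine ⟨fun k => if k = 0 then {0} else Z k, by simp, fun k => ?_⟩
  rcases eq_or_ne k 0 with rfl | hk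
  · simp only [if_true]
    refine ⟨⟨by simp, fun a ha => ⟨0, by simp, ?_⟩⟩, fun Z' hZ' => ?_⟩
    · rw [sub_zero, chainScale, pow_zero, one_mul, chainNorm_le_ofReal_iff (Real.sqrt_nonneg _)]
      intro τ _ u _
      exact (norm_discExt_le τ a u).trans (mul_le_of_le_one_right (Real.sqrt_nonneg _) ha)
    · obtain ⟨z, hz, -⟩ := hZ'.2 0 (by simp)
      rw [Finset.card_singleton]
      exact Finset.card_pos.2 ⟨z, hz⟩
  · simp only [if_neg hk]
    exact hZ k

/-- The links form a finite set, of logarithmic cardinality `≲ 4^k log R`. -/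
theorem exists_links_card_le (hd : 1 ≤ d) :
    ∃ C : ℝ, 1 ≤ C ∧ ∀ R : ℝ, 1 ≤ R → ∀ Λ : Finset (Eu d), IsSphereNet R Λ →
      ∀ Z : ℕ → Finset (EuclideanSpace ℂ Λ), IsChain R Λ Z → ∀ k : ℕ,
      ∃ F : Finset (EuclideanSpace ℂ Λ), ↑F = links R Λ Z k ∧
        (F.card : ℝ) ≤ Real.exp (C * (4 ^ k * Real.log (2 + R))) := by
  classical
  obtain ⟨C, hC1, hC⟩ := exists_isChainCover hd
  -- The factor `5` is `4^k + 4^{k+1} = 5 * 4^k` from two consecutive covers; the `2` absorbs their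
  -- prefactors through `2 ≤ e`.
  refine ⟨2 + 5 * C, by linarith, fun R hR Λ hΛ Z hZ k => ?_⟩
  have hcard : ∀ j, ((Z j).card : ℝ) ≤ 2 * Real.exp (C * (4 ^ j * Real.log (2 + R))) := by
    intro j
    obtain ⟨Z', hZ', hc⟩ := hC R hR Λ hΛ j
    exact le_trans (by exact_mod_cast (hZ.2 j).2 Z' hZ') hc
  refine ⟨((Z k ×ˢ Z (k + 1)).image fun p => p.2 - p.1).filter
    fun b => chainNorm R Λ b ≤ 2 * chainScale Λ k, ?_, ?_⟩
  · ext b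
    simp only [Finset.coe_filter, Finset.mem_image, Finset.mem_product, Prod.exists, links,
      Set.mem_ofPred_eq]
    constructor
    · rintro ⟨⟨z, z', ⟨h1, h2⟩, rfl⟩, h3⟩
      exact ⟨z, h1, z', h2, rfl, h3⟩
    · rintro ⟨z, h1, z', h2, rfl, h3⟩
      exact ⟨⟨z, z', ⟨h1, h2⟩, rfl⟩, h3⟩
  · have hlog := one_le_log hR
    set l := 4 ^ k * Real.log (2 + R) with hl
    have hl1 : 1 ≤ l := one_le_mul_of_one_le_of_one_le (one_le_pow₀ (by norm_num)) hlog
    have h2e : (2 : ℝ) ≤ Real.exp 1 := by linarith [Real.add_one_le_exp (1 : ℝ)]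
    calc _ ≤ ((Z k).card * (Z (k + 1)).card : ℝ) := by
          have h1 := (Finset.card_filter_le (((Z k ×ˢ Z (k + 1)).image fun p => p.2 - p.1))
            fun b => chainNorm R Λ b ≤ 2 * chainScale Λ k).trans Finset.card_image_le
          rw [Finset.card_product] at h1
          exact_mod_cast h1
      _ ≤ (Real.exp 1 * Real.exp (C * l)) * (Real.exp 1 * Real.exp (C * (4 * l))) := by
          have h3 := hcard (k + 1)
          rw [pow_succ', mul_assoc] at h3
          have h4 := hcard k
          gcongr
          · exact h4.trans (by gcongr)
          · exact h3.trans (by gcongr)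
      _ = Real.exp (2 + 5 * C * l) := by
          rw [← Real.exp_add, ← Real.exp_add, ← Real.exp_add]; ring_nf
      _ ≤ _ := by
          rw [Real.exp_le_exp]
          nlinarith

end Entropy

end RandomExtension

namespace RandomExtension

/-! ### The large sieve and the discrete restriction estimate. -/

section LargeSieve

variable {d : ℕ}

/-- The cube `[-2,2)^d`. -/
def cube (d : ℕ) : Set (Eu d) := {ζ | ∀ j, ζ j ∈ Set.Ico (-2 : ℝ) 2}

theorem measurableSet_cube : MeasurableSet (cube d) := by
  have : cube d = ⋂ j, (fun ζ : Eu d => ζ j) ⁻¹' Set.Ico (-2 : ℝ) 2 := by ext; simp [cube]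
  rw [this]
  exact MeasurableSet.iInter fun j => measurableSet_Ico.preimage (by fun_prop)

theorem ball_subset_cube : Metric.ball (0 : Eu d) 2 ⊆ cube d := by
  intro x hx j
  have h := (PiLp.norm_apply_le x j).trans_lt (mem_ball_zero_iff.1 hx)
  rw [Real.norm_eq_abs, abs_lt] at h
  exact ⟨h.1.le, h.2⟩

/-- The interval has length `4`, a whole number of periods of every integer frequency. The cube
`[-2,2)^d` therefore keeps the waves of lattice points orthogonal while leaving room around the unit
ball. -/
theorem integral_Ico_exp (n : ℤ) :
    ∫ t in Set.Ico (-2 : ℝ) 2, Complex.exp (2 * Real.pi * Complex.I * ((n * t : ℝ) : ℂ)) =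
      if n = 0 then 4 else 0 := by
  rw [integral_Ico_eq_integral_Ioc, ← intervalIntegral.integral_of_le (by norm_num)]
  split_ifs with h
  · subst h
    simp
    norm_num
  · have hc : (2 * Real.pi * Complex.I * n : ℂ) ≠ 0 := by
      simp [Real.pi_ne_zero, h]
    have h1 := integral_exp_mul_complex (a := -2) (b := 2) hc
    have h2 : (fun t : ℝ => Complex.exp (2 * Real.pi * Complex.I * ((n * t : ℝ) : ℂ))) =
        fun t : ℝ => Complex.exp (2 * Real.pi * Complex.I * n * t) := by
      ext t; congr 1; push_cast; ring
    rw [h2, h1]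
    have e1 : Complex.exp (2 * Real.pi * Complex.I * n * ((2 : ℝ) : ℂ)) = 1 := by
      rw [← Complex.exp_int_mul_two_pi_mul_I (2 * n)]; congr 1; push_cast; ring
    have e2 : Complex.exp (2 * Real.pi * Complex.I * n * ((-2 : ℝ) : ℂ)) = 1 := by
      rw [← Complex.exp_int_mul_two_pi_mul_I (-2 * n)]; congr 1; push_cast; ring
    rw [e1, e2, sub_self, zero_div]

theorem integral_cube_wave (n : Fin d → ℤ) :
    ∫ ζ in cube d, wave (latticePt n) ζ = if n = 0 then 4 ^ d else 0 := by
  have h1 : ∀ ζ : Eu d, (cube d).indicator (wave (latticePt n)) ζ =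
      ∏ j, (Set.Ico (-2 : ℝ) 2).indicator
        (fun t => Complex.exp (2 * Real.pi * Complex.I * ((n j * t : ℝ) : ℂ))) (ζ j) := by
    intro ζ
    by_cases hζ : ζ ∈ cube d
    · rw [Set.indicator_of_mem hζ, wave, PiLp.inner_apply, Complex.ofReal_sum, Finset.mul_sum,
        Complex.exp_sum]
      refine Finset.prod_congr rfl fun j _ => ?_
      rw [Set.indicator_of_mem (hζ j)]
      simp [latticePt, mul_comm]
    · rw [Set.indicator_of_notMem hζ]
      simp only [cube, Set.mem_ofPred_eq, not_forall] at hζ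
      obtain ⟨j, hj⟩ := hζ
      exact (Finset.prod_eq_zero (Finset.mem_univ j) (Set.indicator_of_notMem hj _)).symm
  rw [← integral_indicator measurableSet_cube, integral_congr_ae (Eventually.of_forall h1)]
  have h2 := (EuclideanSpace.volume_preserving_symm_measurableEquiv_toLp (Fin d)).integral_comp'
    (fun x : Fin d → ℝ => ∏ j, (Set.Ico (-2 : ℝ) 2).indicator
        (fun t => Complex.exp (2 * Real.pi * Complex.I * ((n j * t : ℝ) : ℂ))) (x j))
  refine h2.trans ?_
  rw [integral_fintype_prod_volume_eq_prod (fun j : Fin d => (Set.Ico (-2 : ℝ) 2).indicator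
        (fun t => Complex.exp (2 * Real.pi * Complex.I * ((n j * t : ℝ) : ℂ))))]
  simp_rw [integral_indicator measurableSet_Ico, integral_Ico_exp]
  split_ifs with h
  · subst h; simp
  · obtain ⟨j, hj⟩ := Function.ne_iff.1 h
    exact Finset.prod_eq_zero (Finset.mem_univ j) (if_neg hj)

theorem volume_cube_ne_top : (volume : Measure (Eu d)) (cube d) ≠ ⊤ := by
  have : cube d ⊆ Metric.ball 0 (2 * Real.sqrt d + 1) := by
    intro x hx
    rw [mem_ball_zero_iff, EuclideanSpace.norm_eq]
    refine lt_of_le_of_lt (b := Real.sqrt (∑ _j : Fin d, (2 : ℝ) ^ 2)) ?_ ?_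
    · refine Real.sqrt_le_sqrt (Finset.sum_le_sum fun j _ => ?_)
      have h := hx j
      rw [Real.norm_eq_abs]
      exact pow_le_pow_left₀ (abs_nonneg _) (abs_le.2 ⟨h.1, h.2.le⟩) 2
    · rw [Finset.sum_const, Finset.card_univ, Fintype.card_fin, nsmul_eq_mul,
        Real.sqrt_mul (by positivity), Real.sqrt_sq (by norm_num)]
      linarith
  exact ((measure_mono this).trans_lt measure_ball_lt_top).ne

/-- Bessel's inequality for the samples of a Fourier transform along a shifted lattice. -/
theorem sum_sq_integral_wave_le {H : Eu d → ℂ} (hH : Integrable H)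
    (hH2 : Integrable fun ζ => ‖H ζ‖ ^ 2) (hsupp : Function.support H ⊆ cube d)
    (S : Finset (Fin d → ℤ)) (v : Eu d) :
    ∑ i ∈ S, ‖∫ ζ, wave (latticePt i + v) ζ * H ζ‖ ^ 2 ≤ 4 ^ d * ∫ ζ, ‖H ζ‖ ^ 2 := by
  classical
  set c : (Fin d → ℤ) → ℂ := fun i => ∫ ζ, wave (latticePt i + v) ζ * H ζ with hc
  set T := ∑ i ∈ S, ‖c i‖ ^ 2 with hT
  set G : Eu d → ℂ := fun ζ => ∑ i ∈ S, starRingEnd ℂ (c i) * wave (latticePt i + v) ζ with hG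
  have hGcont : Continuous G := continuous_finsetSum _ fun i _ =>
    continuous_const.mul (continuous_wave.comp (continuous_const.prodMk continuous_id))
  have hwcont : ∀ x : Eu d, Continuous fun ζ => wave x ζ := fun x =>
    continuous_wave.comp (continuous_const.prodMk continuous_id)
  have hint : ∀ x : Eu d, Integrable fun ζ => wave x ζ * H ζ := fun x =>
    hH.bdd_mul (hwcont x).aestronglyMeasurable (c := 1)
      (Eventually.of_forall fun ζ => (norm_wave x ζ).le)
  have hfinite : IsFiniteMeasure ((volume : Measure (Eu d)).restrict (cube d)) :=
    ⟨by rw [Measure.restrict_apply_univ]; exact volume_cube_ne_top.lt_top⟩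
  -- Duality: the sum of squares is the pairing of `H` with the trigonometric polynomial whose
  -- coefficients are the conjugates of the samples.
  have h1 : ((T : ℝ) : ℂ) = ∫ ζ, G ζ * H ζ := by
    simp only [hG, Finset.sum_mul, mul_assoc]
    rw [integral_finsetSum _ fun i _ => (hint _).const_mul _, hT]
    push_cast
    refine Finset.sum_congr rfl fun i _ => ?_
    rw [integral_const_mul, ← Complex.ofReal_pow, ← Complex.normSq_eq_norm_sq,
      Complex.normSq_eq_conj_mul_self]
  have hGb : ∀ ζ, ‖G ζ‖ ≤ ∑ i ∈ S, ‖c i‖ := fun ζ => by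
    refine (norm_sum_le _ _).trans (le_of_eq (Finset.sum_congr rfl fun i _ => ?_))
    rw [norm_mul, norm_wave, mul_one, RCLike.norm_conj]
  have hG2 : IntegrableOn (fun ζ => ‖G ζ‖ ^ 2) (cube d) :=
    Integrable.of_bound (hGcont.norm.pow 2).aestronglyMeasurable ((∑ i ∈ S, ‖c i‖) ^ 2)
      (Eventually.of_forall fun ζ => by
        rw [Real.norm_of_nonneg (by positivity)]
        exact pow_le_pow_left₀ (norm_nonneg _) (hGb ζ) 2)
  -- Parseval on the cube. The shift `v` cancels in the products of two waves.
  have h2 : ∫ ζ in cube d, ‖G ζ‖ ^ 2 = 4 ^ d * T := by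
    have h3 : ((∫ ζ in cube d, ‖G ζ‖ ^ 2 : ℝ) : ℂ) = ((4 ^ d * T : ℝ) : ℂ) := by
      rw [← integral_complex_ofReal]
      have h4 : ∀ ζ, ((‖G ζ‖ ^ 2 : ℝ) : ℂ) = ∑ i ∈ S, ∑ j ∈ S,
          (c i * starRingEnd ℂ (c j)) * wave (latticePt (j - i)) ζ := by
        intro ζ
        rw [← Complex.normSq_eq_norm_sq, Complex.normSq_eq_conj_mul_self, hG, map_sum,
          Finset.sum_mul_sum]
        refine Finset.sum_congr rfl fun i _ => Finset.sum_congr rfl fun j _ => ?_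
        have h5 : latticePt (j - i) = -(latticePt i + v) + (latticePt j + v) := by
          ext l; simp [latticePt]; ring
        rw [h5, wave_add (-(latticePt i + v)), wave_neg, map_mul, Complex.conj_conj]
        ring
      simp_rw [h4]
      have hwint : ∀ x : Eu d, IntegrableOn (fun ζ => wave x ζ) (cube d) := fun x =>
        Integrable.of_bound (hwcont x).aestronglyMeasurable 1
          (Eventually.of_forall fun ζ => (norm_wave x ζ).le)
      rw [integral_finsetSum _ fun i _ => integrable_finsetSum _ fun j _ =>
        (hwint _).const_mul _]
      simp_rw [integral_finsetSum S fun j _ => (hwint _).const_mul _, integral_const_mul,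
        integral_cube_wave, sub_eq_zero]
      rw [hT]
      push_cast
      rw [Finset.mul_sum]
      refine Finset.sum_congr rfl fun i hi => ?_
      simp only [mul_ite, mul_zero, Finset.sum_ite_eq', if_pos hi]
      rw [← Complex.ofReal_pow ‖c i‖, ← Complex.normSq_eq_norm_sq,
        Complex.normSq_eq_conj_mul_self]
      ring
    exact_mod_cast h3
  -- The inequality of means with weights that make the `G` part exactly `T / 2`, which is then
  -- absorbed on the left.
  have h4 : T ≤ ∫ ζ in cube d, (4 ^ d / 2 * ‖H ζ‖ ^ 2 + (4 ^ d)⁻¹ / 2 * ‖G ζ‖ ^ 2) := by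
    have h5 : T = ‖∫ ζ in cube d, G ζ * H ζ‖ := by
      rw [setIntegral_eq_integral_of_forall_compl_eq_zero, ← h1, Complex.norm_real,
        Real.norm_of_nonneg (by positivity)]
      intro ζ hζ
      rw [Function.notMem_support.1 fun h => hζ (hsupp h), mul_zero]
    rw [h5]
    refine (norm_integral_le_integral_norm _).trans (integral_mono_of_nonneg
      (Eventually.of_forall fun _ => norm_nonneg _)
      ((hH2.integrableOn.const_mul _).add (hG2.const_mul _)) (Eventually.of_forall fun ζ => ?_))
    simp only [norm_mul]
    set K : ℝ := 4 ^ d with hK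
    have hK0 : 0 < K := by positivity
    have : K / 2 * ‖H ζ‖ ^ 2 + K⁻¹ / 2 * ‖G ζ‖ ^ 2 - ‖G ζ‖ * ‖H ζ‖ =
        (K * ‖H ζ‖ - ‖G ζ‖) ^ 2 / (2 * K) := by field_simp; ring
    have h6 : 0 ≤ (K * ‖H ζ‖ - ‖G ζ‖) ^ 2 / (2 * K) := by positivity
    linarith
  rw [integral_add (hH2.integrableOn.const_mul _) (hG2.const_mul _), integral_const_mul,
    integral_const_mul, h2] at h4
  have h7 : ∫ ζ in cube d, ‖H ζ‖ ^ 2 = ∫ ζ, ‖H ζ‖ ^ 2 := by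
    refine setIntegral_eq_integral_of_forall_compl_eq_zero fun ζ hζ => ?_
    rw [Function.notMem_support.1 fun h => hζ (hsupp h)]; simp
  rw [h7] at h4
  have h8 : ((4 : ℝ) ^ d)⁻¹ / 2 * (4 ^ d * T) = T / 2 := by field_simp
  rw [h8] at h4
  linarith

/-- On the ball the phase `2π u · ζ` is at most `π/3` in modulus, where the cosine is at least
`1/2`. -/
theorem half_volume_le_norm_integral_ball_wave {R r : ℝ} {u : Eu d} (hu : ‖u‖ ≤ R)
    (hr : R * r ≤ 1 / 6) :
    (volume : Measure (Eu d)).real (Metric.ball 0 r) / 2 ≤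
      ‖∫ ζ in Metric.ball (0 : Eu d) r, wave u ζ‖ := by
  have hwcont : Continuous fun ζ => wave u ζ :=
    continuous_wave.comp (continuous_const.prodMk continuous_id)
  have hint : IntegrableOn (fun ζ => wave u ζ) (Metric.ball (0 : Eu d) r) := by
    have : IsFiniteMeasure ((volume : Measure (Eu d)).restrict (Metric.ball 0 r)) :=
      ⟨by rw [Measure.restrict_apply_univ]; exact measure_ball_lt_top⟩
    exact Integrable.of_bound hwcont.aestronglyMeasurable 1
      (Eventually.of_forall fun ζ => (norm_wave u ζ).le)
  refine le_trans ?_ (Complex.re_le_norm _)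
  have hre : (∫ ζ in Metric.ball (0 : Eu d) r, wave u ζ).re =
      ∫ ζ in Metric.ball (0 : Eu d) r, (wave u ζ).re := (integral_re hint).symm
  rw [hre]
  have hcst : ∫ _ζ in Metric.ball (0 : Eu d) r, (1 / 2 : ℝ) =
      (volume : Measure (Eu d)).real (Metric.ball 0 r) / 2 := by
    rw [setIntegral_const, smul_eq_mul]; ring
  rw [← hcst]
  refine setIntegral_mono_on (integrableOn_const measure_ball_lt_top.ne) hint.re
    Metric.isOpen_ball.measurableSet fun ζ hζ => ?_
  have h1 : |inner ℝ u ζ| ≤ 1 / 6 := by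
    refine (abs_real_inner_le_norm u ζ).trans (le_trans ?_ hr)
    exact mul_le_mul hu (mem_ball_zero_iff.1 hζ).le (norm_nonneg _) ((norm_nonneg _).trans hu)
  have h2 : (wave u ζ).re = Real.cos (2 * Real.pi * inner ℝ u ζ) := by
    have h3 : (2 * (Real.pi : ℂ) * Complex.I * ((inner ℝ u ζ : ℝ) : ℂ))
        = ((2 * Real.pi * inner ℝ u ζ : ℝ) : ℂ) * Complex.I := by
      push_cast; ring
    rw [wave, h3, Complex.exp_ofReal_mul_I_re]
  change 1 / 2 ≤ (wave u ζ).re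
  rw [h2, ← Real.cos_pi_div_three, ← Real.cos_abs (2 * Real.pi * _)]
  refine Real.cos_le_cos_of_nonneg_of_le_pi (abs_nonneg _) (by linarith [Real.pi_pos]) ?_
  rw [abs_mul, abs_of_pos (by positivity : (0 : ℝ) < 2 * Real.pi)]
  nlinarith [Real.pi_pos]

/-- The large sieve inequality for frequencies in the unit ball, sampled on a shifted lattice. -/
theorem large_sieve {ι : Type*} [Fintype ι] (hd : 1 ≤ d) {R r : ℝ} (hr0 : 0 < r) (hr1 : r ≤ 1)
    (hr : R * r ≤ 1 / 6) (ζ : ι → Eu d) (hζ : ∀ j, ‖ζ j‖ ≤ 1)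
    (hsep : ∀ j j', j ≠ j' → 2 * r ≤ dist (ζ j) (ζ j')) (a : ι → ℂ) (v : Eu d)
    (S : Finset (Fin d → ℤ)) (hS : ∀ i ∈ S, ‖latticePt i + v‖ ≤ R) :
    ∑ i ∈ S, ‖∑ j, a j * wave (latticePt i + v) (ζ j)‖ ^ 2 ≤
      4 ^ (d + 1) / (r ^ d * (volume : Measure (Eu d)).real (Metric.ball 0 1)) *
        ∑ j, ‖a j‖ ^ 2 := by
  classical
  set vol := (volume : Measure (Eu d)).real (Metric.ball 0 r) with hvol
  have hvol0 : 0 < vol := volume_real_ball_pos _ hr0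
  -- Each frequency is blurred to a ball of radius `r`. The balls are disjoint, so the `L²` norm is
  -- explicit, and the Fourier integral is the exponential sum times the transform of one centred
  -- ball, bounded below on `|u| ≤ R`.
  set H : Eu d → ℂ := fun x => ∑ j, (Metric.ball (ζ j) r).indicator (fun _ => a j) x with hH
  have hint1 : ∀ j, Integrable ((Metric.ball (ζ j) r).indicator fun _ => a j) := fun j =>
    (integrable_indicator_iff Metric.isOpen_ball.measurableSet).2
      (integrableOn_const measure_ball_lt_top.ne)
  have hHint : Integrable H := integrable_finsetSum _ fun j _ => hint1 j
  have hdisj : ∀ x j j', x ∈ Metric.ball (ζ j) r → x ∈ Metric.ball (ζ j') r → j = j' := by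
    intro x j j' h h'
    by_contra hne
    have := hsep j j' hne
    rw [Metric.mem_ball] at h h'
    linarith [dist_triangle_left (ζ j) (ζ j') x]
  have hsq : (fun x => ‖H x‖ ^ 2) =
      fun x => ∑ j, (Metric.ball (ζ j) r).indicator (fun _ => ‖a j‖ ^ 2) x := by
    ext x
    by_cases hx : ∃ j, x ∈ Metric.ball (ζ j) r
    · obtain ⟨j, hj⟩ := hx
      have hz : ∀ j' ∈ Finset.univ, j' ≠ j → x ∉ Metric.ball (ζ j') r :=
        fun j' _ hne h => hne (hdisj x j' j h hj)
      simp only [hH]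
      rw [Finset.sum_eq_single j (fun j' h1 h2 => Set.indicator_of_notMem (hz j' h1 h2) _)
          (by simp),
        Finset.sum_eq_single j (fun j' h1 h2 => Set.indicator_of_notMem (hz j' h1 h2) _)
          (by simp), Set.indicator_of_mem hj, Set.indicator_of_mem hj]
    · push Not at hx
      simp only [hH]
      rw [Finset.sum_eq_zero fun j _ => Set.indicator_of_notMem (hx j) _,
        Finset.sum_eq_zero fun j _ => Set.indicator_of_notMem (hx j) _]
      simp
  have hint2 : ∀ j, Integrable ((Metric.ball (ζ j) r).indicator fun _ => ‖a j‖ ^ 2) := fun j =>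
    (integrable_indicator_iff Metric.isOpen_ball.measurableSet).2
      (integrableOn_const measure_ball_lt_top.ne)
  have hH2 : Integrable fun x => ‖H x‖ ^ 2 := by
    rw [hsq]; exact integrable_finsetSum _ fun j _ => hint2 j
  have hballvol : ∀ x : Eu d, (volume : Measure (Eu d)).real (Metric.ball x r) = vol := fun x => by
    rw [volume_real_ball hd x hr0.le, hvol, volume_real_ball hd 0 hr0.le]
  have hH2val : ∫ x, ‖H x‖ ^ 2 = vol * ∑ j, ‖a j‖ ^ 2 := by
    rw [hsq, integral_finsetSum _ fun j _ => hint2 j, Finset.mul_sum]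
    refine Finset.sum_congr rfl fun j _ => ?_
    rw [integral_indicator Metric.isOpen_ball.measurableSet, setIntegral_const, hballvol,
      smul_eq_mul]
  have hsupp : Function.support H ⊆ cube d := by
    intro x hx
    obtain ⟨j, -, hj⟩ := Finset.exists_ne_zero_of_sum_ne_zero hx
    have hj := Set.mem_of_indicator_ne_zero hj
    refine ball_subset_cube (mem_ball_zero_iff.2 ?_)
    rw [Metric.mem_ball, dist_eq_norm] at hj
    have h1 : ‖x‖ ≤ ‖x - ζ j‖ + ‖ζ j‖ := by simpa using norm_add_le (x - ζ j) (ζ j)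
    linarith [hζ j]
  have hbessel := sum_sq_integral_wave_le hHint hH2 hsupp S v
  have hfourier : ∀ u : Eu d, ∫ x, wave u x * H x =
      (∑ j, a j * wave u (ζ j)) * ∫ x in Metric.ball (0 : Eu d) r, wave u x := by
    intro u
    have hwcont : Continuous fun x => wave u x :=
      continuous_wave.comp (continuous_const.prodMk continuous_id)
    simp only [hH, Finset.mul_sum]
    rw [integral_finsetSum _ fun j _ => (hint1 j).bdd_mul hwcont.aestronglyMeasurable (c := 1)
      (Eventually.of_forall fun x => (norm_wave u x).le), Finset.sum_mul]
    refine Finset.sum_congr rfl fun j _ => ?_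
    rw [← integral_const_mul, ← integral_indicator Metric.isOpen_ball.measurableSet,
      ← integral_add_right_eq_self _ (ζ j)]
    refine integral_congr_ae (Eventually.of_forall fun x => ?_)
    have hmem : x + ζ j ∈ Metric.ball (ζ j) r ↔ x ∈ Metric.ball (0 : Eu d) r := by
      simp [Metric.mem_ball, dist_eq_norm]
    have hw : wave u (x + ζ j) = wave u (ζ j) * wave u x := by
      rw [wave, wave, wave, ← Complex.exp_add, inner_add_right]
      push_cast; ring_nf
    by_cases hx : x ∈ Metric.ball (0 : Eu d) r
    · simp only [Set.indicator_of_mem hx, Set.indicator_of_mem (hmem.2 hx), hw]; ring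
    · simp only [Set.indicator_of_notMem hx, Set.indicator_of_notMem fun h => hx (hmem.1 h),
        mul_zero]
  have hlow : ∑ i ∈ S, ‖∑ j, a j * wave (latticePt i + v) (ζ j)‖ ^ 2 * (vol / 2) ^ 2 ≤
      4 ^ d * (vol * ∑ j, ‖a j‖ ^ 2) := by
    rw [hH2val] at hbessel
    refine le_trans (Finset.sum_le_sum fun i hi => ?_) hbessel
    rw [hfourier, norm_mul, mul_pow]
    gcongr
    exact half_volume_le_norm_integral_ball_wave (hS i hi) hr
  rw [← Finset.sum_mul] at hlow
  have hval : vol = r ^ d * (volume : Measure (Eu d)).real (Metric.ball 0 1) :=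
    volume_real_ball hd 0 hr0.le
  rw [← hval, div_mul_eq_mul_div, le_div_iff₀ hvol0]
  have : (∑ i ∈ S, ‖∑ j, a j * wave (latticePt i + v) (ζ j)‖ ^ 2) * vol * (vol / 4) ≤
      4 ^ (d + 1) * (∑ j, ‖a j‖ ^ 2) * (vol / 4) := by
    rw [pow_succ]; linarith
  exact le_of_mul_le_mul_right this (by positivity)

/-- The discrete restriction estimate: `∑_i |ξ_i|² ≲ R^d |a|²`. -/
theorem exists_sum_sq_discExt_le (hd : 1 ≤ d) :
    ∃ C : ℝ, 1 ≤ C ∧ ∀ R : ℝ, 1 ≤ R → ∀ Λ : Finset (Eu d), IsSphereNet R Λ →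
      ∀ τ : Eu d, ‖τ‖ < 10 / R → ∀ (a : EuclideanSpace ℂ Λ) (v : Eu d) (S : Finset (Fin d → ℤ)),
        (∀ i ∈ S, ‖latticePt i + v‖ ≤ R) →
        ∑ i ∈ S, ‖discExt Λ τ a (latticePt i + v)‖ ^ 2 ≤ C * R ^ d * ‖a‖ ^ 2 := by
  set ω := (volume : Measure (Eu d)).real (Metric.ball 0 1) with hω
  have hω0 : 0 < ω := volume_real_ball_pos _ one_pos
  set C₁ : ℝ := 3 ^ d * (d * 4 ^ d * 40 ^ (d - 1)) with hC₁
  set C₂ : ℝ := 4 ^ (d + 1) * 6 ^ d / ω with hC₂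
  have hC₁0 : 0 ≤ C₁ := by positivity
  have hC₂0 : 0 ≤ C₂ := by positivity
  refine ⟨C₁ + C₂ + 1, by linarith, fun R hR Λ hΛ τ hτ a v S hS => ?_⟩
  have hR0 : 0 < R := by linarith
  have hsq : ‖a‖ ^ 2 = ∑ η, ‖a η‖ ^ 2 := EuclideanSpace.norm_sq_eq a
  -- The threshold `40` puts the shifts below `1/4`, so that shifted nets stay separated. For
  -- smaller `R` the number of samples times the pointwise bound suffices.
  rcases lt_or_ge R 40 with h40 | h40
  · have hS' : S ⊆ latticeBox R v := fun i hi => mem_latticeBox (hS i hi)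
    have h1 : (S.card : ℝ) ≤ (3 * R) ^ d := by
      calc (S.card : ℝ) ≤ (latticeBox R v).card := by exact_mod_cast Finset.card_le_card hS'
        _ ≤ (2 * R + 1) ^ d := card_latticeBox_le hR0.le v
        _ ≤ _ := by gcongr; linarith
    calc ∑ i ∈ S, ‖discExt Λ τ a (latticePt i + v)‖ ^ 2
        ≤ ∑ _i ∈ S, (d * 4 ^ d * 40 ^ (d - 1)) * ‖a‖ ^ 2 := by
          refine Finset.sum_le_sum fun i _ => ?_
          have h2 := pow_le_pow_left₀ (norm_nonneg _) (norm_discExt_le τ a (latticePt i + v)) 2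
          rw [mul_pow, Real.sq_sqrt (by positivity)] at h2
          refine h2.trans ?_
          gcongr
          exact (hΛ.card_le hd hR).trans (by gcongr)
      _ = S.card * ((d * 4 ^ d * 40 ^ (d - 1)) * ‖a‖ ^ 2) := by
          rw [Finset.sum_const, nsmul_eq_mul]
      _ ≤ (3 * R) ^ d * ((d * 4 ^ d * 40 ^ (d - 1)) * ‖a‖ ^ 2) := by gcongr
      _ = C₁ * R ^ d * ‖a‖ ^ 2 := by rw [hC₁, mul_pow]; ring
      _ ≤ _ := by gcongr; linarith
  · have hτ4 : ‖τ‖ ≤ 1 / 4 := by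
      refine hτ.le.trans ?_
      rw [div_le_div_iff₀ hR0 (by norm_num)]; linarith
    have h6R : 0 < 6 * R := by positivity
    -- This radius gives `R * r = 1/6`, and `2r = 1/(3R)` lies below the separation `1/(2R)` of the
    -- shifted net.
    have h1 := large_sieve hd (R := R) (r := 1 / (6 * R)) (by positivity)
      (by rw [div_le_one h6R]; linarith) (le_of_eq (by field_simp))
      (fun η : Λ => shift (η : Eu d) τ) (fun η => norm_shift_le _ _) ?_ (fun η => a η) v S hS
    · rw [← hsq] at h1
      refine h1.trans ?_
      have h2 : 4 ^ (d + 1) / ((1 / (6 * R)) ^ d * ω) = C₂ * R ^ d := by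
        rw [hC₂, div_pow, one_pow, mul_pow]; field_simp
      rw [h2]
      gcongr
      linarith
    · intro η η' hne
      have h2 := hΛ.2.1 η η.2 η' η'.2 (fun h => hne (Subtype.ext h))
      have h3 := norm_sub_le_shift (hΛ.1 η η.2) (hΛ.1 η' η'.2) hτ4
      rw [dist_eq_norm] at h2 ⊢
      have h4 : 2 * (1 / (6 * R)) ≤ (1 / R) / 2 := by
        rw [div_div, mul_one_div, div_le_div_iff₀ h6R (by positivity)]; linarith
      linarith

end LargeSieve

end RandomExtension

namespace RandomExtension

/-! ### Subgaussian behaviour of the noise. -/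

section Noise

/-- The Gaussian case is explicit and the Bernoulli case is Hoeffding's lemma on `[-1,1]`.
Subgaussianity is all that the later estimates take from the law. -/
theorem IsNoiseLaw.exists_hasSubgaussianMGF {μ : Measure ℝ} [IsProbabilityMeasure μ]
    (hμ : IsNoiseLaw μ) : ∃ K : NNReal, HasSubgaussianMGF id K μ := by
  rcases hμ with ⟨v, rfl⟩ | h
  · refine ⟨v, fun t => integrable_exp_mul_gaussianReal t, fun t => ?_⟩
    rw [mgf_id_gaussianReal]
    simp
  · refine ⟨_, hasSubgaussianMGF_of_mem_Icc_of_integral_eq_zero (a := -1) (b := 1)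
      aemeasurable_id ?_ ?_⟩
    · rw [h, Measure.ae_ennreal_smul_measure_iff (by simp), ae_add_measure_iff, ae_dirac_iff
        (measurableSet_Icc.preimage measurable_id), ae_dirac_iff
        (measurableSet_Icc.preimage measurable_id)]
      norm_num
    · rw [h, integral_smul_measure, integral_add_measure (integrable_dirac (by simp))
        (integrable_dirac (by simp))]
      simp

variable {d : ℕ} {μ : Measure ℝ} [IsProbabilityMeasure μ]

instance : IsProbabilityMeasure (noise d μ) := by
  unfold noise; infer_instance

theorem measurePreserving_noise_eval (n : Fin d → ℤ) :
    MeasurePreserving (fun ω : (Fin d → ℤ) → ℝ => ω n) (noise d μ) μ :=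
  measurePreserving_eval_infinitePi (fun _ : Fin d → ℤ => μ) n

theorem hasSubgaussianMGF_noise_sum {K : NNReal} (hK : HasSubgaussianMGF id K μ)
    (S : Finset (Fin d → ℤ)) (t : (Fin d → ℤ) → ℝ) :
    HasSubgaussianMGF (fun ω => ∑ n ∈ S, t n * ω n)
      (∑ n ∈ S, (t n ^ 2).toNNReal * K) (noise d μ) := by
  have hind : iIndepFun (fun (n : Fin d → ℤ) (ω : (Fin d → ℤ) → ℝ) => t n * ω n) (noise d μ) :=
    iIndepFun_infinitePi (P := fun _ : Fin d → ℤ => μ) (X := fun n x => t n * x)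
      fun n => by fun_prop
  refine HasSubgaussianMGF.sum_of_iIndepFun hind fun n _ => ?_
  rw [Real.toNNReal_of_nonneg (sq_nonneg _)]
  refine HasSubgaussianMGF.const_mul ?_ (t n)
  have hp := measurePreserving_noise_eval (μ := μ) n
  rw [← HasSubgaussianMGF.id_map_iff hp.measurable.aemeasurable, hp.map_eq]
  exact hK

theorem lintegral_noise_eval (n : Fin d → ℤ) {f : ℝ → ENNReal} (hf : Measurable f) :
    ∫⁻ ω, f (ω n) ∂(noise d μ) = ∫⁻ x, f x ∂μ :=
  (measurePreserving_noise_eval n).lintegral_comp hf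

end Noise

/-! ### Second moment of a maximum of subgaussian variables. -/

section Maximal

variable {Ω : Type*} [MeasurableSpace Ω] {P : Measure Ω}

/-- Below the level `T` the first term suffices; the excess `x - T` is dominated by the quadratic
term of the exponential series. A maximum can then be replaced by a sum in the exponential part
only. -/
theorem sq_le_exp_bound {x T l : ℝ} (hx : 0 ≤ x) (hl : 0 < l) :
    x ^ 2 ≤ 2 * T ^ 2 + 4 / l ^ 2 * Real.exp (l * (x - T)) := by
  rcases le_total x T with h | h
  · have h1 : x ^ 2 ≤ T ^ 2 := pow_le_pow_left₀ hx h 2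
    have h2 : 0 ≤ 4 / l ^ 2 * Real.exp (l * (x - T)) := by positivity
    nlinarith [sq_nonneg T]
  · have h1 : (l * (x - T)) ^ 2 / 2 ≤ Real.exp (l * (x - T)) := by
      have h0 : 0 ≤ l * (x - T) := mul_nonneg hl.le (by linarith)
      have := Real.quadratic_le_exp_of_nonneg h0
      linarith
    have h2 : 4 / l ^ 2 * ((l * (x - T)) ^ 2 / 2) ≤ 4 / l ^ 2 * Real.exp (l * (x - T)) := by
      gcongr
    have h3 : 4 / l ^ 2 * ((l * (x - T)) ^ 2 / 2) = 2 * (x - T) ^ 2 := by field_simp; ring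
    rw [h3] at h2
    nlinarith [sq_nonneg (x - 2 * T)]

theorem sq_abs_le_exp_bound {T l : ℝ} (hl : 0 < l) (x : ℝ) :
    x ^ 2 ≤ 2 * T ^ 2 + 4 / l ^ 2 * Real.exp (-(l * T)) *
      (Real.exp (l * x) + Real.exp (-l * x)) := by
  rw [← sq_abs]
  refine (sq_le_exp_bound (T := T) (abs_nonneg x) hl).trans ?_
  rw [mul_assoc, mul_sub, sub_eq_neg_add, Real.exp_add]
  gcongr
  rcases abs_cases x with ⟨h, -⟩ | ⟨h, -⟩ <;> rw [h]
  · linarith [Real.exp_pos (-l * x)]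
  · rw [show l * -x = -l * x by ring]; linarith [Real.exp_pos (l * x)]

theorem lintegral_exp_le {X : Ω → ℝ} {c : NNReal} (hX : HasSubgaussianMGF X c P) (t : ℝ) :
    ∫⁻ ω, ENNReal.ofReal (Real.exp (t * X ω)) ∂P ≤ ENNReal.ofReal (Real.exp (c * t ^ 2 / 2)) := by
  rw [← ofReal_integral_eq_lintegral_ofReal (hX.integrable_exp_mul t)
    (Eventually.of_forall fun _ => (Real.exp_pos _).le)]
  exact ENNReal.ofReal_le_ofReal (hX.mgf_le t)

/-- The second moment of the maximum of finitely many subgaussian variables. -/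
theorem lintegral_iSup_sq_le_of_pos [IsProbabilityMeasure P] {ι : Type*} (F : Finset ι) (X : ι → Ω → ℂ) {c L : ℝ}
    (hc : 0 < c) (hL : 1 ≤ L) (hF : (F.card : ℝ) ≤ Real.exp L)
    (hre : ∀ i ∈ F, ∃ c' : NNReal, c' ≤ c ∧ HasSubgaussianMGF (fun ω => (X i ω).re) c' P)
    (him : ∀ i ∈ F, ∃ c' : NNReal, c' ≤ c ∧ HasSubgaussianMGF (fun ω => (X i ω).im) c' P) :
    ∫⁻ ω, (⨆ i ∈ F, ‖X i ω‖ₑ) ^ 2 ∂P ≤ ENNReal.ofReal (16 * L * c) := by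
  -- Each exponential moment is then at most `exp(L)`. With `l * T = 2L`, the factor `exp(-2L)`
  -- cancels this moment and the cardinality, and both remaining terms are of order `L * c`.
  set l := Real.sqrt (2 * L / c) with hl
  have hl0 : 0 < l := Real.sqrt_pos.2 (by positivity)
  have hl2 : l ^ 2 = 2 * L / c := Real.sq_sqrt (by positivity)
  set T := 2 * L / l with hT
  have hT0 : 0 ≤ T := by positivity
  have hlT : l * T = 2 * L := by rw [hT]; field_simp
  set q := 4 / l ^ 2 * Real.exp (-(l * T)) with hq
  have hq0 : 0 ≤ q := by positivity
  have hpt : ∀ ω, (⨆ i ∈ F, ‖X i ω‖ₑ) ^ 2 ≤ ENNReal.ofReal (4 * T ^ 2) +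
      ∑ i ∈ F, ENNReal.ofReal q * (ENNReal.ofReal (Real.exp (l * (X i ω).re)) +
        ENNReal.ofReal (Real.exp (-l * (X i ω).re)) + ENNReal.ofReal (Real.exp (l * (X i ω).im)) +
        ENNReal.ofReal (Real.exp (-l * (X i ω).im))) := by
    intro ω
    have hle : ∀ b : ENNReal, (∀ i ∈ F, ‖X i ω‖ₑ ^ 2 ≤ b) → (⨆ i ∈ F, ‖X i ω‖ₑ) ^ 2 ≤ b := by
      intro b hb
      have h1 : ∀ x : ENNReal, x ^ 2 ≤ b ↔ x ≤ b ^ (1 / 2 : ℝ) := fun x => by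
        rw [← ENNReal.rpow_natCast, one_div, ENNReal.le_rpow_inv_iff (by norm_num)]
        norm_num
      rw [h1]
      exact iSup₂_le fun i hi => (h1 _).1 (hb i hi)
    refine hle _ fun i hi => ?_
    refine le_trans ?_ (add_le_add_right (Finset.single_le_sum (f := fun i =>
      ENNReal.ofReal q * (ENNReal.ofReal (Real.exp (l * (X i ω).re)) +
        ENNReal.ofReal (Real.exp (-l * (X i ω).re)) + ENNReal.ofReal (Real.exp (l * (X i ω).im)) +
        ENNReal.ofReal (Real.exp (-l * (X i ω).im)))) (fun _ _ => zero_le) hi) _)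
    rw [← ofReal_norm, ← ENNReal.ofReal_pow (norm_nonneg _),
      ← ENNReal.ofReal_add (by positivity) (by positivity),
      ← ENNReal.ofReal_add (by positivity) (by positivity),
      ← ENNReal.ofReal_add (by positivity) (by positivity), ← ENNReal.ofReal_mul hq0,
      ← ENNReal.ofReal_add (by positivity) (by positivity)]
    refine ENNReal.ofReal_le_ofReal ?_
    rw [← Complex.normSq_eq_norm_sq, Complex.normSq_apply]
    have h1 := sq_abs_le_exp_bound (T := T) hl0 (X i ω).re
    have h2 := sq_abs_le_exp_bound (T := T) hl0 (X i ω).im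
    rw [← hq] at h1 h2
    linarith
  have hexp : ∀ (Y : Ω → ℝ) (t : ℝ), t ^ 2 = l ^ 2 →
      (∃ c' : NNReal, c' ≤ c ∧ HasSubgaussianMGF Y c' P) →
      ∫⁻ ω, ENNReal.ofReal (Real.exp (t * Y ω)) ∂P ≤ ENNReal.ofReal (Real.exp L) := by
    rintro Y t ht ⟨c', hc', hY⟩
    refine (lintegral_exp_le hY t).trans (ENNReal.ofReal_le_ofReal (Real.exp_le_exp.2 ?_))
    rw [ht, hl2]
    calc (c' : ℝ) * (2 * L / c) / 2 ≤ c * (2 * L / c) / 2 := by gcongr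
      _ = L := by field_simp
  have hmeas : ∀ (Y : Ω → ℝ) (t : ℝ), (∃ c' : NNReal, c' ≤ c ∧ HasSubgaussianMGF Y c' P) →
      AEMeasurable (fun ω => ENNReal.ofReal (Real.exp (t * Y ω))) P := by
    rintro Y t ⟨c', -, hY⟩
    exact ((hY.aemeasurable.const_mul t).exp).ennreal_ofReal
  calc _ ≤ ∫⁻ ω, (ENNReal.ofReal (4 * T ^ 2) +
      ∑ i ∈ F, ENNReal.ofReal q * (ENNReal.ofReal (Real.exp (l * (X i ω).re)) +
        ENNReal.ofReal (Real.exp (-l * (X i ω).re)) + ENNReal.ofReal (Real.exp (l * (X i ω).im)) +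
        ENNReal.ofReal (Real.exp (-l * (X i ω).im)))) ∂P := lintegral_mono hpt
    _ ≤ ENNReal.ofReal (4 * T ^ 2) + ∑ _i ∈ F, ENNReal.ofReal q *
        (ENNReal.ofReal (Real.exp L) + ENNReal.ofReal (Real.exp L) + ENNReal.ofReal (Real.exp L) +
          ENNReal.ofReal (Real.exp L)) := by
        rw [lintegral_add_left measurable_const, lintegral_const, measure_univ, mul_one,
          lintegral_finsetSum' F fun i hi => ?_]
        · gcongr with i hi
          rw [lintegral_const_mul' _ _ ENNReal.ofReal_ne_top,
            lintegral_add_right' _ (hmeas _ (-l) (him i hi)),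
            lintegral_add_right' _ (hmeas _ l (him i hi)),
            lintegral_add_right' _ (hmeas _ (-l) (hre i hi))]
          gcongr
          exacts [hexp _ _ rfl (hre i hi), hexp _ _ (neg_sq l) (hre i hi), hexp _ _ rfl (him i hi),
            hexp _ _ (neg_sq l) (him i hi)]
        · have m1 := hmeas _ l (hre i hi)
          have m2 := hmeas _ (-l) (hre i hi)
          have m3 := hmeas _ l (him i hi)
          have m4 := hmeas _ (-l) (him i hi)
          exact (((m1.add m2).add m3).add m4).const_mul _
    _ = ENNReal.ofReal (4 * T ^ 2 + F.card * (q * (4 * Real.exp L))) := by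
        rw [Finset.sum_const, nsmul_eq_mul, ← ENNReal.ofReal_add (by positivity) (by positivity),
          ← ENNReal.ofReal_add (by positivity) (by positivity),
          ← ENNReal.ofReal_add (by positivity) (by positivity), ← ENNReal.ofReal_mul hq0,
          ← ENNReal.ofReal_natCast, ← ENNReal.ofReal_mul (by positivity),
          ← ENNReal.ofReal_add (by positivity) (by positivity)]
        ring_nf
    _ ≤ _ := by
        refine ENNReal.ofReal_le_ofReal ?_
        have h1 : (F.card : ℝ) * (q * (4 * Real.exp L)) ≤ 16 / l ^ 2 := by
          calc _ ≤ Real.exp L * (q * (4 * Real.exp L)) := by gcongr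
            _ = 16 / l ^ 2 * (Real.exp L * Real.exp L * Real.exp (-(2 * L))) := by
                rw [hq, hlT]; ring
            _ = _ := by
                rw [← Real.exp_add, ← Real.exp_add]; ring_nf; simp
        have h2 : 4 * T ^ 2 = 8 * L * c := by
          rw [hT, div_pow, hl2]; field_simp; ring
        have h3 : 16 / l ^ 2 ≤ 8 * L * c := by
          rw [hl2, div_div_eq_mul_div, div_le_iff₀ (by positivity)]
          nlinarith [mul_le_mul hL hL zero_le_one (by linarith)]
        linarith

/-- The variance proxy may vanish, for instance when `V = 0`. It is enlarged by an arbitrarily small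
amount to reach the positive case. -/
theorem lintegral_iSup_sq_le [IsProbabilityMeasure P] {ι : Type*} (F : Finset ι) (X : ι → Ω → ℂ) {c L : ℝ}
    (hc : 0 ≤ c) (hL : 1 ≤ L) (hF : (F.card : ℝ) ≤ Real.exp L)
    (hre : ∀ i ∈ F, ∃ c' : NNReal, c' ≤ c ∧ HasSubgaussianMGF (fun ω => (X i ω).re) c' P)
    (him : ∀ i ∈ F, ∃ c' : NNReal, c' ≤ c ∧ HasSubgaussianMGF (fun ω => (X i ω).im) c' P) :
    ∫⁻ ω, (⨆ i ∈ F, ‖X i ω‖ₑ) ^ 2 ∂P ≤ ENNReal.ofReal (16 * L * c) := by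
  refine ENNReal.le_of_forall_pos_le_add fun ε hε _ => ?_
  have hε' : (0 : ℝ) < ε / (16 * L) := by positivity
  have hmono : ∀ Y : Ω → ℝ, (∃ c' : NNReal, c' ≤ c ∧ HasSubgaussianMGF Y c' P) →
      ∃ c' : NNReal, c' ≤ c + ε / (16 * L) ∧ HasSubgaussianMGF Y c' P := by
    rintro Y ⟨c', h1, h2⟩
    exact ⟨c', by linarith, h2⟩
  refine (lintegral_iSup_sq_le_of_pos F X (c := c + ε / (16 * L)) (by linarith) hL hF
    (fun i hi => hmono _ (hre i hi)) fun i hi => hmono _ (him i hi)).trans (le_of_eq ?_)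
  rw [mul_add, mul_div_cancel₀ _ (by positivity), ENNReal.ofReal_add (by positivity) (by positivity),
    ENNReal.ofReal_coe_nnreal]

end Maximal

end RandomExtension

namespace RandomExtension

/-! ### Moments of the chaining terms at fixed `y`, `τ`, `τ'`. -/

section ChainTerm

variable {d : ℕ}

/-- The lattice points `i` with `|i + y - c| < R`. -/
noncomputable def sampleSet (R : ℝ) (c y : Eu d) : Finset (Fin d → ℤ) :=
  (latticeBox R (y - c)).filter fun i => ‖latticePt i + y - c‖ < R

theorem mem_sampleSet {R : ℝ} {c y : Eu d} {i : Fin d → ℤ} :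
    i ∈ sampleSet R c y ↔ ‖latticePt i + y - c‖ < R := by
  rw [sampleSet, Finset.mem_filter, and_iff_right_iff_imp]
  intro h
  rw [add_sub_assoc] at h
  exact mem_latticeBox h.le

theorem card_sampleSet_le {R : ℝ} (hR : 1 ≤ R) (c y : Eu d) :
    ((sampleSet R c y).card : ℝ) ≤ (3 * R) ^ d := by
  calc ((sampleSet R c y).card : ℝ) ≤ (latticeBox R (y - c)).card := by
        exact_mod_cast Finset.card_filter_le _ _
    _ ≤ (2 * R + 1) ^ d := card_latticeBox_le (by linarith) _
    _ ≤ _ := by gcongr; linarith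

/-- The support of `V` removes the other points. The remaining ones satisfy `|i + y - c| < R`,
exactly the range in which the chain norm controls the discrete extensions. -/
theorem chainTerm_eq_sum {R : ℝ} (h : ℝ) (w : (Fin d → ℤ) → ℝ) {V : Eu d → ℂ} {c : Eu d}
    (hV : Function.support V ⊆ Metric.ball c R) (Λ : Finset (Eu d)) (b b' : EuclideanSpace ℂ Λ)
    (y τ τ' : Eu d) :
    chainTerm h w V c Λ b b' y τ τ' = ∑ i ∈ sampleSet R c y,
      starRingEnd ℂ (anderson h w V (latticePt i + y) * discExt Λ τ b (latticePt i + y - c)) *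
        discExt Λ τ' b' (latticePt i + y - c) := by
  refine tsum_eq_sum fun i hi => ?_
  have h0 : V (latticePt i + y) = 0 := by
    by_contra hne
    have := hV (Function.mem_support.2 hne)
    rw [Metric.mem_ball, dist_eq_norm] at this
    exact hi (mem_sampleSet.2 this)
  simp [anderson, h0]

theorem IsChain.norm_le_of_mem_links {R : ℝ} {Λ : Finset (Eu d)}
    {Z : ℕ → Finset (EuclideanSpace ℂ Λ)} (hZ : IsChain R Λ Z) {k : ℕ} {b : EuclideanSpace ℂ Λ}
    (hb : b ∈ links R Λ Z k) : ‖b‖ ≤ 2 := by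
  obtain ⟨z, hz, z', hz', rfl, -⟩ := hb
  have h1 := (hZ.2 k).1.1 z hz
  have h2 := (hZ.2 (k + 1)).1.1 z' hz'
  linarith [norm_sub_le z' z]

theorem norm_discExt_le_of_mem_links {R : ℝ} {Λ : Finset (Eu d)}
    {Z : ℕ → Finset (EuclideanSpace ℂ Λ)} {k : ℕ} {b : EuclideanSpace ℂ Λ}
    (hb : b ∈ links R Λ Z k) {τ u : Eu d} (hτ : ‖τ‖ < 10 / R) (hu : ‖u‖ < R) :
    ‖discExt Λ τ b u‖ ≤ 2 * ((2 : ℝ)⁻¹ ^ k * Real.sqrt Λ.card) := by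
  obtain ⟨z, hz, z', hz', hb, hle⟩ := hb
  rw [chainScale, ← ENNReal.ofReal_ofNat, ← ENNReal.ofReal_mul (by norm_num),
    chainNorm_le_ofReal_iff (by positivity)] at hle
  exact hle τ hτ u hu

theorem norm_anderson (h : ℝ) (w : (Fin d → ℤ) → ℝ) (V : Eu d → ℂ) (x : Eu d) :
    ‖anderson h w V x‖ = |w (cell h x)| * ‖V x‖ := by
  rw [anderson, norm_mul, Complex.norm_real, Real.norm_eq_abs]

/-- Both links are estimated in the sup norm. No cancellation is used, but the bound decays in both
indices, which makes the chain summable. -/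
theorem maxTerm_le_ofReal {R h : ℝ} (w : (Fin d → ℤ) → ℝ) {V : Eu d → ℂ} {c : Eu d}
    (hV : Function.support V ⊆ Metric.ball c R) (Λ : Finset (Eu d))
    (Z : ℕ → Finset (EuclideanSpace ℂ Λ)) (k k' : ℕ) {y τ τ' : Eu d} {B : ℝ}
    (hB : ∀ i, ‖V (latticePt i + y)‖ ≤ B) (hτ : ‖τ‖ < 10 / R) (hτ' : ‖τ'‖ < 10 / R) :
    maxTerm R h w V c Λ Z k k' y τ τ' ≤ ENNReal.ofReal
      (4 * (2 : ℝ)⁻¹ ^ (k + k') * Λ.card * B *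
        ∑ i ∈ sampleSet R c y, |w (cell h (latticePt i + y))|) := by
  refine iSup₂_le fun b hb => iSup₂_le fun b' hb' => ?_
  rw [← ofReal_norm, chainTerm_eq_sum h w hV]
  refine ENNReal.ofReal_le_ofReal ((norm_sum_le _ _).trans ?_)
  rw [Finset.mul_sum]
  refine Finset.sum_le_sum fun i hi => ?_
  have hu := mem_sampleSet.1 hi
  have h1 := norm_discExt_le_of_mem_links hb hτ hu
  have h2 := norm_discExt_le_of_mem_links hb' hτ' hu
  have hB0 : 0 ≤ B := (norm_nonneg _).trans (hB i)
  rw [norm_mul, RCLike.norm_conj, norm_mul, norm_anderson]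
  calc _ ≤ |w (cell h (latticePt i + y))| * B * (2 * ((2 : ℝ)⁻¹ ^ k * Real.sqrt Λ.card)) *
        (2 * ((2 : ℝ)⁻¹ ^ k' * Real.sqrt Λ.card)) := by
        gcongr
        exact hB i
    _ = 4 * (2 : ℝ)⁻¹ ^ (k + k') * (Real.sqrt Λ.card * Real.sqrt Λ.card) * B *
        |w (cell h (latticePt i + y))| := by ring
    _ = _ := by rw [Real.mul_self_sqrt (by positivity)]

/-- The coefficient of `w n` in the chaining term. -/
noncomputable def cellCoeff (R h : ℝ) (V : Eu d → ℂ) (c : Eu d) (Λ : Finset (Eu d))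
    (b b' : EuclideanSpace ℂ Λ) (y τ τ' : Eu d) (n : Fin d → ℤ) : ℂ :=
  ∑ i ∈ (sampleSet R c y).filter fun i => cell h (latticePt i + y) = n,
    starRingEnd ℂ (V (latticePt i + y) * discExt Λ τ b (latticePt i + y - c)) *
      discExt Λ τ' b' (latticePt i + y - c)

theorem chainTerm_eq_sum_cells {R : ℝ} (h : ℝ) (w : (Fin d → ℤ) → ℝ) {V : Eu d → ℂ} {c : Eu d}
    (hV : Function.support V ⊆ Metric.ball c R) (Λ : Finset (Eu d)) (b b' : EuclideanSpace ℂ Λ)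
    (y τ τ' : Eu d) :
    chainTerm h w V c Λ b b' y τ τ' =
      ∑ n ∈ (sampleSet R c y).image fun i => cell h (latticePt i + y),
        cellCoeff R h V c Λ b b' y τ τ' n * (w n : ℂ) := by
  classical
  rw [chainTerm_eq_sum h w hV, ← Finset.sum_fiberwise_of_maps_to
    (g := fun i => cell h (latticePt i + y)) (fun i hi => Finset.mem_image.2 ⟨i, hi, rfl⟩)]
  refine Finset.sum_congr rfl fun n _ => ?_
  rw [cellCoeff, Finset.sum_mul]
  refine Finset.sum_congr rfl fun i hi => ?_
  rw [anderson, (Finset.mem_filter.1 hi).2, map_mul, map_mul, map_mul, Complex.conj_ofReal]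
  ring

/-- Cauchy–Schwarz inside each noise cell costs its number of lattice points; the cells partition
the sample set. The left side is the variance of the chaining term up to the law of the noise. -/
theorem sum_sq_cellCoeff_le {R h : ℝ} (hh : 0 < h) {V : Eu d → ℂ} {c : Eu d} (Λ : Finset (Eu d))
    (b b' : EuclideanSpace ℂ Λ) {y τ τ' : Eu d} {B : ℝ} (hB : ∀ i, ‖V (latticePt i + y)‖ ≤ B) :
    ∑ n ∈ (sampleSet R c y).image fun i => cell h (latticePt i + y),
        ‖cellCoeff R h V c Λ b b' y τ τ' n‖ ^ 2 ≤
      (h + 1) ^ d * B ^ 2 * ∑ i ∈ sampleSet R c y,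
        ‖discExt Λ τ b (latticePt i + y - c)‖ ^ 2 * ‖discExt Λ τ' b' (latticePt i + y - c)‖ ^ 2 := by
  classical
  rw [← Finset.sum_fiberwise_of_maps_to (s := sampleSet R c y)
    (g := fun i => cell h (latticePt i + y)) (fun i hi => Finset.mem_image.2 ⟨i, hi, rfl⟩),
    Finset.mul_sum]
  refine Finset.sum_le_sum fun n _ => ?_
  set S := (sampleSet R c y).filter fun i => cell h (latticePt i + y) = n with hS
  have hcard : (S.card : ℝ) ≤ (h + 1) ^ d :=
    card_le_of_cell_eq hh y n S fun i hi => (Finset.mem_filter.1 hi).2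
  have h1 : ‖cellCoeff R h V c Λ b b' y τ τ' n‖ ≤ ∑ i ∈ S,
      B * (‖discExt Λ τ b (latticePt i + y - c)‖ * ‖discExt Λ τ' b' (latticePt i + y - c)‖) := by
    refine (norm_sum_le _ _).trans (Finset.sum_le_sum fun i _ => ?_)
    rw [norm_mul, RCLike.norm_conj, norm_mul, mul_assoc]
    gcongr
    exact hB i
  calc _ ≤ (∑ i ∈ S, B * (‖discExt Λ τ b (latticePt i + y - c)‖ *
        ‖discExt Λ τ' b' (latticePt i + y - c)‖)) ^ 2 := by gcongr
    _ ≤ S.card * ∑ i ∈ S, (B * (‖discExt Λ τ b (latticePt i + y - c)‖ *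
        ‖discExt Λ τ' b' (latticePt i + y - c)‖)) ^ 2 := sq_sum_le_card_mul_sum_sq
    _ ≤ (h + 1) ^ d * ∑ i ∈ S, (B * (‖discExt Λ τ b (latticePt i + y - c)‖ *
        ‖discExt Λ τ' b' (latticePt i + y - c)‖)) ^ 2 := by gcongr
    _ = _ := by
        rw [mul_assoc, Finset.mul_sum S _ (B ^ 2)]
        congr 1
        refine Finset.sum_congr rfl fun i _ => ?_
        ring

theorem measurable_maxTerm_noise {R h : ℝ} {V : Eu d → ℂ} {c : Eu d}
    (hV : Function.support V ⊆ Metric.ball c R) (Λ : Finset (Eu d))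
    (Z : ℕ → Finset (EuclideanSpace ℂ Λ)) (k k' : ℕ) (y τ τ' : Eu d)
    (hfin : ∀ k, (links R Λ Z k).Countable) :
    Measurable fun w : (Fin d → ℤ) → ℝ => maxTerm R h w V c Λ Z k k' y τ τ' := by
  unfold maxTerm
  refine Measurable.biSup _ (hfin k) fun b _ => Measurable.biSup _ (hfin k') fun b' _ => ?_
  refine Measurable.enorm ?_
  simp only [chainTerm_eq_sum_cells h _ hV]
  fun_prop

theorem countable_links {R : ℝ} {Λ : Finset (Eu d)} (Z : ℕ → Finset (EuclideanSpace ℂ Λ)) (k : ℕ) :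
    (links R Λ Z k).Countable := by
  classical
  refine Set.Countable.mono (s₂ := ↑((Z k ×ˢ Z (k + 1)).image fun p => p.2 - p.1)) ?_
    (Finset.countable_toSet _)
  rintro b ⟨z, hz, z', hz', rfl, -⟩
  exact Finset.mem_coe.2 (Finset.mem_image.2 ⟨(z, z'), Finset.mem_product.2 ⟨hz, hz'⟩, rfl⟩)

/-- The variance of the chaining term is at most
`≲ ⟨h⟩^d |Λ| R^d 4^{-j} ‖V‖²` if one of the two factors is a link of order `j`. -/
theorem exists_variance_le (hd : 1 ≤ d) :
    ∃ C : ℝ, 1 ≤ C ∧ ∀ R : ℝ, 1 ≤ R → ∀ Λ : Finset (Eu d), IsSphereNet R Λ →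
      ∀ Z : ℕ → Finset (EuclideanSpace ℂ Λ), IsChain R Λ Z → ∀ (k k' : ℕ) (c y τ τ' : Eu d),
      ‖τ‖ < 10 / R → ‖τ'‖ < 10 / R → ∀ b ∈ links R Λ Z k, ∀ b' ∈ links R Λ Z k',
      ∑ i ∈ sampleSet R c y, ‖discExt Λ τ b (latticePt i + y - c)‖ ^ 2 *
          ‖discExt Λ τ' b' (latticePt i + y - c)‖ ^ 2 ≤
        C * (R ^ (d - 1) * R ^ d) / 4 ^ max k k' := by
  obtain ⟨C, hC1, hC⟩ := exists_sum_sq_discExt_le hd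
  have hd1 : (1 : ℝ) ≤ d * 4 ^ d := by
    have h1 : (1 : ℝ) ≤ d := by exact_mod_cast hd
    have h2 : (1 : ℝ) ≤ 4 ^ d := one_le_pow₀ (by norm_num)
    nlinarith
  refine ⟨16 * C * (d * 4 ^ d), by nlinarith, ?_⟩
  intro R hR Λ hΛ Z hZ k k' c y τ τ' hτ hτ' b hb b' hb'
  have hR0 : 0 < R := by linarith
  -- The link of order `j` is taken in the sup norm and the other one in `ℓ²` by the large sieve.
  -- The roles are symmetric, so `j` may be the larger of the two orders.
  have key : ∀ (j j' : ℕ) (σ σ' : Eu d), ‖σ‖ < 10 / R → ‖σ'‖ < 10 / R → ∀ a ∈ links R Λ Z j,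
      ∀ a' ∈ links R Λ Z j', ∑ i ∈ sampleSet R c y, ‖discExt Λ σ a (latticePt i + y - c)‖ ^ 2 *
          ‖discExt Λ σ' a' (latticePt i + y - c)‖ ^ 2 ≤
        16 * C * (d * 4 ^ d) * (R ^ (d - 1) * R ^ d) / 4 ^ j := by
    intro j j' σ σ' hσ hσ' a ha a' ha'
    have h1 := hC R hR Λ hΛ σ' hσ' a' (y - c) (sampleSet R c y) fun i hi => by
      rw [← add_sub_assoc]; exact (mem_sampleSet.1 hi).le
    have h2 := hZ.norm_le_of_mem_links ha'
    simp only [← add_sub_assoc] at h1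
    calc _ ≤ ∑ i ∈ sampleSet R c y, 4 * (Λ.card / 4 ^ j) *
          ‖discExt Λ σ' a' (latticePt i + y - c)‖ ^ 2 := by
          refine Finset.sum_le_sum fun i hi => ?_
          gcongr
          have h3 := pow_le_pow_left₀ (norm_nonneg _)
            (norm_discExt_le_of_mem_links ha hσ (mem_sampleSet.1 hi)) 2
          refine h3.trans (le_of_eq ?_)
          rw [mul_pow, mul_pow, Real.sq_sqrt (by positivity), inv_pow, inv_pow, ← pow_mul,
            mul_comm j 2, pow_mul]
          norm_num
          field_simp
      _ = 4 * (Λ.card / 4 ^ j) * ∑ i ∈ sampleSet R c y,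
          ‖discExt Λ σ' a' (latticePt i + y - c)‖ ^ 2 := by rw [Finset.mul_sum]
      _ ≤ 4 * ((d * 4 ^ d * R ^ (d - 1)) / 4 ^ j) * (C * R ^ d * 2 ^ 2) := by
          gcongr
          · exact hΛ.card_le hd hR
          · refine h1.trans ?_
            gcongr
      _ = _ := by ring
  rcases max_cases k k' with ⟨h, -⟩ | ⟨h, -⟩
  · rw [h]; exact key k k' τ τ' hτ hτ' b hb b' hb'
  · rw [h]
    refine le_trans (le_of_eq ?_) (key k' k τ' τ hτ' hτ b' hb' b hb)
    exact Finset.sum_congr rfl fun i _ => mul_comm _ _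

/-- The second moment of the maximum over the links. -/
theorem exists_lintegral_maxTerm_sq_le (hd : 1 ≤ d) {μ : Measure ℝ} [IsProbabilityMeasure μ]
    {K : NNReal} (hK : HasSubgaussianMGF id K μ) :
    ∃ C : ℝ, 1 ≤ C ∧ ∀ (R h : ℝ), 1 ≤ R → 0 < h → ∀ (c : Eu d) (V : Eu d → ℂ),
      Function.support V ⊆ Metric.ball c R → ∀ Λ : Finset (Eu d), IsSphereNet R Λ →
      ∀ Z : ℕ → Finset (EuclideanSpace ℂ Λ), IsChain R Λ Z → ∀ (k k' : ℕ) (y τ τ' : Eu d) (B : ℝ),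
      0 ≤ B → (∀ i, ‖V (latticePt i + y)‖ ≤ B) → ‖τ‖ < 10 / R → ‖τ'‖ < 10 / R →
      ∫⁻ ω, maxTerm R h ω V c Λ Z k k' y τ τ' ^ 2 ∂(noise d μ) ≤
        ENNReal.ofReal (C * (Real.log (2 + R) * (2 + h) ^ d * (R ^ (d - 1) * R ^ d) * B ^ 2)) := by
  classical
  obtain ⟨C₁, hC₁1, hC₁⟩ := exists_variance_le hd
  obtain ⟨C₂, hC₂1, hC₂⟩ := exists_links_card_le hd
  have hp : 0 ≤ 32 * C₂ * K * C₁ := by positivity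
  refine ⟨32 * C₂ * K * C₁ + 1, by linarith, ?_⟩
  intro R h hR hh c V hV Λ hΛ Z hZ k k' y τ τ' B hB0 hB hτ hτ'
  have hR0 : 0 < R := by linarith
  have hlog := one_le_log hR
  obtain ⟨F, hF, hFcard⟩ := hC₂ R hR Λ hΛ Z hZ k
  obtain ⟨F', hF', hFcard'⟩ := hC₂ R hR Λ hΛ Z hZ k'
  set m := max k k' with hm
  -- A bound for the logarithm of the number of pairs of links, from `4^k + 4^{k'} ≤ 2 * 4^m`.
  set L : ℝ := C₂ * (2 * 4 ^ m * Real.log (2 + R)) with hL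
  have hL1 : 1 ≤ L := by
    have h4 : (1 : ℝ) ≤ 4 ^ m := one_le_pow₀ (by norm_num)
    have : 1 ≤ 2 * 4 ^ m * Real.log (2 + R) :=
      one_le_mul_of_one_le_of_one_le (by linarith) hlog
    exact one_le_mul_of_one_le_of_one_le hC₂1 this
  set Vr : ℝ := (h + 1) ^ d * B ^ 2 * (C₁ * (R ^ (d - 1) * R ^ d) / 4 ^ m) with hVr
  have hVr0 : 0 ≤ Vr := by positivity
  have hsub : ∀ p ∈ F ×ˢ F', ∀ f : ℂ → ℝ, (∀ z, |f z| ≤ ‖z‖) →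
      (∀ w : (Fin d → ℤ) → ℝ, f (chainTerm h w V c Λ p.1 p.2 y τ τ') =
        ∑ n ∈ (sampleSet R c y).image fun i => cell h (latticePt i + y),
          f (cellCoeff R h V c Λ p.1 p.2 y τ τ' n) * w n) →
      ∃ c' : NNReal, (c' : ℝ) ≤ Vr * K ∧
        HasSubgaussianMGF (fun w => f (chainTerm h w V c Λ p.1 p.2 y τ τ')) c' (noise d μ) := by
    intro p hp f hf hfsum
    have hs := hasSubgaussianMGF_noise_sum (d := d) hK
      ((sampleSet R c y).image fun i => cell h (latticePt i + y))
      (fun n => f (cellCoeff R h V c Λ p.1 p.2 y τ τ' n))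
    refine ⟨_, ?_, by simpa only [hfsum] using hs⟩
    have hp1 : p.1 ∈ links R Λ Z k := hF ▸ (Finset.mem_product.1 hp).1
    have hp2 : p.2 ∈ links R Λ Z k' := hF' ▸ (Finset.mem_product.1 hp).2
    have hvar := hC₁ R hR Λ hΛ Z hZ k k' c y τ τ' hτ hτ' p.1 hp1 p.2 hp2
    push_cast
    rw [← Finset.sum_mul]
    refine mul_le_mul_of_nonneg_right ?_ K.2
    simp only [Real.coe_toNNReal _ (sq_nonneg _)]
    calc _ ≤ ∑ n ∈ (sampleSet R c y).image fun i => cell h (latticePt i + y),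
          ‖cellCoeff R h V c Λ p.1 p.2 y τ τ' n‖ ^ 2 := by
          refine Finset.sum_le_sum fun n _ => ?_
          rw [← sq_abs]
          exact pow_le_pow_left₀ (abs_nonneg _) (hf _) 2
      _ ≤ _ := sum_sq_cellCoeff_le hh Λ p.1 p.2 hB
      _ ≤ Vr := by rw [hVr]; gcongr
  have hmax := lintegral_iSup_sq_le (P := noise d μ) (F ×ˢ F')
    (fun p w => chainTerm h w V c Λ p.1 p.2 y τ τ') (c := Vr * K) (L := L) (by positivity) hL1 ?_
    (fun p hp => hsub p hp Complex.re Complex.abs_re_le_norm fun w => by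
      rw [chainTerm_eq_sum_cells h w hV, Complex.re_sum]
      exact Finset.sum_congr rfl fun n _ => Complex.re_mul_ofReal _ _)
    (fun p hp => hsub p hp Complex.im Complex.abs_im_le_norm fun w => by
      rw [chainTerm_eq_sum_cells h w hV, Complex.im_sum]
      exact Finset.sum_congr rfl fun n _ => Complex.im_mul_ofReal _ _)
  · have heq : ∀ w, maxTerm R h w V c Λ Z k k' y τ τ' ≤
        ⨆ p ∈ F ×ˢ F', ‖chainTerm h w V c Λ p.1 p.2 y τ τ'‖ₑ := by
      intro w
      refine iSup₂_le fun b hb => iSup₂_le fun b' hb' => ?_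
      rw [← hF] at hb
      rw [← hF'] at hb'
      exact le_iSup₂_of_le (b, b') (Finset.mem_product.2 ⟨hb, hb'⟩) le_rfl
    refine (lintegral_mono fun w => pow_le_pow_left₀ zero_le (heq w) 2).trans (hmax.trans ?_)
    refine ENNReal.ofReal_le_ofReal ?_
    -- The crucial cancellation: the entropy factor `4^m` in `L` meets `4^{-m}` in the variance
    -- `Vr`, so nothing depends on `k`, `k'`.
    have h1 : 16 * L * (Vr * K) = 32 * C₂ * K * C₁ *
        (Real.log (2 + R) * (h + 1) ^ d * (R ^ (d - 1) * R ^ d) * B ^ 2) := by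
      rw [hL, hVr]; field_simp; ring
    have h2 : (h + 1) ^ d ≤ (2 + h) ^ d := pow_le_pow_left₀ (by linarith) (by linarith) d
    have h3 : 32 * C₂ * K * C₁ ≤ 32 * C₂ * K * C₁ + 1 := by linarith
    rw [h1]
    gcongr
  · rw [Finset.card_product]
    push_cast
    calc (F.card : ℝ) * F'.card ≤ Real.exp (C₂ * (4 ^ k * Real.log (2 + R))) *
          Real.exp (C₂ * (4 ^ k' * Real.log (2 + R))) := by gcongr
      _ = Real.exp (C₂ * ((4 ^ k + 4 ^ k') * Real.log (2 + R))) := by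
          rw [← Real.exp_add]; ring_nf
      _ ≤ Real.exp L := by
          rw [hL, Real.exp_le_exp]
          have h1 : (4 : ℝ) ^ k ≤ 4 ^ m := pow_le_pow_right₀ (by norm_num) (le_max_left _ _)
          have h2 : (4 : ℝ) ^ k' ≤ 4 ^ m := pow_le_pow_right₀ (by norm_num) (le_max_right _ _)
          gcongr
          linarith

/-- The second moment of the trivial bound. -/
theorem exists_lintegral_maxTerm_sq_le_decay (hd : 1 ≤ d) {μ : Measure ℝ} [IsProbabilityMeasure μ]
    {K : NNReal} (hK : HasSubgaussianMGF id K μ) :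
    ∃ C : ℝ, 1 ≤ C ∧ ∀ (R h : ℝ), 1 ≤ R → ∀ (c : Eu d) (V : Eu d → ℂ),
      Function.support V ⊆ Metric.ball c R → ∀ Λ : Finset (Eu d), IsSphereNet R Λ →
      ∀ Z : ℕ → Finset (EuclideanSpace ℂ Λ), ∀ (k k' : ℕ) (y τ τ' : Eu d) (B : ℝ),
      0 ≤ B → (∀ i, ‖V (latticePt i + y)‖ ≤ B) → ‖τ‖ < 10 / R → ‖τ'‖ < 10 / R →
      ∫⁻ ω, maxTerm R h ω V c Λ Z k k' y τ τ' ^ 2 ∂(noise d μ) ≤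
        ENNReal.ofReal (C * (R ^ (d - 1) * R ^ d * (2 : ℝ)⁻¹ ^ (k + k') * B)) ^ 2 := by
  set v := ∫ x, x ^ 2 ∂μ with hv
  have hint : Integrable (fun x : ℝ => x ^ 2) μ := (hK.memLp 2).integrable_sq
  have hv0 : 0 ≤ v := integral_nonneg fun x => sq_nonneg x
  set C := 4 * (d * 4 ^ d) * 3 ^ d * Real.sqrt v with hC
  have hC0 : 0 ≤ C := by positivity
  refine ⟨C + 1, by linarith, ?_⟩
  intro R h hR c V hV Λ hΛ Z k k' y τ τ' B hB0 hB hτ hτ'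
  have hR0 : 0 < R := by linarith
  set S := sampleSet R c y with hS
  set q : ℝ := 4 * (2 : ℝ)⁻¹ ^ (k + k') * Λ.card * B with hq
  have hq0 : 0 ≤ q := by positivity
  -- Cauchy–Schwarz over the sample points reduces the second moment to that of a single noise
  -- variable, so repeated cells cause no difficulty.
  have hpt : ∀ w : (Fin d → ℤ) → ℝ, maxTerm R h w V c Λ Z k k' y τ τ' ^ 2 ≤
      ∑ i ∈ S, ENNReal.ofReal (q ^ 2 * S.card) *
        ENNReal.ofReal (w (cell h (latticePt i + y)) ^ 2) := by
    intro w
    refine (pow_le_pow_left₀ zero_le (maxTerm_le_ofReal w hV Λ Z k k' hB hτ hτ') 2).trans ?_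
    rw [← ENNReal.ofReal_pow (by positivity), ← Finset.mul_sum,
      ← ENNReal.ofReal_sum_of_nonneg fun _ _ => sq_nonneg _, ← ENNReal.ofReal_mul (by positivity)]
    refine ENNReal.ofReal_le_ofReal ?_
    rw [← hq, mul_pow, mul_assoc]
    gcongr
    simpa using sq_sum_le_card_mul_sum_sq (s := S) (f := fun i => |w (cell h (latticePt i + y))|)
  calc _ ≤ ∫⁻ w : (Fin d → ℤ) → ℝ, ∑ i ∈ S, ENNReal.ofReal (q ^ 2 * S.card) *
        ENNReal.ofReal (w (cell h (latticePt i + y)) ^ 2) ∂(noise d μ) := lintegral_mono hpt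
    _ = ∑ _i ∈ S, ENNReal.ofReal (q ^ 2 * S.card) * ENNReal.ofReal v := by
        rw [lintegral_finsetSum _ fun i _ => by fun_prop]
        refine Finset.sum_congr rfl fun i _ => ?_
        rw [lintegral_const_mul _ (by fun_prop), lintegral_noise_eval (μ := μ) _
          (f := fun x => ENNReal.ofReal (x ^ 2)) (by fun_prop),
          ← ofReal_integral_eq_lintegral_ofReal hint (Eventually.of_forall fun x => sq_nonneg x)]
    _ = ENNReal.ofReal ((q * S.card * Real.sqrt v) ^ 2) := by
        rw [Finset.sum_const, nsmul_eq_mul, ← ENNReal.ofReal_natCast,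
          ← ENNReal.ofReal_mul (by positivity), ← ENNReal.ofReal_mul (by positivity),
          mul_pow _ (Real.sqrt v), Real.sq_sqrt hv0]
        congr 1
        ring
    _ ≤ _ := by
        rw [← ENNReal.ofReal_pow (by positivity)]
        refine ENNReal.ofReal_le_ofReal (pow_le_pow_left₀ (by positivity) ?_ 2)
        calc q * S.card * Real.sqrt v ≤
            (4 * (2 : ℝ)⁻¹ ^ (k + k') * (d * 4 ^ d * R ^ (d - 1)) * B) * (3 * R) ^ d *
              Real.sqrt v := by
              rw [hq]
              gcongr
              · exact hΛ.card_le hd hR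
              · exact card_sampleSet_le hR c y
          _ = C * (R ^ (d - 1) * R ^ d * (2 : ℝ)⁻¹ ^ (k + k') * B) := by
              rw [hC, mul_pow]; ring
          _ ≤ _ := by gcongr; linarith

end ChainTerm

end RandomExtension

namespace RandomExtension

/-! ### Integration over the unit cell and over the shifts. -/

section Integrated

variable {d : ℕ}

theorem lintegral_le_lintegral_sq_rpow {Ω : Type*} [MeasurableSpace Ω] {P : Measure Ω}
    [IsProbabilityMeasure P] {f : Ω → ENNReal} (hf : AEMeasurable f P) :
    ∫⁻ ω, f ω ∂P ≤ (∫⁻ ω, f ω ^ 2 ∂P) ^ (1 / 2 : ℝ) := by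
  have h := ENNReal.lintegral_mul_le_Lp_mul_Lq P Real.HolderConjugate.two_two hf
    (aemeasurable_const (b := 1))
  simpa using h

/-- The lattice is countable. Since `V` is bounded only almost everywhere, this provides almost
every `y` for which all its samples are bounded. -/
theorem ae_forall_lattice {p : Eu d → Prop} (h : ∀ᵐ x, p x) :
    ∀ᵐ y : Eu d, ∀ i : Fin d → ℤ, p (latticePt i + y) :=
  ae_all_iff.2 fun i => (measurePreserving_add_left volume (latticePt i)).quasiMeasurePreserving.ae h

theorem ofReal_toReal_eLpNorm_top {V : Eu d → ℂ} (hV : MemLp V ⊤ volume) :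
    ENNReal.ofReal (eLpNorm V ⊤ volume).toReal = eLpNorm V ⊤ volume :=
  ENNReal.ofReal_toReal hV.eLpNorm_ne_top

theorem ae_norm_le_toReal_eLpNorm_top {V : Eu d → ℂ} (hV : MemLp V ⊤ volume) :
    ∀ᵐ x, ‖V x‖ ≤ (eLpNorm V ⊤ volume).toReal := by
  have h := ae_le_eLpNormEssSup (f := V) (μ := volume)
  rw [← eLpNorm_exponent_top] at h
  refine h.mono fun x hx => ?_
  rw [← toReal_enorm]
  exact ENNReal.toReal_mono hV.eLpNorm_ne_top hx

theorem volume_unitCell : (volume : Measure (Eu d)) (unitCell d) = 1 := by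
  have h : unitCell d = (MeasurableEquiv.toLp 2 (Fin d → ℝ)).symm ⁻¹'
      (Set.univ.pi fun _ => Set.Ico (0 : ℝ) 1) := by
    ext x; simp [unitCell, Set.mem_pi]
  rw [h, (EuclideanSpace.volume_preserving_symm_measurableEquiv_toLp (Fin d)).measure_preimage
    (MeasurableSet.univ_pi fun _ => measurableSet_Ico).nullMeasurableSet, volume_pi_pi]
  simp

theorem ae_shiftMeasure_norm_lt (R : ℝ) : ∀ᵐ τ ∂(shiftMeasure d R), ‖τ‖ < 10 / R := by
  refine Measure.ae_smul_measure ?_ _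
  filter_upwards [ae_restrict_mem Metric.isOpen_ball.measurableSet] with τ hτ
  exact mem_ball_zero_iff.1 hτ

theorem lintegral_shiftMeasure_le {R : ℝ} {f : Eu d → ENNReal} {Q : ENNReal}
    (hf : ∀ τ, ‖τ‖ < 10 / R → f τ ≤ Q) :
    ∫⁻ τ, f τ ∂(shiftMeasure d R) ≤ Q * shiftMeasure d R Set.univ := by
  rw [← lintegral_const]
  exact lintegral_mono_ae ((ae_shiftMeasure_norm_lt R).mono fun τ hτ => hf τ hτ)

theorem lintegral_unitCell_le {f : Eu d → ENNReal} {Q : ENNReal} (hf : ∀ᵐ y, f y ≤ Q) :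
    ∫⁻ y in unitCell d, f y ≤ Q := by
  calc _ ≤ ∫⁻ _y in unitCell d, Q := lintegral_mono_ae (ae_restrict_of_ae hf)
    _ = Q := by rw [setLIntegral_const, volume_unitCell, mul_one]

theorem lintegral_unitCell_shift_shift_le {R : ℝ} {f : Eu d → Eu d → Eu d → ENNReal} {Q : ENNReal}
    (hf : ∀ᵐ y, ∀ τ τ', ‖τ‖ < 10 / R → ‖τ'‖ < 10 / R → f y τ τ' ≤ Q) :
    ∫⁻ y in unitCell d, ∫⁻ τ, ∫⁻ τ', f y τ τ' ∂(shiftMeasure d R) ∂(shiftMeasure d R) ≤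
      Q * shiftMeasure d R Set.univ * shiftMeasure d R Set.univ :=
  lintegral_unitCell_le <| hf.mono fun _ hy => lintegral_shiftMeasure_le fun τ hτ =>
    lintegral_shiftMeasure_le fun τ' hτ' => hy τ τ' hτ hτ'

/-- The square root leaves only one factor of the mass, where the plain integral has two. This
accounts for the prefactor `R^{d-1}` in the integrated bound and its absence in the square
integrated one. -/
theorem lintegral_unitCell_rpow_le {R : ℝ} {f : Eu d → Eu d → Eu d → ENNReal} {Q : ENNReal}
    (hf : ∀ᵐ y, ∀ τ τ', ‖τ‖ < 10 / R → ‖τ'‖ < 10 / R → f y τ τ' ≤ Q ^ 2) :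
    ∫⁻ y in unitCell d,
        (∫⁻ τ, ∫⁻ τ', f y τ τ' ∂(shiftMeasure d R) ∂(shiftMeasure d R)) ^ (1 / 2 : ℝ) ≤
      Q * shiftMeasure d R Set.univ := by
  refine lintegral_unitCell_le <| hf.mono fun y hy => ?_
  have h1 : ∫⁻ τ, ∫⁻ τ', f y τ τ' ∂(shiftMeasure d R) ∂(shiftMeasure d R) ≤
      (Q * shiftMeasure d R Set.univ) ^ 2 := by
    refine (lintegral_shiftMeasure_le fun τ hτ => lintegral_shiftMeasure_le fun τ' hτ' =>
      hy τ τ' hτ hτ').trans (le_of_eq (by ring))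
  refine (ENNReal.rpow_le_rpow h1 (by norm_num)).trans (le_of_eq ?_)
  rw [← ENNReal.rpow_natCast, ← ENNReal.rpow_mul]
  norm_num

/-- The constant in the total mass of the shift measure. -/
noncomputable def shiftMass (d : ℕ) : ℝ :=
  10 ^ d * (volume : Measure (Eu d)).real (Metric.ball 0 1)

theorem shiftMass_nonneg : 0 ≤ shiftMass d := by unfold shiftMass; positivity

theorem shiftMeasure_univ (hd : 1 ≤ d) {R : ℝ} (hR : 0 < R) :
    shiftMeasure d R Set.univ = ENNReal.ofReal (shiftMass d / R ^ (d - 1)) :=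
  lintegral_shiftMeasure_one hd hR

/-- From a uniform bound on the second moment to the integrated bounds. -/
theorem integrated_bounds_of_sq (hd : 1 ≤ d) {μ : Measure ℝ} [IsProbabilityMeasure μ]
    {R h : ℝ} (hR : 1 ≤ R) {c : Eu d} {V : Eu d → ℂ} (hV : MemLp V ⊤ volume)
    (hsupp : Function.support V ⊆ Metric.ball c R) {Λ : Finset (Eu d)}
    {Z : ℕ → Finset (EuclideanSpace ℂ Λ)} {k k' : ℕ} {X : ℝ} (hX : 0 ≤ X)
    (hE : ∀ (y τ τ' : Eu d), (∀ i, ‖V (latticePt i + y)‖ ≤ (eLpNorm V ⊤ volume).toReal) →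
      ‖τ‖ < 10 / R → ‖τ'‖ < 10 / R →
      ∫⁻ ω, maxTerm R h ω V c Λ Z k k' y τ τ' ^ 2 ∂(noise d μ) ≤
        ENNReal.ofReal (R ^ (d - 1) * X * (eLpNorm V ⊤ volume).toReal) ^ 2) :
    ENNReal.ofReal (R ^ (d - 1)) *
        ∫⁻ y in unitCell d, ∫⁻ τ, ∫⁻ τ', ∫⁻ ω, maxTerm R h ω V c Λ Z k k' y τ τ'
          ∂(noise d μ) ∂(shiftMeasure d R) ∂(shiftMeasure d R) ≤
        ENNReal.ofReal (shiftMass d ^ 2 * X) * eLpNorm V ⊤ volume ∧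
      ∫⁻ y in unitCell d, (∫⁻ τ, ∫⁻ τ', ∫⁻ ω, maxTerm R h ω V c Λ Z k k' y τ τ' ^ 2
          ∂(noise d μ) ∂(shiftMeasure d R) ∂(shiftMeasure d R)) ^ (1 / 2 : ℝ) ≤
        ENNReal.ofReal (shiftMass d * X) * eLpNorm V ⊤ volume := by
  have hR0 : 0 < R := by linarith
  set B := (eLpNorm V ⊤ volume).toReal with hB
  have hB0 : 0 ≤ B := ENNReal.toReal_nonneg
  have hgood := ae_forall_lattice (ae_norm_le_toReal_eLpNorm_top hV)
  have hm := shiftMass_nonneg (d := d)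
  rw [← ofReal_toReal_eLpNorm_top hV, ← hB]
  constructor
  · have h1 := lintegral_unitCell_shift_shift_le (R := R)
      (f := fun y τ τ' => ∫⁻ ω, maxTerm R h ω V c Λ Z k k' y τ τ' ∂(noise d μ))
      (Q := ENNReal.ofReal (R ^ (d - 1) * X * B)) (hgood.mono fun y hy τ τ' hτ hτ' => by
        refine (lintegral_le_lintegral_sq_rpow (measurable_maxTerm_noise hsupp Λ Z k k' y τ τ'
          (countable_links Z)).aemeasurable).trans ?_
        refine (ENNReal.rpow_le_rpow (hE y τ τ' hy hτ hτ') (by norm_num)).trans (le_of_eq ?_)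
        rw [← ENNReal.rpow_natCast, ← ENNReal.rpow_mul]
        norm_num)
    rw [shiftMeasure_univ hd hR0] at h1
    refine (mul_le_mul_right h1 _).trans (le_of_eq ?_)
    rw [← ENNReal.ofReal_mul (by positivity), ← ENNReal.ofReal_mul (by positivity),
      ← ENNReal.ofReal_mul (by positivity), ← ENNReal.ofReal_mul (by positivity)]
    congr 1
    field_simp
  · have h1 := lintegral_unitCell_rpow_le (R := R)
      (f := fun y τ τ' => ∫⁻ ω, maxTerm R h ω V c Λ Z k k' y τ τ' ^ 2 ∂(noise d μ))
      (Q := ENNReal.ofReal (R ^ (d - 1) * X * B)) (hgood.mono fun y hy τ τ' hτ hτ' =>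
        hE y τ τ' hy hτ hτ')
    rw [shiftMeasure_univ hd hR0] at h1
    refine h1.trans (le_of_eq ?_)
    rw [← ENNReal.ofReal_mul (by positivity), ← ENNReal.ofReal_mul (by positivity)]
    congr 1
    field_simp

/-- The probabilistic bounds and the bounds with decay. -/
theorem exists_chaining_bounds (hd : 1 ≤ d) {μ : Measure ℝ} [IsProbabilityMeasure μ]
    {K : NNReal} (hK : HasSubgaussianMGF id K μ) :
    ∃ C : ℝ, 1 ≤ C ∧ ∀ (R h : ℝ), 1 ≤ R → 0 < h → ∀ (c : Eu d) (V : Eu d → ℂ),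
      MemLp V ⊤ volume → Function.support V ⊆ Metric.ball c R →
      ∀ Λ : Finset (Eu d), IsSphereNet R Λ →
      ∀ Z : ℕ → Finset (EuclideanSpace ℂ Λ), IsChain R Λ Z → ∀ (k k' : ℕ),
      ENNReal.ofReal (R ^ (d - 1)) *
          ∫⁻ y in unitCell d, ∫⁻ τ, ∫⁻ τ', ∫⁻ ω, maxTerm R h ω V c Λ Z k k' y τ τ'
            ∂(noise d μ) ∂(shiftMeasure d R) ∂(shiftMeasure d R) ≤
          ENNReal.ofReal (C * (R ^ (1 / 2 : ℝ) * (Real.log (2 + R)) ^ (1 / 2 : ℝ) *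
            (2 + h) ^ ((d : ℝ) / 2))) * eLpNorm V ⊤ volume ∧
      ∫⁻ y in unitCell d, (∫⁻ τ, ∫⁻ τ', ∫⁻ ω, maxTerm R h ω V c Λ Z k k' y τ τ' ^ 2
            ∂(noise d μ) ∂(shiftMeasure d R) ∂(shiftMeasure d R)) ^ (1 / 2 : ℝ) ≤
          ENNReal.ofReal (C * (R ^ (1 / 2 : ℝ) * (Real.log (2 + R)) ^ (1 / 2 : ℝ) *
            (2 + h) ^ ((d : ℝ) / 2))) * eLpNorm V ⊤ volume ∧
      ∫⁻ y in unitCell d, ∫⁻ τ, ∫⁻ τ', ∫⁻ ω, maxTerm R h ω V c Λ Z k k' y τ τ'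
            ∂(noise d μ) ∂(shiftMeasure d R) ∂(shiftMeasure d R) ≤
          ENNReal.ofReal (C * (R * (2 : ℝ)⁻¹ ^ (k + k'))) * eLpNorm V ⊤ volume ∧
      ∫⁻ y in unitCell d, (∫⁻ τ, ∫⁻ τ', ∫⁻ ω, maxTerm R h ω V c Λ Z k k' y τ τ' ^ 2
            ∂(noise d μ) ∂(shiftMeasure d R) ∂(shiftMeasure d R)) ^ (1 / 2 : ℝ) ≤
          ENNReal.ofReal (C * (R ^ d * (2 : ℝ)⁻¹ ^ (k + k'))) * eLpNorm V ⊤ volume := by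
  obtain ⟨C₁, hC₁1, hC₁⟩ := exists_lintegral_maxTerm_sq_le hd hK
  obtain ⟨C₂, hC₂1, hC₂⟩ := exists_lintegral_maxTerm_sq_le_decay hd hK
  have hm := shiftMass_nonneg (d := d)
  set s := shiftMass d with hs
  have hC₁0 : 0 ≤ C₁ := by linarith
  have hC₂0 : 0 ≤ C₂ := by linarith
  set D := (s ^ 2 + s) * (Real.sqrt C₁ + C₂) with hD
  have hD0 : 0 ≤ D := by positivity
  refine ⟨D + 1, by linarith, ?_⟩
  intro R h hR hh c V hV hsupp Λ hΛ Z hZ k k'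
  have hR0 : 0 < R := by linarith
  have hlog := one_le_log hR
  have hlog0 : 0 ≤ Real.log (2 + R) := by linarith
  set B := (eLpNorm V ⊤ volume).toReal with hB
  have hB0 : 0 ≤ B := ENNReal.toReal_nonneg
  set X := R ^ (1 / 2 : ℝ) * (Real.log (2 + R)) ^ (1 / 2 : ℝ) * (2 + h) ^ ((d : ℝ) / 2) with hX
  have hX0 : 0 ≤ X := by positivity
  have hX2 : X ^ 2 = R * Real.log (2 + R) * (2 + h) ^ d := by
    rw [hX, mul_pow, mul_pow, ← Real.rpow_natCast (R ^ _), ← Real.rpow_mul hR0.le,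
      ← Real.rpow_natCast (Real.log _ ^ _), ← Real.rpow_mul hlog0,
      ← Real.rpow_natCast ((2 + h) ^ _), ← Real.rpow_mul (by linarith)]
    norm_num
  -- After the square root, `R^{d-1}` is cancelled by the mass of the shifts, and the surplus factor
  -- `R` becomes `R^{1/2}`.
  have hRd : R ^ (d - 1) * R ^ d = (R ^ (d - 1)) ^ 2 * R := by
    obtain ⟨e, rfl⟩ : ∃ e, d = e + 1 := ⟨d - 1, by omega⟩
    rw [Nat.add_sub_cancel]; ring
  have hb1 := integrated_bounds_of_sq hd (μ := μ) (h := h) hR hV hsupp (Λ := Λ) (Z := Z) (k := k)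
    (k' := k') (X := Real.sqrt C₁ * X) (by positivity) fun y τ τ' hy hτ hτ' => by
      refine (hC₁ R h hR hh c V hsupp Λ hΛ Z hZ k k' y τ τ' B hB0 hy hτ hτ').trans (le_of_eq ?_)
      rw [← ENNReal.ofReal_pow (by positivity), mul_pow, mul_pow, mul_pow, hX2,
        Real.sq_sqrt hC₁0, hRd]
      congr 1; ring
  have hb2 := integrated_bounds_of_sq hd (μ := μ) (h := h) hR hV hsupp (Λ := Λ) (Z := Z) (k := k)
    (k' := k') (X := C₂ * (R ^ d * (2 : ℝ)⁻¹ ^ (k + k'))) (by positivity)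
    fun y τ τ' hy hτ hτ' => by
      refine (hC₂ R h hR c V hsupp Λ hΛ Z k k' y τ τ' B hB0 hy hτ hτ').trans (le_of_eq ?_)
      congr 2; ring
  rw [← hs] at hb1 hb2
  have hsq := Real.sqrt_nonneg C₁
  have k1 : s ^ 2 * Real.sqrt C₁ ≤ D + 1 := by
    rw [hD]
    nlinarith [mul_nonneg hm hsq, mul_nonneg hm hC₂0, mul_nonneg (sq_nonneg s) hC₂0]
  have k2 : s * Real.sqrt C₁ ≤ D + 1 := by
    rw [hD]
    nlinarith [mul_nonneg (sq_nonneg s) hsq, mul_nonneg hm hC₂0, mul_nonneg (sq_nonneg s) hC₂0]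
  have k3 : s ^ 2 * C₂ ≤ D + 1 := by
    rw [hD]
    nlinarith [mul_nonneg hm hsq, mul_nonneg hm hC₂0, mul_nonneg (sq_nonneg s) hsq]
  have k4 : s * C₂ ≤ D + 1 := by
    rw [hD]
    nlinarith [mul_nonneg hm hsq, mul_nonneg (sq_nonneg s) hC₂0, mul_nonneg (sq_nonneg s) hsq]
  refine ⟨hb1.1.trans ?_, hb1.2.trans ?_, ?_, hb2.2.trans ?_⟩
  · rw [← mul_assoc]; gcongr
  · rw [← mul_assoc]; gcongr
  -- The decaying bound on the plain integral follows from its normalized form upon division by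
  -- `R^{d-1}`, which turns `R^d` into `R`.
  · have h1 : (1 : ENNReal) = ENNReal.ofReal (R ^ (d - 1))⁻¹ * ENNReal.ofReal (R ^ (d - 1)) := by
      rw [← ENNReal.ofReal_mul (by positivity), inv_mul_cancel₀ (by positivity), ENNReal.ofReal_one]
    rw [← one_mul (∫⁻ y in unitCell d, _), h1, mul_assoc]
    refine (mul_le_mul_right hb2.1 _).trans ?_
    rw [← mul_assoc, ← ENNReal.ofReal_mul (by positivity)]
    refine mul_le_mul' (ENNReal.ofReal_le_ofReal ?_) le_rfl
    obtain ⟨e, he⟩ : ∃ e, d = e + 1 := ⟨d - 1, by omega⟩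
    have h2 : (R ^ (d - 1))⁻¹ * (s ^ 2 * (C₂ * (R ^ d * (2 : ℝ)⁻¹ ^ (k + k')))) =
        s ^ 2 * C₂ * (R * (2 : ℝ)⁻¹ ^ (k + k')) := by
      have h3 : R ^ d = R ^ (d - 1) * R := by rw [he, Nat.add_sub_cancel, pow_succ]
      rw [h3]; field_simp
    rw [h2]
    gcongr
  · rw [← mul_assoc]; gcongr

/-- The deterministic bound. -/
theorem exists_deterministic_bound (hd : 1 ≤ d) :
    ∃ C : ℝ, 0 < C ∧ ∀ (R h : ℝ), 1 ≤ R → 0 < h → h ≤ R →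
      ∀ (c : Eu d) (V : Eu d → ℂ), MemLp V ⊤ volume →
      Function.support V ⊆ Metric.ball c R →
      ∀ Λ : Finset (Eu d), IsSphereNet R Λ →
      ∀ Z : ℕ → Finset (EuclideanSpace ℂ Λ), IsChain R Λ Z →
      ∀ (k k' : ℕ) (w : (Fin d → ℤ) → ℝ),
        ∫⁻ y in unitCell d, ∫⁻ τ, ∫⁻ τ', maxTerm R h w V c Λ Z k k' y τ τ'
            ∂(shiftMeasure d R) ∂(shiftMeasure d R) ≤
          ENNReal.ofReal (C * (R * (2 : ℝ)⁻¹ ^ (k + k'))) * eLpNorm V ⊤ volume *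
            ⨆ x ∈ Metric.ball c R, ‖w (cell h x)‖ₑ := by
  have hm := shiftMass_nonneg (d := d)
  set s := shiftMass d with hs
  refine ⟨4 * (d * 4 ^ d) * 3 ^ d * s ^ 2 + 1, by positivity, ?_⟩
  intro R h hR _ _ c V hV hsupp Λ hΛ Z _ k k' w
  have hR0 : 0 < R := by linarith
  set B := (eLpNorm V ⊤ volume).toReal with hB
  have hB0 : 0 ≤ B := ENNReal.toReal_nonneg
  set W := ⨆ x ∈ Metric.ball c R, ‖w (cell h x)‖ₑ with hW
  have hgood := ae_forall_lattice (ae_norm_le_toReal_eLpNorm_top hV)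
  have h1 := lintegral_unitCell_shift_shift_le (R := R)
    (f := fun y τ τ' => maxTerm R h w V c Λ Z k k' y τ τ')
    (Q := ENNReal.ofReal (4 * (2 : ℝ)⁻¹ ^ (k + k') * (d * 4 ^ d * R ^ (d - 1)) * B * (3 * R) ^ d) *
      W) (hgood.mono fun y hy τ τ' hτ hτ' => by
      refine (maxTerm_le_ofReal w hsupp Λ Z k k' hy hτ hτ').trans ?_
      rw [ENNReal.ofReal_mul (by positivity), ENNReal.ofReal_mul (q := (3 * R) ^ d) (by positivity),
        ENNReal.ofReal_sum_of_nonneg fun _ _ => abs_nonneg _,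
        mul_assoc (ENNReal.ofReal (4 * (2 : ℝ)⁻¹ ^ (k + k') * (d * 4 ^ d * R ^ (d - 1)) * B)) _ W]
      refine mul_le_mul' ?_ ?_
      · refine ENNReal.ofReal_le_ofReal ?_
        have hp : (0 : ℝ) ≤ 4 * (2 : ℝ)⁻¹ ^ (k + k') := by positivity
        have := mul_le_mul_of_nonneg_right
          (mul_le_mul_of_nonneg_left (hΛ.card_le hd hR) hp) hB0
        linarith
      · calc _ ≤ ∑ _i ∈ sampleSet R c y, W := by
              refine Finset.sum_le_sum fun i hi => ?_
              rw [← Real.norm_eq_abs, ofReal_norm]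
              refine le_iSup₂_of_le (latticePt i + y) ?_ le_rfl
              rw [Metric.mem_ball, dist_eq_norm]
              exact mem_sampleSet.1 hi
          _ = ENNReal.ofReal (sampleSet R c y).card * W := by
              rw [Finset.sum_const, nsmul_eq_mul, ENNReal.ofReal_natCast]
          _ ≤ _ := by
              exact mul_le_mul' (ENNReal.ofReal_le_ofReal (card_sampleSet_le hR c y)) le_rfl)
  rw [shiftMeasure_univ hd hR0, ← hs] at h1
  refine h1.trans ?_
  rw [← ofReal_toReal_eLpNorm_top hV, ← hB, mul_right_comm _ W,
    ← ENNReal.ofReal_mul (by positivity), mul_right_comm _ W, ← ENNReal.ofReal_mul (by positivity),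
    ← ENNReal.ofReal_mul (by positivity)]
  refine mul_le_mul' (ENNReal.ofReal_le_ofReal ?_) le_rfl
  obtain ⟨e, he⟩ : ∃ e, d = e + 1 := ⟨d - 1, by omega⟩
  have h3 : R ^ d = R ^ (d - 1) * R := by rw [he, Nat.add_sub_cancel, pow_succ]
  calc _ = 4 * (d * 4 ^ d) * 3 ^ d * s ^ 2 * (R * (2 : ℝ)⁻¹ ^ (k + k')) * B := by
        rw [mul_pow, h3]; field_simp
    _ ≤ _ := by gcongr; linarith

end Integrated

end RandomExtension

namespace RandomExtension

/-! ### Polar coordinates in a thin shell. -/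

section Polar

open scoped Pointwise

variable {d : ℕ}

/-- The part of a punctured ball with directions in `T`. -/
theorem Ioo_smul_image_coe (r : ℝ) (T : Set (Eu d)) :
    Set.Ioo (0 : ℝ) r • (((↑) : Sph d → Eu d) '' ((↑) ⁻¹' T)) =
      {x : Eu d | 0 < ‖x‖ ∧ ‖x‖ < r ∧ ‖x‖⁻¹ • x ∈ T} := by
  ext x
  rw [Set.mem_smul]
  constructor
  · rintro ⟨t, ht, _, ⟨ξ, hξ, rfl⟩, rfl⟩
    have h1 : ‖t • (ξ : Eu d)‖ = t := by
      rw [norm_smul, Real.norm_of_nonneg ht.1.le, norm_eq_of_mem_sphere, mul_one]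
    refine ⟨by rw [h1]; exact ht.1, by rw [h1]; exact ht.2, ?_⟩
    rw [h1, inv_smul_smul₀ ht.1.ne']
    exact hξ
  · rintro ⟨h0, h1, h2⟩
    refine ⟨‖x‖, ⟨h0, h1⟩, ‖x‖⁻¹ • x, ⟨⟨‖x‖⁻¹ • x, ?_⟩, h2, rfl⟩, smul_inv_smul₀ h0.ne' x⟩
    rw [mem_sphere_zero_iff_norm, norm_smul, norm_inv, norm_norm, inv_mul_cancel₀ h0.ne']

theorem smul_setOf_direction {r : ℝ} (hr : 0 < r) (T : Set (Eu d)) :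
    {x : Eu d | 0 < ‖x‖ ∧ ‖x‖ < r ∧ ‖x‖⁻¹ • x ∈ T} =
      r • {x : Eu d | 0 < ‖x‖ ∧ ‖x‖ < 1 ∧ ‖x‖⁻¹ • x ∈ T} := by
  ext x
  rw [Set.mem_smul_set_iff_inv_smul_mem₀ hr.ne']
  simp only [Set.mem_ofPred_eq, norm_smul, norm_inv, Real.norm_of_nonneg hr.le, smul_smul]
  refine and_congr ?_ (and_congr ?_ ?_)
  · exact (mul_pos_iff_of_pos_left (inv_pos.2 hr)).symm
  · rw [inv_mul_lt_iff₀ hr, mul_one]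
  · rw [mul_inv, inv_inv, mul_right_comm, mul_inv_cancel₀ hr.ne', one_mul]

theorem measurable_direction : Measurable fun x : Eu d => ‖x‖⁻¹ • x := by fun_prop

/-- The measure of the shell of inner radius `1` and thickness `δ`, relative to the surface
measure. -/
noncomputable def shellMass (d : ℕ) (δ : ℝ) : ℝ := ((1 + δ) ^ d - 1) / d

theorem le_shellMass (hd : 1 ≤ d) {δ : ℝ} (hδ : 0 ≤ δ) : δ ≤ shellMass d δ := by
  have h := one_add_mul_le_pow (by linarith : (-2 : ℝ) ≤ δ) d
  have hd' : (0 : ℝ) < d := by exact_mod_cast hd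
  rw [shellMass, le_div_iff₀ hd']
  linarith

/-- Directions of points of a thin shell are distributed according to the surface measure. -/
theorem map_direction_shell (hd : 1 ≤ d) {δ : ℝ} (hδ : 0 ≤ δ) :
    ((volume : Measure (Eu d)).restrict {x | 1 ≤ ‖x‖ ∧ ‖x‖ < 1 + δ}).map (fun x => ‖x‖⁻¹ • x) =
      ENNReal.ofReal (shellMass d δ) • (surf d).map (↑) := by
  have hdpos : (0 : ℝ) < d := by exact_mod_cast hd
  have hS : MeasurableSet {x : Eu d | 1 ≤ ‖x‖ ∧ ‖x‖ < 1 + δ} :=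
    (measurableSet_le measurable_const measurable_norm).inter
      (measurableSet_lt measurable_norm measurable_const)
  ext T hT
  rw [Measure.map_apply measurable_direction hT,
    Measure.restrict_apply (measurable_direction hT), Measure.smul_apply,
    Measure.map_apply measurable_subtype_coe hT, surf,
    Measure.toSphere_apply' _ (measurable_subtype_coe hT), Ioo_smul_image_coe, smul_eq_mul,
    finrank_euclideanSpace, Fintype.card_fin]
  set A : ℝ → Set (Eu d) := fun r => {x | 0 < ‖x‖ ∧ ‖x‖ < r ∧ ‖x‖⁻¹ • x ∈ T} with hA
  have hAm : ∀ r, MeasurableSet (A r) := fun r =>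
    (measurableSet_lt measurable_const measurable_norm).inter
      ((measurableSet_lt measurable_norm measurable_const).inter (measurable_direction hT))
  have hfin : volume (A 1) ≠ ⊤ := by
    refine measure_ne_top_of_subset (s := Metric.ball (0 : Eu d) 1) (fun x hx => ?_) measure_ball_lt_top.ne
    rw [mem_ball_zero_iff]; exact hx.2.1
  -- The part of the shell over `T` is a difference of two truncated cones, the larger being the
  -- dilation of the smaller by `1 + δ`. The surface measure is `d` times the volume of the unit
  -- cone.
  have h1 : (fun x : Eu d => ‖x‖⁻¹ • x) ⁻¹' T ∩ {x | 1 ≤ ‖x‖ ∧ ‖x‖ < 1 + δ} =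
      A (1 + δ) \ A 1 := by
    ext x
    simp only [hA, Set.mem_inter_iff, Set.mem_preimage, Set.mem_ofPred_eq, Set.mem_sdiff]
    constructor
    · rintro ⟨h1, h2, h3⟩
      exact ⟨⟨by linarith, h3, h1⟩, fun h => by linarith [h.2.1]⟩
    · rintro ⟨⟨h1, h2, h3⟩, h4⟩
      refine ⟨h3, ?_, h2⟩
      by_contra h5
      exact h4 ⟨h1, not_le.1 h5, h3⟩
  have hsub : A 1 ⊆ A (1 + δ) := fun x hx => ⟨hx.1, by linarith [hx.2.1], hx.2.2⟩
  change volume ((fun x : Eu d => ‖x‖⁻¹ • x) ⁻¹' T ∩ {x | 1 ≤ ‖x‖ ∧ ‖x‖ < 1 + δ}) =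
    ENNReal.ofReal (shellMass d δ) * (d * volume (A 1))
  rw [h1, measure_sdiff hsub (hAm 1).nullMeasurableSet hfin]
  have h2 : volume (A (1 + δ)) = ENNReal.ofReal ((1 + δ) ^ d) * volume (A 1) := by
    simp only [hA]
    rw [smul_setOf_direction (by linarith : 0 < 1 + δ), Measure.addHaar_smul,
      finrank_euclideanSpace, Fintype.card_fin, abs_of_nonneg (by positivity)]
  have h3 : ENNReal.ofReal ((1 + δ) ^ d) = ENNReal.ofReal (shellMass d δ) * d + 1 := by
    rw [← ENNReal.ofReal_natCast d, ← ENNReal.ofReal_mul (hδ.trans (le_shellMass hd hδ)),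
      ← ENNReal.ofReal_one, ← ENNReal.ofReal_add ?_ zero_le_one, shellMass]
    · congr 1; field_simp; ring
    · exact mul_nonneg (hδ.trans (le_shellMass hd hδ)) hdpos.le
  rw [h2, h3, add_mul, one_mul, ENNReal.add_sub_cancel_right hfin, mul_assoc]

/-- The vectors `τ` for which `η + τ` lies in the shell. -/
def shiftShell (η : Eu d) (δ : ℝ) : Set (Eu d) := {τ | 1 ≤ ‖η + τ‖ ∧ ‖η + τ‖ < 1 + δ}

theorem measurableSet_shiftShell (η : Eu d) (δ : ℝ) : MeasurableSet (shiftShell η δ) :=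
  (measurableSet_le measurable_const (g := fun τ => ‖η + τ‖) (by fun_prop)).inter
    (measurableSet_lt (f := fun τ => ‖η + τ‖) (by fun_prop) measurable_const)

/-- Translation by `η` reduces this to the centred shell. The law is the same for all net points, so
one integral over `τ` averages every net point over the whole sphere. -/
theorem map_shift_shiftShell (hd : 1 ≤ d) (η : Eu d) {δ : ℝ} (hδ : 0 ≤ δ) :
    ((volume : Measure (Eu d)).restrict (shiftShell η δ)).map (shift η) =
      ENNReal.ofReal (shellMass d δ) • (surf d).map (↑) := by
  rw [← map_direction_shell hd hδ]
  have h1 := (measurePreserving_add_left (volume : Measure (Eu d)) η).restrict_preimage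
    (s := {x | 1 ≤ ‖x‖ ∧ ‖x‖ < 1 + δ})
    ((measurableSet_le measurable_const measurable_norm).inter
      (measurableSet_lt measurable_norm measurable_const))
  rw [← h1.map_eq, Measure.map_map measurable_direction (by fun_prop)]
  rfl

theorem lintegral_shift_shiftShell (hd : 1 ≤ d) (η : Eu d) {δ : ℝ} (hδ : 0 ≤ δ)
    {F : Eu d → ENNReal} (hF : Measurable F) :
    ∫⁻ τ in shiftShell η δ, F (shift η τ) =
      ENNReal.ofReal (shellMass d δ) * ∫⁻ ξ, F ξ ∂(surf d) := by
  rw [← lintegral_map hF (measurable_shift η), map_shift_shiftShell hd η hδ,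
    lintegral_smul_measure, lintegral_map hF measurable_subtype_coe, smul_eq_mul]

theorem integral_shift_shiftShell (hd : 1 ≤ d) (η : Eu d) {δ : ℝ} (hδ : 0 ≤ δ)
    {F : Eu d → ℂ} (hF : Measurable F) :
    ∫ τ in shiftShell η δ, F (shift η τ) =
      (shellMass d δ : ℂ) * ∫ ξ, F ξ ∂(surf d) := by
  rw [← integral_map (measurable_shift η).aemeasurable hF.aestronglyMeasurable,
    map_shift_shiftShell hd η hδ,
    integral_smul_measure, integral_map measurable_subtype_coe.aemeasurable hF.aestronglyMeasurable,
    ENNReal.toReal_ofReal (hδ.trans (le_shellMass hd hδ)), Complex.real_smul]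

end Polar

/-! ### A partition of unity subordinate to the net. -/

section Partition

variable {d : ℕ}

open Classical in
/-- The number of net points that are close to `ξ`. -/
noncomputable def nearCount (R : ℝ) (Λ : Finset (Eu d)) (ξ : Eu d) : ℝ :=
  ∑ η ∈ Λ, if dist ξ η ≤ 1 / R then 1 else 0

open Classical in
/-- A partition of unity on the sphere that is subordinate to the net. -/
noncomputable def netWeight (R : ℝ) (Λ : Finset (Eu d)) (η ξ : Eu d) : ℝ :=
  (if dist ξ η ≤ 1 / R then 1 else 0) / nearCount R Λ ξ

theorem measurable_nearCount (R : ℝ) (Λ : Finset (Eu d)) : Measurable (nearCount R Λ) := by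
  unfold nearCount
  refine Finset.measurable_fun_sum _ fun η _ => Measurable.ite ?_ measurable_const measurable_const
  exact measurableSet_le (by fun_prop) measurable_const

theorem measurable_netWeight (R : ℝ) (Λ : Finset (Eu d)) (η : Eu d) :
    Measurable (netWeight R Λ η) := by
  unfold netWeight
  refine Measurable.div (Measurable.ite ?_ measurable_const measurable_const)
    (measurable_nearCount R Λ)
  exact measurableSet_le (by fun_prop) measurable_const

theorem nearCount_nonneg (R : ℝ) (Λ : Finset (Eu d)) (ξ : Eu d) : 0 ≤ nearCount R Λ ξ :=
  Finset.sum_nonneg fun _ _ => by split_ifs <;> norm_num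

theorem netWeight_nonneg (R : ℝ) (Λ : Finset (Eu d)) (η ξ : Eu d) : 0 ≤ netWeight R Λ η ξ :=
  div_nonneg (by split_ifs <;> norm_num) (nearCount_nonneg R Λ ξ)

theorem dist_le_of_netWeight_ne_zero {R : ℝ} {Λ : Finset (Eu d)} {η ξ : Eu d}
    (h : netWeight R Λ η ξ ≠ 0) : dist ξ η ≤ 1 / R := by
  by_contra hlt
  exact h (by rw [netWeight, if_neg hlt, zero_div])

theorem IsSphereNet.sum_netWeight {R : ℝ} {Λ : Finset (Eu d)} (hΛ : IsSphereNet R Λ) {ξ : Eu d}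
    (hξ : ‖ξ‖ = 1) : ∑ η ∈ Λ, netWeight R Λ η ξ = 1 := by
  classical
  unfold netWeight
  rw [← Finset.sum_div]
  refine div_self (ne_of_gt ?_)
  obtain ⟨η, hη, hle⟩ := hΛ.2.2 ξ hξ
  refine Finset.sum_pos' (fun _ _ => by split_ifs <;> norm_num) ⟨η, hη, ?_⟩
  rw [if_pos hle]; exact one_pos

theorem IsSphereNet.netWeight_le_one {R : ℝ} {Λ : Finset (Eu d)} (hΛ : IsSphereNet R Λ)
    {η ξ : Eu d} (hη : η ∈ Λ) (hξ : ‖ξ‖ = 1) : netWeight R Λ η ξ ≤ 1 := by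
  rw [← hΛ.sum_netWeight hξ]
  exact Finset.single_le_sum (fun η _ => netWeight_nonneg R Λ η ξ) hη

/-- Weights in `[0,1]` with sum one. This keeps the `ℓ²` norm of the discretized coefficients below
that of the function, whatever the overlap of the pieces. -/
theorem IsSphereNet.sum_netWeight_sq_le {R : ℝ} {Λ : Finset (Eu d)} (hΛ : IsSphereNet R Λ)
    {ξ : Eu d} (hξ : ‖ξ‖ = 1) : ∑ η ∈ Λ, netWeight R Λ η ξ ^ 2 ≤ 1 := by
  refine le_trans (Finset.sum_le_sum fun η hη => ?_) (hΛ.sum_netWeight hξ).le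
  have h0 := netWeight_nonneg R Λ η ξ
  have h1 := hΛ.netWeight_le_one hη hξ
  nlinarith

end Partition

/-! ### Extension of a function as an average of discrete extensions. -/

section Discretization

variable {d : ℕ}

/-- The extension of an `L²` function is an average of discrete extensions of shifted nets. -/
theorem exists_extension_eq_integral_discExt (hd : 1 ≤ d) {R : ℝ} (hR : 1 ≤ R)
    {Λ : Finset (Eu d)} (hΛ : IsSphereNet R Λ) (c : Eu d) (g : L2Sph d) :
    ∃ A : Eu d → EuclideanSpace ℂ Λ, Measurable A ∧
      ∫⁻ τ, ‖A τ‖ₑ ^ 2 ∂(shiftMeasure d R) ≤ ‖g‖ₑ ^ 2 ∧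
      ∀ u, extension g (u + c) = ∫ τ, discExt Λ τ (A τ) u ∂(shiftMeasure d R) := by
  have hR0 : 0 < R := by linarith
  have hδ : (0 : ℝ) ≤ 1 / R := by positivity
  set κ := shellMass d (1 / R) with hκ
  have hκR : 1 / R ≤ κ := le_shellMass hd hδ
  have hκ0 : 0 < κ := lt_of_lt_of_le (by positivity) hκR
  have hRκ : 1 ≤ R * κ := by rwa [div_le_iff₀' hR0] at hκR
  -- A Borel extension of `g` to the whole space, so that it can be composed with the shift map.
  obtain ⟨G, hGm, hG⟩ := (MeasurableEmbedding.subtype_coe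
    (Metric.isClosed_sphere (x := (0 : Eu d)) (ε := 1)).measurableSet).exists_measurable_extend
    (Lp.stronglyMeasurable g).measurable fun _ => ⟨0⟩
  have hG' : ∀ ξ : Sph d, G ξ = g ξ := fun ξ => congrFun hG ξ
  have hwave : ∀ x : Eu d, Measurable fun ξ : Eu d => wave x ξ := fun x =>
    (continuous_wave.comp (continuous_const.prodMk continuous_id)).measurable
  -- The piece of `g` near `η`. The modulation by `wave c` recentres the extension at `c`, and `(R *
  -- κ)⁻¹` compensates the mass that integration over the shell produces.
  set F : Eu d → Eu d → ℂ := fun η ξ =>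
    ((R * κ)⁻¹ : ℝ) * (wave c ξ * G ξ * (netWeight R Λ η ξ : ℂ)) with hF
  have hFm : ∀ η, Measurable (F η) := fun η => by
    have := measurable_netWeight R Λ η
    have := hwave c
    simp only [hF]
    fun_prop
  set A : Eu d → EuclideanSpace ℂ Λ := fun τ => WithLp.toLp 2 fun η : Λ =>
    (shiftShell (η : Eu d) (1 / R)).indicator (fun τ => F η (shift η τ)) τ with hA
  have hAm : Measurable A := by
    refine (WithLp.measurable_toLp 2 _).comp (measurable_pi_iff.2 fun η => ?_)
    exact ((hFm η).comp (measurable_shift _)).indicator (measurableSet_shiftShell _ _)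
  -- The shell moves `η + τ` radially by at most `1/R`, and the weight keeps its direction within
  -- `1/R` of `η`. Hence `‖τ‖ ≤ 2/R`, and restricting the integral to the ball loses nothing.
  have hsupp : ∀ η ∈ Λ, ∀ τ, τ ∉ Metric.ball (0 : Eu d) (10 / R) →
      (shiftShell η (1 / R)).indicator (fun τ => F η (shift η τ)) τ = 0 := by
    intro η hη τ hτ
    by_contra hne
    have h1 : τ ∈ shiftShell η (1 / R) := by
      by_contra h; exact hne (Set.indicator_of_notMem h _)
    rw [Set.indicator_of_mem h1] at hne
    have h2 : dist (shift η τ) η ≤ 1 / R := by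
      refine dist_le_of_netWeight_ne_zero (R := R) (Λ := Λ) fun h => hne ?_
      simp [hF, h]
    have h0 : η + τ ≠ 0 := norm_pos_iff.1 (by linarith [h1.1])
    have h3 : ‖(η + τ) - shift η τ‖ ≤ 1 / R := by
      have h4 : (η + τ) - shift η τ = (‖η + τ‖ - 1) • shift η τ := by
        rw [sub_smul, one_smul]
        congr 1
        rw [shift, smul_inv_smul₀ (norm_ne_zero_iff.2 h0)]
      rw [h4, norm_smul, norm_shift h0, mul_one, Real.norm_of_nonneg (by linarith [h1.1])]
      linarith [h1.2]
    apply hτ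
    rw [mem_ball_zero_iff]
    have h5 : τ = ((η + τ) - shift η τ) + (shift η τ - η) := by abel
    rw [dist_eq_norm] at h2
    calc ‖τ‖ = ‖((η + τ) - shift η τ) + (shift η τ - η)‖ := by rw [← h5]
      _ ≤ 1 / R + 1 / R := (norm_add_le _ _).trans (add_le_add h3 h2)
      _ = 2 / R := by ring
      _ < 10 / R := by gcongr; norm_num
  have hnorm : ∀ ξ : Sph d, ∀ η, ‖F η ξ‖ₑ ^ 2 =
      ENNReal.ofReal ((R * κ)⁻¹ ^ 2) * (‖g ξ‖ₑ ^ 2 * ENNReal.ofReal (netWeight R Λ η ξ ^ 2)) := by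
    intro ξ η
    have h0 := netWeight_nonneg R Λ η ξ
    simp only [hF]
    rw [hG', ← ofReal_norm, ← ofReal_norm, norm_mul, norm_mul, norm_mul, norm_wave, one_mul,
      Complex.norm_real, Complex.norm_real, Real.norm_of_nonneg h0,
      Real.norm_of_nonneg (by positivity), ← ENNReal.ofReal_pow (by positivity),
      ← ENNReal.ofReal_pow (by positivity), ← ENNReal.ofReal_mul (by positivity),
      ← ENNReal.ofReal_mul (by positivity)]
    congr 1; ring
  have hgnorm : ∫⁻ ξ, ‖g ξ‖ₑ ^ 2 ∂(surf d) = ‖g‖ₑ ^ 2 := by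
    rw [Lp.enorm_def, eLpNorm_eq_lintegral_rpow_enorm_toReal (by norm_num) (by norm_num)]
    simp only [ENNReal.toReal_ofNat, ENNReal.rpow_ofNat]
    rw [← ENNReal.rpow_natCast, ← ENNReal.rpow_mul]
    norm_num
  refine ⟨A, hAm, ?_, ?_⟩
  · have hAn : ∀ τ, ‖A τ‖ₑ ^ 2 = ∑ η : Λ, (shiftShell (η : Eu d) (1 / R)).indicator
        (fun τ => ‖F η (shift η τ)‖ₑ ^ 2) τ := by
      intro τ
      rw [← ofReal_norm, ← ENNReal.ofReal_pow (norm_nonneg _), EuclideanSpace.norm_sq_eq,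
        ENNReal.ofReal_sum_of_nonneg fun _ _ => by positivity]
      refine Finset.sum_congr rfl fun η _ => ?_
      rw [ENNReal.ofReal_pow (norm_nonneg _), ofReal_norm]
      by_cases h : τ ∈ shiftShell (η : Eu d) (1 / R)
      · simp [hA, h, -one_div]
      · simp [hA, h, -one_div]
    calc ∫⁻ τ, ‖A τ‖ₑ ^ 2 ∂(shiftMeasure d R)
        ≤ ENNReal.ofReal R * ∫⁻ τ, ‖A τ‖ₑ ^ 2 := by
          rw [shiftMeasure, lintegral_smul_measure, smul_eq_mul]
          gcongr
          exact Measure.restrict_le_self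
      _ = ENNReal.ofReal R * ∑ η : Λ, ENNReal.ofReal κ *
            ∫⁻ ξ : Sph d, ‖F η ξ‖ₑ ^ 2 ∂(surf d) := by
          simp only [hAn]
          rw [lintegral_finsetSum (f := fun (η : Λ) => (shiftShell (η : Eu d) (1 / R)).indicator
            (fun τ => ‖F η (shift η τ)‖ₑ ^ 2)) _ fun η _ => Measurable.indicator
            (((hFm η).comp (measurable_shift _)).enorm.pow_const 2) (measurableSet_shiftShell _ _)]
          congr 1
          refine Finset.sum_congr rfl fun η _ => ?_
          rw [lintegral_indicator (measurableSet_shiftShell _ _),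
            lintegral_shift_shiftShell hd η hδ (F := fun ξ => ‖F η ξ‖ₑ ^ 2)
              ((hFm η).enorm.pow_const 2)]
      _ = ENNReal.ofReal R * ENNReal.ofReal κ *
            ∫⁻ ξ : Sph d, ∑ η : Λ, ‖F η ξ‖ₑ ^ 2 ∂(surf d) := by
          rw [← Finset.mul_sum, mul_assoc, lintegral_finsetSum (f := fun (η : Λ) (ξ : Sph d) => ‖F η ξ‖ₑ ^ 2) _ fun η _ =>
            ((hFm η).comp measurable_subtype_coe).enorm.pow_const 2]
      _ ≤ ENNReal.ofReal R * ENNReal.ofReal κ *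
            ∫⁻ ξ : Sph d, ENNReal.ofReal ((R * κ)⁻¹ ^ 2) * ‖g ξ‖ₑ ^ 2 ∂(surf d) := by
          refine mul_le_mul' le_rfl (lintegral_mono fun ξ => ?_)
          simp only [hnorm]
          rw [← Finset.mul_sum, ← Finset.mul_sum,
            ← ENNReal.ofReal_sum_of_nonneg fun _ _ => sq_nonneg _]
          refine mul_le_mul' le_rfl (mul_le_of_le_one_right' ?_)
          rw [ENNReal.ofReal_le_one, Finset.sum_coe_sort Λ fun η => netWeight R Λ η ξ ^ 2]
          exact hΛ.sum_netWeight_sq_le (norm_eq_of_mem_sphere ξ)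
      _ = ENNReal.ofReal (R * κ * (R * κ)⁻¹ ^ 2) * ‖g‖ₑ ^ 2 := by
          rw [lintegral_const_mul' _ _ ENNReal.ofReal_ne_top, hgnorm, ← mul_assoc,
            ← ENNReal.ofReal_mul hR0.le, ← ENNReal.ofReal_mul (by positivity)]
      _ ≤ ‖g‖ₑ ^ 2 := by
          refine mul_le_of_le_one_left' ?_
          rw [ENNReal.ofReal_le_one, pow_two, ← mul_assoc, mul_inv_cancel₀ (by positivity), one_mul]
          exact inv_le_one_of_one_le₀ hRκ
  · intro u
    have hint : ∀ η : Λ, Integrable (fun ξ : Sph d => F η ξ * wave u ξ) (surf d) := by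
      intro η
      refine Integrable.mono' (g := fun ξ => (R * κ)⁻¹ * ‖g ξ‖) ((integrable_L2Sph g).norm.const_mul _)
        (((hFm η).comp measurable_subtype_coe).mul
          ((hwave u).comp measurable_subtype_coe)).aestronglyMeasurable
        (Eventually.of_forall fun ξ => ?_)
      have hle : netWeight R Λ η ξ ≤ 1 :=
        hΛ.netWeight_le_one η.2 (norm_eq_of_mem_sphere ξ)
      simp only [hF]
      rw [norm_mul, norm_mul, norm_mul, norm_mul, norm_wave, norm_wave, one_mul, mul_one, hG',
        Complex.norm_real, Complex.norm_real, Real.norm_of_nonneg (netWeight_nonneg R Λ η ξ),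
        Real.norm_of_nonneg (by positivity)]
      exact mul_le_mul_of_nonneg_left (mul_le_of_le_one_right (norm_nonneg _) hle) (by positivity)
    have hterm : ∀ η : Λ, ∀ τ, A τ η * wave u (shift η τ) =
        (shiftShell (η : Eu d) (1 / R)).indicator
          (fun τ => F η (shift η τ) * wave u (shift η τ)) τ := by
      intro η τ
      by_cases h : τ ∈ shiftShell (η : Eu d) (1 / R)
      · simp [hA, h, -one_div]
      · simp [hA, h, -one_div]
    have hFw : ∀ η : Λ, Measurable fun ξ : Eu d => F η ξ * wave u ξ := fun η => (hFm η).mul (hwave u)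
    have hintS : ∀ η : Λ, Integrable ((shiftShell (η : Eu d) (1 / R)).indicator
        (fun τ => F η (shift η τ) * wave u (shift η τ))) := by
      intro η
      rw [integrable_indicator_iff (measurableSet_shiftShell _ _), IntegrableOn]
      have h1 : Integrable (fun ξ : Eu d => F η ξ * wave u ξ)
          (((volume : Measure (Eu d)).restrict (shiftShell (η : Eu d) (1 / R))).map (shift η)) := by
        rw [map_shift_shiftShell hd η hδ]
        refine Integrable.smul_measure ?_ ENNReal.ofReal_ne_top
        rw [integrable_map_measure (hFw η).aestronglyMeasurable measurable_subtype_coe.aemeasurable]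
        exact hint η
      exact h1.comp_measurable (measurable_shift _)
    have hball : ∀ η : Λ, ∫ τ, A τ η * wave u (shift η τ) ∂(shiftMeasure d R) =
        ((R * κ : ℝ) : ℂ) * ∫ ξ : Sph d, F η ξ * wave u ξ ∂(surf d) := by
      intro η
      simp only [hterm]
      rw [shiftMeasure, integral_smul_measure, setIntegral_eq_integral_of_forall_compl_eq_zero,
        integral_indicator (measurableSet_shiftShell _ _),
        integral_shift_shiftShell hd η hδ (hFw η), ENNReal.toReal_ofReal hR0.le, Complex.real_smul]
      · push_cast; ring
      · intro τ hτ
        have := hsupp η η.2 τ hτ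
        by_cases h : τ ∈ shiftShell (η : Eu d) (1 / R)
        · rw [Set.indicator_of_mem h] at this ⊢
          rw [this, zero_mul]
        · exact Set.indicator_of_notMem h _
    simp only [discExt]
    rw [integral_finsetSum]
    · simp only [hball]
      rw [← Finset.mul_sum, ← integral_finsetSum _ fun η _ => hint η, ← integral_const_mul]
      refine integral_congr_ae (Eventually.of_forall fun ξ => ?_)
      have h1 := hΛ.sum_netWeight (norm_eq_of_mem_sphere ξ)
      rw [← Finset.sum_coe_sort Λ fun η => netWeight R Λ η ξ] at h1
      have h2 : ((∑ η : Λ, netWeight R Λ η ξ : ℝ) : ℂ) = 1 := by rw [h1]; norm_num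
      have h3 : ((R * κ : ℝ) : ℂ) * ((R * κ)⁻¹ : ℝ) = 1 := by
        rw [← Complex.ofReal_mul, mul_inv_cancel₀ (by positivity), Complex.ofReal_one]
      simp only [hF, hG']
      calc wave (u + c) (ξ : Eu d) * g ξ
          = (((R * κ : ℝ) : ℂ) * ((R * κ)⁻¹ : ℝ)) * (wave u ξ * wave c ξ * g ξ) *
            ((∑ η : Λ, netWeight R Λ η ξ : ℝ) : ℂ) := by rw [h2, h3, wave_add]; ring
        _ = _ := by
            push_cast
            rw [Finset.mul_sum, Finset.mul_sum]
            refine Finset.sum_congr rfl fun η _ => ?_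
            ring
    · intro η _
      simp only [hterm]
      rw [shiftMeasure]
      exact (hintS η).restrict.smul_measure ENNReal.ofReal_ne_top

end Discretization

end RandomExtension

namespace RandomExtension

/-! ### Quadratic form and elementary bounds for the operator. -/

section SandwichBasics

variable {d : ℕ}

theorem sandwich_of_not_integrable {W : Eu d → ℂ} (hW : ¬Integrable W) : sandwich W = 0 :=
  dif_neg hW

theorem sandwich_coeFn {W : Eu d → ℂ} (hW : Integrable W) (g : L2Sph d) :
    sandwich W g =ᵐ[surf d] restriction fun x => W x * extension g x := by
  rw [sandwich, dif_pos hW]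
  exact MemLp.coeFn_toLp (memLp_restriction (integrable_mul_extension hW (integrable_L2Sph g)))

/-- The quadratic form of `𝓔^* W 𝓔`. -/
theorem inner_sandwich {W : Eu d → ℂ} (hW : Integrable W) (f g : L2Sph d) :
    inner ℂ (sandwich W g) f =
      ∫ x, starRingEnd ℂ (W x * extension g x) * extension f x := by
  have hH := integrable_mul_extension hW (integrable_L2Sph g)
  set H : Eu d → ℂ := fun x => W x * extension g x with hHdef
  have hHc : Integrable fun x => starRingEnd ℂ (H x) :=
    hH.congr' (Complex.continuous_conj.comp_aestronglyMeasurable hH.1)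
      (Eventually.of_forall fun x => (RCLike.norm_conj _).symm)
  have h1 : inner ℂ (sandwich W g) f =
      ∫ ξ, ∫ x, f ξ * (wave x (ξ : Eu d) * starRingEnd ℂ (H x)) ∂volume ∂(surf d) := by
    rw [L2.inner_def]
    refine integral_congr_ae ((sandwich_coeFn hW g).mono fun ξ hξ => ?_)
    simp only [RCLike.inner_apply]
    rw [hξ, restriction, ← integral_conj, ← integral_const_mul]
    refine integral_congr_ae (Eventually.of_forall fun x => ?_)
    change f ξ * starRingEnd ℂ (wave (-x) ξ * (W x * extension g x)) =
      f ξ * (wave x ξ * starRingEnd ℂ (W x * extension g x))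
    rw [map_mul, wave_neg, Complex.conj_conj]
  have hint : Integrable (Function.uncurry fun (ξ : Sph d) (x : Eu d) =>
      f ξ * (wave x (ξ : Eu d) * starRingEnd ℂ (H x))) ((surf d).prod volume) := by
    have h2 := (integrable_L2Sph f).mul_prod hHc
    refine (h2.bdd_mul (f := fun p : Sph d × Eu d => wave p.2 (p.1 : Eu d)) (c := 1) ?_
      (Eventually.of_forall fun p => (norm_wave _ _).le)).congr (Eventually.of_forall fun p => ?_)
    · exact (continuous_wave.comp
        (continuous_snd.prodMk (continuous_subtype_val.comp continuous_fst))).aestronglyMeasurable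
    · simp only [Function.uncurry]; ring
  rw [h1, integral_integral_swap hint]
  refine integral_congr_ae (Eventually.of_forall fun x => ?_)
  simp only [extension]
  rw [← integral_const_mul]
  refine integral_congr_ae (Eventually.of_forall fun ξ => ?_)
  simp only [hHdef, extension]
  ring

/-- The choice `f = T g` recovers the norm of `T g`. An infinite bound is permitted, so chain sums
need not be shown finite first. -/
theorem enorm_le_of_enorm_inner_le {E : Type*} [NormedAddCommGroup E] [InnerProductSpace ℂ E]
    {T : E →L[ℂ] E} {Q : ENNReal} (h : ∀ f g, ‖inner ℂ (T g) f‖ₑ ≤ Q * (‖g‖ₑ * ‖f‖ₑ)) :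
    ‖T‖ₑ ≤ Q := by
  rcases eq_or_ne Q ⊤ with rfl | hQ
  · exact le_top
  rw [← ofReal_norm, ← ENNReal.ofReal_toReal hQ]
  refine ENNReal.ofReal_le_ofReal (T.opNorm_le_bound ENNReal.toReal_nonneg fun g => ?_)
  have h1 := h (T g) g
  rw [← ENNReal.ofReal_toReal hQ, ← ofReal_norm, ← ofReal_norm, ← ofReal_norm,
    ← ENNReal.ofReal_mul (norm_nonneg _), ← ENNReal.ofReal_mul ENNReal.toReal_nonneg,
    ENNReal.ofReal_le_ofReal_iff (by positivity), inner_self_eq_norm_sq_to_K] at h1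
  rcases eq_or_ne (T g) 0 with h0 | h0
  · rw [h0, norm_zero]; positivity
  · refine le_of_mul_le_mul_right ?_ (norm_pos_iff.2 h0)
    refine le_trans (le_of_eq ?_) (h1.trans (le_of_eq (by ring)))
    rw [norm_pow, RCLike.norm_ofReal, abs_norm, sq]

/-- The trivial bound. -/
theorem exists_enorm_sandwich_le (d : ℕ) :
    ∃ C : ℝ, 0 ≤ C ∧ ∀ W : Eu d → ℂ, ‖sandwich W‖ₑ ≤ ENNReal.ofReal C * ∫⁻ x, ‖W x‖ₑ := by
  set s := ((surf d Set.univ) ^ (1 / 2 : ℝ)).toReal with hs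
  have hs0 : 0 ≤ s := ENNReal.toReal_nonneg
  refine ⟨s * s, by positivity, fun W => ?_⟩
  by_cases hW : Integrable W
  swap
  · rw [sandwich_of_not_integrable hW, ← ofReal_norm, norm_zero, ENNReal.ofReal_zero]
    exact zero_le
  refine enorm_le_of_enorm_inner_le fun f g => ?_
  rw [inner_sandwich hW]
  refine (enorm_integral_le_lintegral_enorm _).trans ?_
  have hle : ∀ (g : L2Sph d) x, ‖extension g x‖ₑ ≤ ENNReal.ofReal s * ‖g‖ₑ := by
    intro g x
    rw [← ofReal_norm, ← ofReal_norm, ← ENNReal.ofReal_mul hs0]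
    exact ENNReal.ofReal_le_ofReal ((norm_extension_le _ x).trans (integral_norm_L2Sph_le g))
  calc ∫⁻ x, ‖starRingEnd ℂ (W x * extension g x) * extension f x‖ₑ
      ≤ ∫⁻ x, (ENNReal.ofReal s * ‖g‖ₑ * (ENNReal.ofReal s * ‖f‖ₑ)) * ‖W x‖ₑ := by
        refine lintegral_mono fun x => ?_
        rw [enorm_mul, RCLike.enorm_conj, enorm_mul, mul_assoc, mul_comm]
        exact mul_le_mul' (mul_le_mul' (hle g x) (hle f x)) le_rfl
    _ = _ := by
        rw [lintegral_const_mul'' _ hW.1.enorm, ENNReal.ofReal_mul hs0]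
        ring

theorem sandwich_congr_ae {W W' : Eu d → ℂ} (h : W =ᵐ[volume] W') : sandwich W = sandwich W' := by
  by_cases hW : Integrable W
  · have hW' := hW.congr h
    refine ContinuousLinearMap.ext fun g => ext_inner_right ℂ fun f => ?_
    rw [inner_sandwich hW, inner_sandwich hW']
    exact integral_congr_ae (h.mono fun x hx => by simp only [hx])
  · rw [sandwich_of_not_integrable hW,
      sandwich_of_not_integrable fun hW' => hW (hW'.congr h.symm)]

end SandwichBasics

/-! ### Noise cells and the decomposition into lattice translates. -/

section Cells

variable {d : ℕ}

theorem measurable_cell (h : ℝ) : Measurable (cell h : Eu d → Fin d → ℤ) := by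
  refine measurable_pi_iff.2 fun i => Int.measurable_floor.comp ?_
  fun_prop

theorem finite_cell_image_ball {h : ℝ} (hh : 0 < h) (c : Eu d) (R : ℝ) :
    (cell h '' Metric.ball c R).Finite := by
  refine Set.Finite.subset (Finset.finite_toSet (Fintype.piFinset fun i =>
    Finset.Icc ⌊(c i - R) / h⌋ ⌊(c i + R) / h⌋)) ?_
  rintro _ ⟨x, hx, rfl⟩
  rw [Finset.mem_coe, Fintype.mem_piFinset]
  intro i
  rw [Metric.mem_ball, dist_eq_norm] at hx
  have h1 : |x i - c i| ≤ R := by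
    have := PiLp.norm_apply_le (x - c) i
    rw [PiLp.sub_apply, Real.norm_eq_abs] at this
    linarith
  rw [abs_le] at h1
  rw [Finset.mem_Icc]
  constructor <;> refine Int.floor_le_floor ?_ <;> gcongr <;> linarith

theorem aestronglyMeasurable_anderson {h : ℝ} (w : (Fin d → ℤ) → ℝ) {V : Eu d → ℂ}
    (hV : AEStronglyMeasurable V volume) : AEStronglyMeasurable (anderson h w V) volume := by
  have h1 : Measurable fun x : Eu d => ((w (cell h x) : ℝ) : ℂ) :=
    Complex.measurable_ofReal.comp ((measurable_of_countable w).comp (measurable_cell h))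
  exact h1.aestronglyMeasurable.mul hV

theorem integrable_anderson {R h : ℝ} (hh : 0 < h) (w : (Fin d → ℤ) → ℝ) {V : Eu d → ℂ} {c : Eu d}
    (hV : MemLp V ⊤ volume) (hsupp : Function.support V ⊆ Metric.ball c R) :
    Integrable (anderson h w V) := by
  have hfin := finite_cell_image_ball hh c R
  have hle : ∀ x ∈ Metric.ball c R, |w (cell h x)| ≤ ∑ n ∈ hfin.toFinset, |w n| := fun x hx =>
    Finset.single_le_sum (f := fun n => |w n|) (fun _ _ => abs_nonneg _)
      (hfin.mem_toFinset.2 ⟨x, hx, rfl⟩)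
  set S := ∑ n ∈ hfin.toFinset, |w n|
  set B := (eLpNorm V ⊤ volume).toReal
  have hS : 0 ≤ S := Finset.sum_nonneg fun _ _ => abs_nonneg _
  refine Integrable.mono' (g := (Metric.ball c R).indicator fun _ => S * B) ?_
    (aestronglyMeasurable_anderson w hV.1) ?_
  · exact (integrable_indicator_iff measurableSet_ball).2 (integrableOn_const measure_ball_lt_top.ne)
  · refine (ae_norm_le_toReal_eLpNorm_top hV).mono fun x hx => ?_
    rw [norm_anderson]
    by_cases h : x ∈ Metric.ball c R
    · rw [Set.indicator_of_mem h]
      exact mul_le_mul (hle x h) hx (norm_nonneg _) hS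
    · rw [Set.indicator_of_notMem h, Function.notMem_support.1 fun h' => h (hsupp h'), norm_zero,
        mul_zero]

theorem cell_one_latticePt_add (i : Fin d → ℤ) (y : Eu d) :
    cell 1 (latticePt i + y) = i ↔ y ∈ unitCell d := by
  rw [cell_eq_iff one_pos, unitCell, Set.mem_ofPred_eq]
  refine forall_congr' fun j => ?_
  have : ((latticePt i + y) j - 1 * (i j : ℝ)) / 1 = y j := by
    simp [latticePt]
  rw [this]

/-- An integral over the space as an integral of lattice sums over the unit cell. -/
theorem enorm_integral_le_lintegral_unitCell {G : Eu d → ℂ} (hG : Integrable G) :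
    ‖∫ x, G x‖ₑ ≤ ∫⁻ y in unitCell d, ‖∑' i : Fin d → ℤ, G (latticePt i + y)‖ₑ := by
  set s : (Fin d → ℤ) → Set (Eu d) := fun i => cell 1 ⁻¹' {i} with hs
  have hsm : ∀ i, MeasurableSet (s i) := fun i => measurable_cell 1 (measurableSet_singleton i)
  have hsd : Pairwise (Function.onFun Disjoint s) := fun i j hij =>
    Disjoint.preimage _ (Set.disjoint_singleton.2 hij)
  have hsu : ⋃ i, s i = Set.univ := by
    ext x; simp [hs]
  have hpre : ∀ i, (fun y => latticePt i + y) ⁻¹' s i = unitCell d := fun i => by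
    ext y; exact cell_one_latticePt_add i y
  have hmp : ∀ i : Fin d → ℤ, MeasurePreserving (fun y : Eu d => latticePt i + y) volume volume :=
    fun i => measurePreserving_add_left volume _
  have hemb : ∀ i : Fin d → ℤ, MeasurableEmbedding fun y : Eu d => latticePt i + y :=
    fun i => (MeasurableEquiv.addLeft (latticePt i)).measurableEmbedding
  have h1 : ∫ x, G x = ∑' i, ∫ y in unitCell d, G (latticePt i + y) := by
    rw [← setIntegral_univ, ← hsu, integral_iUnion hsm hsd hG.integrableOn]
    refine tsum_congr fun i => ?_
    rw [← (hmp i).setIntegral_preimage_emb (hemb i), hpre]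
  have h2 : ∑' i, ∫⁻ y in unitCell d, ‖G (latticePt i + y)‖ₑ = ∫⁻ x, ‖G x‖ₑ := by
    rw [← setLIntegral_univ (fun x => ‖G x‖ₑ), ← hsu, lintegral_iUnion hsm hsd]
    refine tsum_congr fun i => ?_
    rw [← (hmp i).setLIntegral_comp_preimage_emb (hemb i) (fun x => ‖G x‖ₑ), hpre]
  rw [h1, ← integral_tsum]
  · exact enorm_integral_le_lintegral_enorm _
  · intro i
    exact (hG.1.comp_measurePreserving (hmp i)).restrict
  · rw [h2]; exact hG.2.ne

end Cells

/-! ### The chain decomposition of the bilinear sums. -/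

section Chaining

variable {d : ℕ}

theorem discExt_sum {ι : Type*} {Λ : Finset (Eu d)} (τ : Eu d) (s : Finset ι)
    (b : ι → EuclideanSpace ℂ Λ) (u : Eu d) :
    discExt Λ τ (∑ k ∈ s, b k) u = ∑ k ∈ s, discExt Λ τ (b k) u := by
  classical
  induction s using Finset.induction_on with
  | empty => simp [discExt]
  | insert k s hk ih => rw [Finset.sum_insert hk, Finset.sum_insert hk, discExt_add, ih]

/-- Each point of the unit ball is the limit of a chain. -/
theorem IsChain.exists_chain {R : ℝ} {Λ : Finset (Eu d)} {Z : ℕ → Finset (EuclideanSpace ℂ Λ)}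
    (hZ : IsChain R Λ Z) {a : EuclideanSpace ℂ Λ} (ha : ‖a‖ ≤ 1) :
    ∃ z : ℕ → EuclideanSpace ℂ Λ, z 0 = 0 ∧ (∀ k, z (k + 1) - z k ∈ links R Λ Z k) ∧
      ∀ τ u, ‖τ‖ < 10 / R → ‖u‖ < R →
        Tendsto (fun k => discExt Λ τ (z k) u) atTop (𝓝 (discExt Λ τ a u)) := by
  -- The chain consists of approximating centres of `a` in the successive covers. Consecutive ones
  -- are links by the triangle inequality, and the chain starts at the origin because `Z 0 = {0}`.
  choose z hzZ hz using fun k => (hZ.2 k).1.2 a ha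
  have hz' : ∀ k τ, ‖τ‖ < 10 / R → ∀ u, ‖u‖ < R →
      ‖discExt Λ τ (a - z k) u‖ ≤ (2 : ℝ)⁻¹ ^ k * Real.sqrt Λ.card := fun k =>
    (chainNorm_le_ofReal_iff (by positivity)).1 (hz k)
  refine ⟨z, ?_, fun k => ⟨z k, hzZ k, z (k + 1), hzZ (k + 1), rfl, ?_⟩, fun τ u hτ hu => ?_⟩
  · have := hzZ 0
    rw [hZ.1] at this
    exact Finset.mem_singleton.1 this
  · have hs : 2 * chainScale Λ k = ENNReal.ofReal (2 * ((2 : ℝ)⁻¹ ^ k * Real.sqrt Λ.card)) := by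
      rw [chainScale, ENNReal.ofReal_mul zero_le_two, ENNReal.ofReal_ofNat]
    rw [hs, chainNorm_le_ofReal_iff (by positivity)]
    intro τ hτ u hu
    have h1 : discExt Λ τ (z (k + 1) - z k) u =
        discExt Λ τ (a - z k) u - discExt Λ τ (a - z (k + 1)) u := by
      rw [← discExt_sub]; congr 1; abel
    have h2 := hz' k τ hτ u hu
    have h3 := hz' (k + 1) τ hτ u hu
    have h4 : (0 : ℝ) ≤ (2 : ℝ)⁻¹ ^ k * Real.sqrt Λ.card := by positivity
    rw [h1]
    refine (norm_sub_le _ _).trans ?_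
    rw [pow_succ] at h3
    linarith
  · rw [tendsto_iff_norm_sub_tendsto_zero]
    have hlim : Tendsto (fun k : ℕ => (2 : ℝ)⁻¹ ^ k * Real.sqrt Λ.card) atTop (𝓝 0) := by
      have := (tendsto_pow_atTop_nhds_zero_of_lt_one (r := (2 : ℝ)⁻¹) (by norm_num)
        (by norm_num)).mul_const (Real.sqrt Λ.card)
      rwa [zero_mul] at this
    refine squeeze_zero (fun _ => norm_nonneg _) (fun k => ?_) hlim
    rw [norm_sub_rev, ← discExt_sub]
    exact hz' k τ hτ u hu

/-- The chaining bound on the unit ball. -/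
theorem enorm_chainTerm_le_of_norm_le_one {R h : ℝ} (w : (Fin d → ℤ) → ℝ) {V : Eu d → ℂ}
    {c : Eu d} (hV : Function.support V ⊆ Metric.ball c R) {Λ : Finset (Eu d)}
    {Z : ℕ → Finset (EuclideanSpace ℂ Λ)} (hZ : IsChain R Λ Z) {a a' : EuclideanSpace ℂ Λ}
    (ha : ‖a‖ ≤ 1) (ha' : ‖a'‖ ≤ 1) (y : Eu d) {τ τ' : Eu d} (hτ : ‖τ‖ < 10 / R)
    (hτ' : ‖τ'‖ < 10 / R) :
    ‖chainTerm h w V c Λ a a' y τ τ'‖ₑ ≤ ∑' (k : ℕ) (k' : ℕ), maxTerm R h w V c Λ Z k k' y τ τ' := by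
  obtain ⟨z, hz0, hzl, hzlim⟩ := hZ.exists_chain ha
  obtain ⟨z', hz0', hzl', hzlim'⟩ := hZ.exists_chain ha'
  -- Only finitely many samples occur, so pointwise convergence of the discrete extensions passes to
  -- the chaining term. The partial chains are then expanded by sesquilinearity into links.
  have hlim : Tendsto (fun K => chainTerm h w V c Λ (z K) (z' K) y τ τ') atTop
      (𝓝 (chainTerm h w V c Λ a a' y τ τ')) := by
    simp only [chainTerm_eq_sum h w hV]
    refine tendsto_finsetSum _ fun i hi => ?_
    have hi' := mem_sampleSet.1 hi
    exact ((Complex.continuous_conj.tendsto _).comp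
      ((hzlim τ _ hτ hi').const_mul _)).mul (hzlim' τ' _ hτ' hi')
  refine le_of_tendsto hlim.enorm (Eventually.of_forall fun K => ?_)
  have h1 : ∀ {z : ℕ → EuclideanSpace ℂ Λ}, z 0 = 0 → z K = ∑ k ∈ Finset.range K, (z (k + 1) - z k) :=
    fun {z} h0 => by rw [Finset.sum_range_sub, h0, sub_zero]
  have h2 : chainTerm h w V c Λ (z K) (z' K) y τ τ' =
      ∑ k ∈ Finset.range K, ∑ k' ∈ Finset.range K,
        chainTerm h w V c Λ (z (k + 1) - z k) (z' (k' + 1) - z' k') y τ τ' := by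
    rw [h1 hz0, h1 hz0']
    simp only [chainTerm_eq_sum h w hV, discExt_sum]
    rw [Finset.sum_congr rfl fun k _ => Finset.sum_comm, Finset.sum_comm]
    refine Finset.sum_congr rfl fun i _ => ?_
    rw [Finset.mul_sum _ _ (anderson h w V (latticePt i + y)), map_sum, Finset.sum_mul_sum]
  rw [h2]
  calc _ ≤ ∑ k ∈ Finset.range K, ∑ k' ∈ Finset.range K,
        ‖chainTerm h w V c Λ (z (k + 1) - z k) (z' (k' + 1) - z' k') y τ τ'‖ₑ :=
        (enorm_sum_le _ _).trans (Finset.sum_le_sum fun k _ => enorm_sum_le _ _)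
    _ ≤ ∑ k ∈ Finset.range K, ∑ k' ∈ Finset.range K, maxTerm R h w V c Λ Z k k' y τ τ' := by
        refine Finset.sum_le_sum fun k _ => Finset.sum_le_sum fun k' _ => ?_
        exact le_iSup₂_of_le _ (hzl k) (le_iSup₂_of_le _ (hzl' k') le_rfl)
    _ ≤ ∑ k ∈ Finset.range K, ∑' k', maxTerm R h w V c Λ Z k k' y τ τ' :=
        Finset.sum_le_sum fun k _ => ENNReal.sum_le_tsum _
    _ ≤ _ := ENNReal.sum_le_tsum _

theorem chainTerm_smul_smul {R h : ℝ} (w : (Fin d → ℤ) → ℝ) {V : Eu d → ℂ}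
    {c : Eu d} (hV : Function.support V ⊆ Metric.ball c R) {Λ : Finset (Eu d)} (s t : ℂ)
    (a a' : EuclideanSpace ℂ Λ) (y τ τ' : Eu d) :
    chainTerm h w V c Λ (s • a) (t • a') y τ τ' =
      starRingEnd ℂ s * t * chainTerm h w V c Λ a a' y τ τ' := by
  simp only [chainTerm_eq_sum h w hV, discExt_smul, Finset.mul_sum, map_mul]
  exact Finset.sum_congr rfl fun i _ => by ring

/-- The chaining bound. -/
theorem enorm_chainTerm_le {R h : ℝ} (w : (Fin d → ℤ) → ℝ) {V : Eu d → ℂ}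
    {c : Eu d} (hV : Function.support V ⊆ Metric.ball c R) {Λ : Finset (Eu d)}
    {Z : ℕ → Finset (EuclideanSpace ℂ Λ)} (hZ : IsChain R Λ Z) (a a' : EuclideanSpace ℂ Λ)
    (y : Eu d) {τ τ' : Eu d} (hτ : ‖τ‖ < 10 / R) (hτ' : ‖τ'‖ < 10 / R) :
    ‖chainTerm h w V c Λ a a' y τ τ'‖ₑ ≤
      ‖a‖ₑ * ‖a'‖ₑ * ∑' (k : ℕ) (k' : ℕ), maxTerm R h w V c Λ Z k k' y τ τ' := by
  have key : ∀ a : EuclideanSpace ℂ Λ, ∃ b : EuclideanSpace ℂ Λ, ‖b‖ ≤ 1 ∧ a = (‖a‖ : ℂ) • b := by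
    intro a
    rcases eq_or_ne a 0 with rfl | ha
    · exact ⟨0, by simp, by simp⟩
    · have h0 : (‖a‖ : ℂ) ≠ 0 := by exact_mod_cast norm_ne_zero_iff.2 ha
      refine ⟨(‖a‖ : ℂ)⁻¹ • a, ?_, (smul_inv_smul₀ h0 a).symm⟩
      rw [norm_smul, norm_inv, Complex.norm_real, norm_norm,
        inv_mul_cancel₀ (norm_ne_zero_iff.2 ha)]
  obtain ⟨b, hb, hab⟩ := key a
  obtain ⟨b', hb', hab'⟩ := key a'
  have h1 : ∀ a : EuclideanSpace ℂ Λ, ‖((‖a‖ : ℝ) : ℂ)‖ₑ = ‖a‖ₑ := fun a => by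
    rw [← ofReal_norm, ← ofReal_norm, Complex.norm_real, norm_norm]
  conv_lhs => rw [hab, hab', chainTerm_smul_smul w hV]
  rw [enorm_mul, enorm_mul, RCLike.enorm_conj, h1, h1]
  exact mul_le_mul' le_rfl (enorm_chainTerm_le_of_norm_le_one w hV hZ hb hb' y hτ hτ')

end Chaining

end RandomExtension

namespace RandomExtension

/-! ### Joint measurability in the noise and in the parameters. -/

section JointMeasurability

variable {d : ℕ}

/-- The noise is evaluated at an index that depends on `x`; this is jointly measurable because the
index set is countable. -/
theorem measurable_anderson_prod (h : ℝ) {V : Eu d → ℂ} (hV : Measurable V) :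
    Measurable fun p : ((Fin d → ℤ) → ℝ) × Eu d => anderson h p.1 V p.2 := by
  have h1 : Measurable fun q : ((Fin d → ℤ) → ℝ) × (Fin d → ℤ) => q.1 q.2 :=
    measurable_from_prod_countable_left fun n => measurable_pi_apply n
  have h2 : Measurable fun p : ((Fin d → ℤ) → ℝ) × Eu d => p.1 (cell h p.2) :=
    h1.comp (measurable_fst.prodMk ((measurable_cell h).comp measurable_snd))
  exact (Complex.measurable_ofReal.comp h2).mul (hV.comp measurable_snd)

theorem measurable_wave_shift (η : Eu d) :
    Measurable fun p : Eu d × Eu d => wave p.2 (shift η p.1) :=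
  Complex.measurable_exp.comp ((Complex.measurable_ofReal.comp
    (measurable_snd.inner ((measurable_shift η).comp measurable_fst))).const_mul _)

theorem measurable_discExt (Λ : Finset (Eu d)) (b : EuclideanSpace ℂ Λ) :
    Measurable fun p : Eu d × Eu d => discExt Λ p.1 b p.2 := by
  unfold discExt
  exact Finset.measurable_fun_sum _ fun η _ => (measurable_wave_shift _).const_mul _

theorem measurable_chainTerm {h : ℝ} {V : Eu d → ℂ} {c : Eu d} (hVm : Measurable V) (Λ : Finset (Eu d)) (b b' : EuclideanSpace ℂ Λ) :
    Measurable fun p : (((Fin d → ℤ) → ℝ) × Eu d) × (Eu d × Eu d) =>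
      chainTerm h p.1.1 V c Λ b b' p.1.2 p.2.1 p.2.2 := by
  set F : (Fin d → ℤ) → (((Fin d → ℤ) → ℝ) × Eu d) × (Eu d × Eu d) → ℂ := fun i p =>
    starRingEnd ℂ (anderson h p.1.1 V (latticePt i + p.1.2) *
      discExt Λ p.2.1 b (latticePt i + p.1.2 - c)) * discExt Λ p.2.2 b' (latticePt i + p.1.2 - c)
    with hF
  have hFm : ∀ i, Measurable (F i) := by
    intro i
    have h1 : Measurable fun p : (((Fin d → ℤ) → ℝ) × Eu d) × (Eu d × Eu d) =>
        latticePt i + p.1.2 := by fun_prop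
    have h2 : Measurable fun p : (((Fin d → ℤ) → ℝ) × Eu d) × (Eu d × Eu d) =>
        anderson h p.1.1 V (latticePt i + p.1.2) :=
      (measurable_anderson_prod h hVm).comp
        (f := fun p : (((Fin d → ℤ) → ℝ) × Eu d) × (Eu d × Eu d) => (p.1.1, latticePt i + p.1.2))
        ((measurable_fst.comp measurable_fst).prodMk h1)
    have h3 : Measurable fun p : (((Fin d → ℤ) → ℝ) × Eu d) × (Eu d × Eu d) =>
        discExt Λ p.2.1 b (latticePt i + p.1.2 - c) :=
      (measurable_discExt Λ b).comp
        (f := fun p : (((Fin d → ℤ) → ℝ) × Eu d) × (Eu d × Eu d) =>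
          (p.2.1, latticePt i + p.1.2 - c))
        ((measurable_fst.comp measurable_snd).prodMk (h1.sub_const c))
    have h4 : Measurable fun p : (((Fin d → ℤ) → ℝ) × Eu d) × (Eu d × Eu d) =>
        discExt Λ p.2.2 b' (latticePt i + p.1.2 - c) :=
      (measurable_discExt Λ b').comp
        (f := fun p : (((Fin d → ℤ) → ℝ) × Eu d) × (Eu d × Eu d) =>
          (p.2.2, latticePt i + p.1.2 - c))
        ((measurable_snd.comp measurable_snd).prodMk (h1.sub_const c))
    exact (Complex.continuous_conj.measurable.comp (h2.mul h3)).mul h4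
  exact Measurable.tsum hFm

theorem measurable_maxTerm {R h : ℝ} {V : Eu d → ℂ} {c : Eu d} (hVm : Measurable V) (Λ : Finset (Eu d))
    (Z : ℕ → Finset (EuclideanSpace ℂ Λ)) (k k' : ℕ) :
    Measurable fun p : (((Fin d → ℤ) → ℝ) × Eu d) × (Eu d × Eu d) =>
      maxTerm R h p.1.1 V c Λ Z k k' p.1.2 p.2.1 p.2.2 := by
  unfold maxTerm
  refine Measurable.biSup _ (countable_links Z k) fun b _ =>
    Measurable.biSup _ (countable_links Z k') fun b' _ => ?_
  exact (measurable_chainTerm hVm Λ b b').enorm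

end JointMeasurability

/-! ### Bounding the operator norm by the chain. -/

section OperatorBound

variable {d : ℕ}

instance (d : ℕ) (R : ℝ) : IsFiniteMeasure (shiftMeasure d R) := by
  unfold shiftMeasure
  have : IsFiniteMeasure ((volume : Measure (Eu d)).restrict (Metric.ball 0 (10 / R))) :=
    isFiniteMeasure_restrict.2 measure_ball_lt_top.ne
  exact Measure.smul_finite _ ENNReal.ofReal_ne_top

theorem integrable_discExt_of_lintegral_sq {R : ℝ} {Λ : Finset (Eu d)} {A : Eu d → EuclideanSpace ℂ Λ}
    (hA : Measurable A) (hA2 : ∫⁻ τ, ‖A τ‖ₑ ^ 2 ∂(shiftMeasure d R) < ⊤) (u : Eu d) :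
    Integrable (fun τ => discExt Λ τ (A τ) u) (shiftMeasure d R) := by
  have h1 : MemLp A 2 (shiftMeasure d R) := by
    refine ⟨hA.aestronglyMeasurable, ?_⟩
    rw [eLpNorm_lt_top_iff_lintegral_rpow_enorm_lt_top (by norm_num) (by norm_num)]
    simpa using hA2
  have h2 : Integrable A (shiftMeasure d R) := h1.integrable (by norm_num)
  refine Integrable.mono' (h2.norm.const_mul (Real.sqrt Λ.card)) ?_
    (Eventually.of_forall fun τ => norm_discExt_le τ (A τ) u)
  refine Measurable.aestronglyMeasurable ?_
  unfold discExt
  refine Finset.measurable_fun_sum _ fun η _ => Measurable.mul ?_ ?_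
  · exact (measurable_pi_apply η).comp ((WithLp.measurable_ofLp 2 _).comp hA)
  · exact (measurable_wave_shift (η : Eu d)).comp (f := fun τ : Eu d => (τ, u))
      (measurable_id.prodMk measurable_const)

/-- Cauchy–Schwarz in both shifts, where only the mean square of the coefficients is known. This is
why the chain is measured by a square root of second moments in `τ` and `τ'`. -/
theorem lintegral_enorm_mul_enorm_mul_le {E : Type*} [NormedAddCommGroup E] [MeasurableSpace E]
    [OpensMeasurableSpace E] {ν : Measure (Eu d)} [IsFiniteMeasure ν] {A A' : Eu d → E}
    (hA : Measurable A) (hA' : Measurable A') {m : Eu d × Eu d → ENNReal} (hm : Measurable m)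
    {p q : ENNReal} (hp : ∫⁻ τ, ‖A τ‖ₑ ^ 2 ∂ν ≤ p ^ 2) (hq : ∫⁻ τ, ‖A' τ‖ₑ ^ 2 ∂ν ≤ q ^ 2) :
    ∫⁻ z, ‖A z.1‖ₑ * ‖A' z.2‖ₑ * m z ∂(ν.prod ν) ≤
      p * q * (∫⁻ z, m z ^ 2 ∂(ν.prod ν)) ^ (1 / 2 : ℝ) := by
  have h1 := ENNReal.lintegral_mul_le_Lp_mul_Lq (ν.prod ν) Real.HolderConjugate.two_two
    (f := fun z => ‖A z.1‖ₑ * ‖A' z.2‖ₑ) (g := m) (by fun_prop) hm.aemeasurable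
  refine h1.trans (mul_le_mul' ?_ (le_of_eq (by simp)))
  have h2 : ∫⁻ z, (‖A z.1‖ₑ * ‖A' z.2‖ₑ) ^ (2 : ℝ) ∂(ν.prod ν) ≤ (p * q) ^ (2 : ℝ) := by
    simp only [ENNReal.rpow_ofNat, mul_pow]
    rw [lintegral_prod_mul (f := fun τ => ‖A τ‖ₑ ^ 2) (g := fun τ => ‖A' τ‖ₑ ^ 2) (by fun_prop)
      (by fun_prop)]
    exact mul_le_mul' hp hq
  calc _ ≤ ((p * q) ^ (2 : ℝ)) ^ (1 / 2 : ℝ) := by gcongr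
    _ = p * q := by rw [← ENNReal.rpow_mul]; norm_num

/-- The lattice sum of the quadratic form as an average of chaining terms. -/
theorem enorm_tsum_lattice_le {R h : ℝ} (w : (Fin d → ℤ) → ℝ) {V : Eu d → ℂ} {c : Eu d}
    (hV : Function.support V ⊆ Metric.ball c R) {Λ : Finset (Eu d)}
    {A A' : Eu d → EuclideanSpace ℂ Λ} {F F' : Eu d → ℂ}
    (hA : ∀ u, Integrable (fun τ => discExt Λ τ (A τ) u) (shiftMeasure d R))
    (hA' : ∀ u, Integrable (fun τ => discExt Λ τ (A' τ) u) (shiftMeasure d R))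
    (hF : ∀ u, F (u + c) = ∫ τ, discExt Λ τ (A τ) u ∂(shiftMeasure d R))
    (hF' : ∀ u, F' (u + c) = ∫ τ, discExt Λ τ (A' τ) u ∂(shiftMeasure d R)) (y : Eu d) :
    ‖∑' i : Fin d → ℤ, starRingEnd ℂ (anderson h w V (latticePt i + y) * F (latticePt i + y)) *
        F' (latticePt i + y)‖ₑ ≤
      ∫⁻ τ, ∫⁻ τ', ‖chainTerm h w V c Λ (A τ) (A' τ') y τ τ'‖ₑ
        ∂(shiftMeasure d R) ∂(shiftMeasure d R) := by
  set ν := shiftMeasure d R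
  have h0 : ∀ i ∉ sampleSet R c y, starRingEnd ℂ (anderson h w V (latticePt i + y) *
      F (latticePt i + y)) * F' (latticePt i + y) = 0 := by
    intro i hi
    have h0 : V (latticePt i + y) = 0 := by
      by_contra hne
      have := hV (Function.mem_support.2 hne)
      rw [Metric.mem_ball, dist_eq_norm] at this
      exact hi (mem_sampleSet.2 this)
    simp [anderson, h0]
  have h1 : ∀ i : Fin d → ℤ, starRingEnd ℂ (anderson h w V (latticePt i + y) *
      F (latticePt i + y)) * F' (latticePt i + y) =
      ∫ τ, ∫ τ', starRingEnd ℂ (anderson h w V (latticePt i + y) *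
        discExt Λ τ (A τ) (latticePt i + y - c)) *
          discExt Λ τ' (A' τ') (latticePt i + y - c) ∂ν ∂ν := by
    intro i
    have h2 := hF (latticePt i + y - c)
    have h3 := hF' (latticePt i + y - c)
    rw [sub_add_cancel] at h2 h3
    simp only [integral_const_mul]
    rw [integral_mul_const, integral_conj, integral_const_mul, ← h2, ← h3]
  have hint : ∀ i : Fin d → ℤ, Integrable (fun τ => starRingEnd ℂ (anderson h w V (latticePt i + y) *
      discExt Λ τ (A τ) (latticePt i + y - c))) ν := fun i =>
    ((hA (latticePt i + y - c)).const_mul _).congr'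
      (Complex.continuous_conj.comp_aestronglyMeasurable ((hA _).const_mul _).1)
      (Eventually.of_forall fun x => (RCLike.norm_conj _).symm)
  rw [tsum_eq_sum h0, Finset.sum_congr rfl fun i _ => h1 i, ← integral_finsetSum]
  swap
  · intro i _
    simp only [integral_const_mul]
    exact (hint i).mul_const _
  refine (enorm_integral_le_lintegral_enorm _).trans (lintegral_mono fun τ => ?_)
  rw [← integral_finsetSum _ fun i _ => (hA' _).const_mul _]
  refine (enorm_integral_le_lintegral_enorm _).trans (lintegral_mono fun τ' => ?_)
  rw [chainTerm_eq_sum h w hV]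

/-- The chaining bound for a realization of the operator. -/
theorem enorm_sandwich_anderson_le (hd : 1 ≤ d) {R h : ℝ} (hR : 1 ≤ R) (hh : 0 < h)
    (w : (Fin d → ℤ) → ℝ) {V : Eu d → ℂ} {c : Eu d} (hVm : Measurable V)
    (hV : MemLp V ⊤ volume) (hsupp : Function.support V ⊆ Metric.ball c R)
    {Λ : Finset (Eu d)} (hΛ : IsSphereNet R Λ) {Z : ℕ → Finset (EuclideanSpace ℂ Λ)}
    (hZ : IsChain R Λ Z) :
    ‖sandwich (anderson h w V)‖ₑ ≤ ∑' p : ℕ × ℕ, ∫⁻ y in unitCell d,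
      (∫⁻ z, maxTerm R h w V c Λ Z p.1 p.2 y z.1 z.2 ^ 2
        ∂((shiftMeasure d R).prod (shiftMeasure d R))) ^ (1 / 2 : ℝ) := by
  have hW := integrable_anderson hh w hV hsupp
  set ν := shiftMeasure d R
  refine enorm_le_of_enorm_inner_le fun f g => ?_
  obtain ⟨A, hAm, hA2, hA⟩ := exists_extension_eq_integral_discExt hd hR hΛ c g
  obtain ⟨A', hAm', hA2', hA'⟩ := exists_extension_eq_integral_discExt hd hR hΛ c f
  have hAi := integrable_discExt_of_lintegral_sq hAm
    (hA2.trans_lt (ENNReal.pow_lt_top enorm_lt_top))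
  have hAi' := integrable_discExt_of_lintegral_sq hAm'
    (hA2'.trans_lt (ENNReal.pow_lt_top enorm_lt_top))
  have hmeas : ∀ p : ℕ × ℕ, Measurable fun q : Eu d × (Eu d × Eu d) =>
      maxTerm R h w V c Λ Z p.1 p.2 q.1 q.2.1 q.2.2 := fun p =>
    (measurable_maxTerm hVm Λ Z p.1 p.2).comp
      (f := fun q : Eu d × (Eu d × Eu d) => ((w, q.1), q.2)) (by fun_prop)
  have hmeasy : ∀ (p : ℕ × ℕ) (y : Eu d), Measurable fun z : Eu d × Eu d =>
      maxTerm R h w V c Λ Z p.1 p.2 y z.1 z.2 := fun p y =>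
    (hmeas p).comp (f := fun z : Eu d × Eu d => (y, z)) (measurable_const.prodMk measurable_id)
  rw [inner_sandwich hW]
  have hG : Integrable fun x => starRingEnd ℂ (anderson h w V x * extension g x) *
      extension f x := by
    have hH := integrable_mul_extension hW (integrable_L2Sph g)
    exact integrable_mul_extension (hH.congr' (Complex.continuous_conj.comp_aestronglyMeasurable hH.1)
      (Eventually.of_forall fun x => (RCLike.norm_conj _).symm)) (integrable_L2Sph f)
  refine (enorm_integral_le_lintegral_unitCell hG).trans ?_
  have hy : ∀ y, ‖∑' i : Fin d → ℤ, starRingEnd ℂ (anderson h w V (latticePt i + y) *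
      extension g (latticePt i + y)) * extension f (latticePt i + y)‖ₑ ≤
      ∑' p : ℕ × ℕ, ‖g‖ₑ * ‖f‖ₑ * (∫⁻ z, maxTerm R h w V c Λ Z p.1 p.2 y z.1 z.2 ^ 2
        ∂(ν.prod ν)) ^ (1 / 2 : ℝ) := by
    intro y
    refine (enorm_tsum_lattice_le w hsupp hAi hAi' hA hA' y).trans ?_
    calc _ ≤ ∫⁻ τ, ∫⁻ τ', ∑' p : ℕ × ℕ, ‖A τ‖ₑ * ‖A' τ'‖ₑ *
          maxTerm R h w V c Λ Z p.1 p.2 y τ τ' ∂ν ∂ν := by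
          refine lintegral_mono_ae ((ae_shiftMeasure_norm_lt R).mono fun τ hτ =>
            lintegral_mono_ae ((ae_shiftMeasure_norm_lt R).mono fun τ' hτ' => ?_))
          rw [ENNReal.tsum_mul_left, ENNReal.tsum_prod
            (f := fun k k' => maxTerm R h w V c Λ Z k k' y τ τ')]
          exact enorm_chainTerm_le w hsupp hZ _ _ y hτ hτ'
      _ = ∫⁻ z, ∑' p : ℕ × ℕ, ‖A z.1‖ₑ * ‖A' z.2‖ₑ *
          maxTerm R h w V c Λ Z p.1 p.2 y z.1 z.2 ∂(ν.prod ν) := by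
          rw [lintegral_prod]
          exact (Measurable.tsum fun p =>
            ((by fun_prop : Measurable fun z : Eu d × Eu d => ‖A z.1‖ₑ * ‖A' z.2‖ₑ)).mul
              (hmeasy p y)).aemeasurable
      _ = ∑' p : ℕ × ℕ, ∫⁻ z, ‖A z.1‖ₑ * ‖A' z.2‖ₑ *
          maxTerm R h w V c Λ Z p.1 p.2 y z.1 z.2 ∂(ν.prod ν) :=
          lintegral_tsum fun p =>
            ((by fun_prop : Measurable fun z : Eu d × Eu d => ‖A z.1‖ₑ * ‖A' z.2‖ₑ).mul
              (hmeasy p y)).aemeasurable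
      _ ≤ _ := ENNReal.tsum_le_tsum fun p =>
          lintegral_enorm_mul_enorm_mul_le hAm hAm' (hmeasy p y) hA2 hA2'
  calc _ ≤ ∫⁻ y in unitCell d, ∑' p : ℕ × ℕ, ‖g‖ₑ * ‖f‖ₑ *
        (∫⁻ z, maxTerm R h w V c Λ Z p.1 p.2 y z.1 z.2 ^ 2 ∂(ν.prod ν)) ^ (1 / 2 : ℝ) :=
        lintegral_mono hy
    _ = ‖g‖ₑ * ‖f‖ₑ * ∫⁻ y in unitCell d, ∑' p : ℕ × ℕ,
        (∫⁻ z, maxTerm R h w V c Λ Z p.1 p.2 y z.1 z.2 ^ 2 ∂(ν.prod ν)) ^ (1 / 2 : ℝ) := by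
        simp only [ENNReal.tsum_mul_left]
        rw [lintegral_const_mul' _ _ (ENNReal.mul_ne_top enorm_ne_top enorm_ne_top)]
    _ = _ := by
        rw [lintegral_tsum fun p => ?_, mul_comm]
        exact (((hmeas p).pow_const 2).lintegral_prod_right'.pow_const _).aemeasurable

/-- The potential enters only through its lattice samples, so a change on a null set affects the
maximum only for a null set of `y`. -/
theorem maxTerm_congr {R h : ℝ} (w : (Fin d → ℤ) → ℝ) {V V' : Eu d → ℂ} (c : Eu d)
    (Λ : Finset (Eu d)) (Z : ℕ → Finset (EuclideanSpace ℂ Λ)) (k k' : ℕ) {y : Eu d}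
    (hy : ∀ i : Fin d → ℤ, V (latticePt i + y) = V' (latticePt i + y)) (τ τ' : Eu d) :
    maxTerm R h w V c Λ Z k k' y τ τ' = maxTerm R h w V' c Λ Z k k' y τ τ' := by
  simp only [maxTerm, chainTerm, anderson, hy]

/-- The expected operator norm is bounded by the sum of the chain. -/
theorem lintegral_enorm_sandwich_le_tsum (hd : 1 ≤ d) {μ : Measure ℝ} [IsProbabilityMeasure μ]
    {R h : ℝ} (hR : 1 ≤ R) (hh : 0 < h) {V : Eu d → ℂ} {c : Eu d}
    (hV : MemLp V ⊤ volume) (hsupp : Function.support V ⊆ Metric.ball c R)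
    {Λ : Finset (Eu d)} (hΛ : IsSphereNet R Λ) {Z : ℕ → Finset (EuclideanSpace ℂ Λ)}
    (hZ : IsChain R Λ Z) :
    ∫⁻ ω, ‖sandwich (anderson h ω V)‖ₑ ∂(noise d μ) ≤ ∑' (k : ℕ) (k' : ℕ),
      ∫⁻ y in unitCell d, (∫⁻ τ, ∫⁻ τ', ∫⁻ ω, maxTerm R h ω V c Λ Z k k' y τ τ' ^ 2
        ∂(noise d μ) ∂(shiftMeasure d R) ∂(shiftMeasure d R)) ^ (1 / 2 : ℝ) := by
  set ν := shiftMeasure d R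
  -- A Borel representative, cut off so that its support lies in the ball everywhere and not merely
  -- almost everywhere.
  set V' : Eu d → ℂ := (Metric.ball c R).indicator (hV.1.mk V) with hV'def
  have hVm' : Measurable V' := hV.1.stronglyMeasurable_mk.measurable.indicator measurableSet_ball
  have hsupp' : Function.support V' ⊆ Metric.ball c R := Set.support_indicator_subset
  have hVV' : V =ᵐ[volume] V' := hV.1.ae_eq_mk.mono fun x hx => by
    by_cases h : x ∈ Metric.ball c R
    · rw [hV'def, Set.indicator_of_mem h, hx]
    · rw [hV'def, Set.indicator_of_notMem h, Function.notMem_support.1 fun h' => h (hsupp h')]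
  have hV' : MemLp V' ⊤ volume := hV.ae_eq hVV'
  have hsand : ∀ ω, sandwich (anderson h ω V) = sandwich (anderson h ω V') := fun ω =>
    sandwich_congr_ae (hVV'.mono fun x hx => by simp only [anderson, hx])
  have hmeas : ∀ p : ℕ × ℕ, Measurable fun q : (((Fin d → ℤ) → ℝ) × Eu d) × (Eu d × Eu d) =>
      maxTerm R h q.1.1 V' c Λ Z p.1 p.2 q.1.2 q.2.1 q.2.2 ^ 2 := fun p =>
    (measurable_maxTerm hVm' Λ Z p.1 p.2).pow_const 2
  have hmeas2 : ∀ p : ℕ × ℕ, Measurable fun q : ((Fin d → ℤ) → ℝ) × Eu d =>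
      ∫⁻ z, maxTerm R h q.1 V' c Λ Z p.1 p.2 q.2 z.1 z.2 ^ 2 ∂(ν.prod ν) := fun p =>
    (hmeas p).lintegral_prod_right'
  have hgood := ae_forall_lattice hVV'
  simp only [hsand]
  rw [← ENNReal.tsum_prod (f := fun k k' => ∫⁻ y in unitCell d, (∫⁻ τ, ∫⁻ τ', ∫⁻ ω,
    maxTerm R h ω V c Λ Z k k' y τ τ' ^ 2 ∂(noise d μ) ∂ν ∂ν) ^ (1 / 2 : ℝ))]
  calc _ ≤ ∫⁻ ω, (∑' p : ℕ × ℕ, ∫⁻ y in unitCell d,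
        (∫⁻ z, maxTerm R h ω V' c Λ Z p.1 p.2 y z.1 z.2 ^ 2 ∂(ν.prod ν)) ^ (1 / 2 : ℝ))
          ∂(noise d μ) :=
        lintegral_mono fun ω => enorm_sandwich_anderson_le hd hR hh ω hVm' hV' hsupp' hΛ hZ
    _ = ∑' p : ℕ × ℕ, ∫⁻ ω, (∫⁻ y in unitCell d,
        (∫⁻ z, maxTerm R h ω V' c Λ Z p.1 p.2 y z.1 z.2 ^ 2 ∂(ν.prod ν)) ^ (1 / 2 : ℝ))
          ∂(noise d μ) :=
        lintegral_tsum fun p => (((hmeas2 p).pow_const _).lintegral_prod_right').aemeasurable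
    _ ≤ _ := ENNReal.tsum_le_tsum fun p => ?_
  -- Once the expectation is inside the integral over `y`, Jensen's inequality moves it under the
  -- square root.
  rw [lintegral_lintegral_swap ((hmeas2 p).pow_const _).aemeasurable]
  refine lintegral_mono_ae (ae_restrict_of_ae (hgood.mono fun y hy => ?_))
  have hm1 : Measurable fun ω : (Fin d → ℤ) → ℝ =>
      ∫⁻ z, maxTerm R h ω V' c Λ Z p.1 p.2 y z.1 z.2 ^ 2 ∂(ν.prod ν) :=
    (hmeas2 p).comp (f := fun ω : (Fin d → ℤ) → ℝ => (ω, y)) (measurable_id.prodMk measurable_const)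
  refine (lintegral_le_lintegral_sq_rpow (hm1.pow_const _).aemeasurable).trans (le_of_eq ?_)
  congr 1
  have h1 : ∀ x : ENNReal, (x ^ (1 / 2 : ℝ)) ^ 2 = x := fun x => by
    rw [← ENNReal.rpow_natCast, ← ENNReal.rpow_mul]; norm_num
  simp only [h1]
  have hm2 : Measurable fun q : ((Fin d → ℤ) → ℝ) × (Eu d × Eu d) =>
      maxTerm R h q.1 V' c Λ Z p.1 p.2 y q.2.1 q.2.2 ^ 2 :=
    (hmeas p).comp (f := fun q : ((Fin d → ℤ) → ℝ) × (Eu d × Eu d) => ((q.1, y), q.2)) (by fun_prop)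
  rw [lintegral_lintegral_swap hm2.aemeasurable, lintegral_prod]
  · simp only [maxTerm_congr _ c Λ Z p.1 p.2 hy]
  · exact hm2.lintegral_prod_left'.aemeasurable

end OperatorBound

end RandomExtension

namespace RandomExtension

/-! ### Summation of a double series with two competing bounds. -/

section Summation

theorem tsum_geometric_ennreal (β : ENNReal) :
    ∑' (k : ℕ) (k' : ℕ), β * (2 : ENNReal)⁻¹ ^ (k + k') = 4 * β := by
  have h : ∑' k : ℕ, (2 : ENNReal)⁻¹ ^ k = 2 := by
    rw [ENNReal.tsum_geometric, ENNReal.one_sub_inv_two, inv_inv]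
  simp only [pow_add, ENNReal.tsum_mul_left, ENNReal.tsum_mul_right, h]
  rw [mul_comm, show (4 : ENNReal) = 2 * 2 by norm_num]

/-- A double series whose terms are bounded and decay geometrically. -/
theorem tsum_tsum_le_of_le_geometric {J : ℕ → ℕ → ENNReal} {a β : ENNReal} (N : ℕ)
    (h1 : ∀ k k', J k k' ≤ a) (h2 : ∀ k k', J k k' ≤ β * 2 ^ N * (2 : ENNReal)⁻¹ ^ (k + k')) :
    ∑' (k : ℕ) (k' : ℕ), J k k' ≤ N ^ 2 * a + 8 * β := by
  have hN : ∀ n : ℕ, β * 2 ^ N * (2 : ENNReal)⁻¹ ^ (n + N) = β * (2 : ENNReal)⁻¹ ^ n := by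
    intro n
    have h3 : (2 : ENNReal) ^ N * (2 : ENNReal)⁻¹ ^ N = 1 := by
      rw [← mul_pow, ENNReal.mul_inv_cancel (by norm_num) (by norm_num), one_pow]
    rw [pow_add, mul_assoc, mul_comm ((2 : ENNReal)⁻¹ ^ n), ← mul_assoc ((2 : ENNReal) ^ N), h3,
      one_mul]
  have hsplit : ∀ f : ℕ → ENNReal, ∑' k, f k = ∑ k ∈ Finset.range N, f k + ∑' k, f (k + N) :=
    fun f => (ENNReal.summable.sum_add_tsum_nat_add' (k := N)).symm
  rw [hsplit]
  -- The uniform bound is used on the square of indices below `N`. Wherever one index is at least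
  -- `N`, shifting it by `N` absorbs the factor `2 ^ N`.
  have hA : ∑ k ∈ Finset.range N, ∑' k', J k k' ≤ N ^ 2 * a + 4 * β := by
    simp only [fun k => hsplit (J k)]
    rw [Finset.sum_add_distrib]
    refine add_le_add ?_ ?_
    · calc _ ≤ ∑ _k ∈ Finset.range N, ∑ _k' ∈ Finset.range N, a :=
          Finset.sum_le_sum fun k _ => Finset.sum_le_sum fun k' _ => h1 k k'
        _ = _ := by
          rw [Finset.sum_const, Finset.sum_const, Finset.card_range, nsmul_eq_mul, nsmul_eq_mul]
          ring
    · refine (ENNReal.sum_le_tsum _).trans ?_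
      rw [← tsum_geometric_ennreal]
      refine ENNReal.tsum_le_tsum fun k => ENNReal.tsum_le_tsum fun k' => ?_
      rw [← hN, add_assoc]
      exact h2 _ _
  have hB : ∑' k, ∑' k', J (k + N) k' ≤ 4 * β := by
    rw [← tsum_geometric_ennreal]
    refine ENNReal.tsum_le_tsum fun k => ENNReal.tsum_le_tsum fun k' => ?_
    rw [← hN, add_right_comm]
    exact h2 _ _
  calc _ ≤ (N ^ 2 * a + 4 * β) + 4 * β := add_le_add hA hB
    _ = _ := by ring

end Summation

/-! ### The expected operator norm for potentials in a ball. -/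

section OperatorNormBound

variable {d : ℕ}

/-- The sum of the chain. -/
theorem exists_tsum_chain_le (hd : 1 ≤ d) {μ : Measure ℝ} [IsProbabilityMeasure μ]
    {K : NNReal} (hK : HasSubgaussianMGF id K μ) :
    ∃ C : ℝ, 1 ≤ C ∧ ∀ (R h : ℝ), 1 ≤ R → 0 < h → ∀ (c : Eu d) (V : Eu d → ℂ),
      MemLp V ⊤ volume → Function.support V ⊆ Metric.ball c R →
      ∀ Λ : Finset (Eu d), IsSphereNet R Λ →
      ∀ Z : ℕ → Finset (EuclideanSpace ℂ Λ), IsChain R Λ Z →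
      ∑' (k : ℕ) (k' : ℕ),
          ∫⁻ y in unitCell d, (∫⁻ τ, ∫⁻ τ', ∫⁻ ω, maxTerm R h ω V c Λ Z k k' y τ τ' ^ 2
            ∂(noise d μ) ∂(shiftMeasure d R) ∂(shiftMeasure d R)) ^ (1 / 2 : ℝ) ≤
        ENNReal.ofReal (C * (R ^ (1 / 2 : ℝ) * (2 + h) ^ ((d : ℝ) / 2) *
          (Real.log (2 + R)) ^ (5 / 2 : ℝ))) * eLpNorm V ⊤ volume := by
  obtain ⟨C, hC1, hC⟩ := exists_chaining_bounds hd hK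
  have hC0 : 0 ≤ C := by linarith
  refine ⟨C * ((2 * d + 1) ^ 2 + 8), ?_, ?_⟩
  · nlinarith [sq_nonneg (2 * (d : ℝ) + 1)]
  intro R h hR hh c V hV hsupp Λ hΛ Z hZ
  have hR0 : 0 < R := by linarith
  set L := Real.log (2 + R) with hL
  have hL1 : 1 ≤ L := one_le_log hR
  set B := eLpNorm V ⊤ volume with hB
  -- Chosen so that `R ^ d ≤ 2 ^ N`: beyond `N` the trivial decaying bound wins. Still `N` is at
  -- most a multiple of `log R`.
  set N : ℕ := ⌈d * L / Real.log 2⌉₊ with hN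
  have hlog2 : 1 / 2 < Real.log 2 := by linarith [Real.log_two_gt_d9]
  have hN1 : R ^ d ≤ 2 ^ N := by
    have h1 : (d : ℝ) * L ≤ N * Real.log 2 := by
      have := Nat.le_ceil (d * L / Real.log 2)
      rwa [div_le_iff₀ (by linarith)] at this
    calc R ^ d ≤ (2 + R) ^ d := by gcongr; linarith
      _ = Real.exp (d * L) := by
          rw [mul_comm, Real.exp_mul, hL, Real.exp_log (by linarith), Real.rpow_natCast]
      _ ≤ Real.exp (N * Real.log 2) := Real.exp_le_exp.2 h1
      _ = 2 ^ N := by rw [mul_comm, Real.exp_mul, Real.exp_log two_pos, Real.rpow_natCast]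
  have hN2 : (N : ℝ) ≤ (2 * d + 1) * L := by
    have h1 := (Nat.ceil_lt_add_one (a := d * L / Real.log 2) (by positivity)).le
    have h2 : d * L / Real.log 2 ≤ 2 * (d * L) := by
      rw [div_le_iff₀ (by linarith)]
      nlinarith [mul_nonneg (Nat.cast_nonneg (α := ℝ) d) (by linarith : 0 ≤ L)]
    rw [← hN] at h1
    linarith
  set H := (2 + h) ^ ((d : ℝ) / 2) with hH
  have hH1 : 1 ≤ H := Real.one_le_rpow (by linarith) (by positivity)
  have hRh : 1 ≤ R ^ (1 / 2 : ℝ) := Real.one_le_rpow hR (by norm_num)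
  have hLh : 1 ≤ L ^ (5 / 2 : ℝ) := Real.one_le_rpow hL1 (by norm_num)
  -- Two logarithms count the relevant pairs `(k, k')`; the half comes from the maximum over the
  -- links.
  have hLL : L ^ 2 * L ^ (1 / 2 : ℝ) = L ^ (5 / 2 : ℝ) := by
    rw [← Real.rpow_natCast, ← Real.rpow_add (by linarith)]; norm_num
  refine (tsum_tsum_le_of_le_geometric N (a := ENNReal.ofReal (C * (R ^ (1 / 2 : ℝ) *
    L ^ (1 / 2 : ℝ) * H)) * B) (β := ENNReal.ofReal C * B)
    (fun k k' => (hC R h hR hh c V hV hsupp Λ hΛ Z hZ k k').2.1) fun k k' => ?_).trans ?_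
  · refine ((hC R h hR hh c V hV hsupp Λ hΛ Z hZ k k').2.2.2).trans ?_
    have h1 : ENNReal.ofReal (C * (R ^ d * (2 : ℝ)⁻¹ ^ (k + k'))) ≤
        ENNReal.ofReal C * (2 ^ N * (2 : ENNReal)⁻¹ ^ (k + k')) := by
      rw [ENNReal.ofReal_mul hC0, ENNReal.ofReal_mul (by positivity),
        ENNReal.ofReal_pow (p := (2 : ℝ)⁻¹) (by norm_num), ENNReal.ofReal_inv_of_pos two_pos,
        ENNReal.ofReal_ofNat]
      refine mul_le_mul' le_rfl (mul_le_mul' ?_ le_rfl)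
      refine (ENNReal.ofReal_le_ofReal hN1).trans (le_of_eq ?_)
      rw [ENNReal.ofReal_pow two_pos.le, ENNReal.ofReal_ofNat]
    refine (mul_le_mul' h1 le_rfl).trans (le_of_eq ?_)
    ring
  · have h1 : (N : ENNReal) ^ 2 = ENNReal.ofReal ((N : ℝ) ^ 2) := by
      rw [ENNReal.ofReal_pow (by positivity), ENNReal.ofReal_natCast]
    have h2 : (8 : ENNReal) = ENNReal.ofReal 8 := (ENNReal.ofReal_ofNat 8).symm
    rw [h1, h2, ← mul_assoc, ← mul_assoc (ENNReal.ofReal 8), ← ENNReal.ofReal_mul (by positivity),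
      ← ENNReal.ofReal_mul (by norm_num), ← add_mul, ← ENNReal.ofReal_add (by positivity)
      (by positivity)]
    refine mul_le_mul' (ENNReal.ofReal_le_ofReal ?_) le_rfl
    have h3 : (1 : ℝ) ≤ R ^ (1 / 2 : ℝ) * H * L ^ (5 / 2 : ℝ) :=
      one_le_mul_of_one_le_of_one_le (one_le_mul_of_one_le_of_one_le hRh hH1) hLh
    calc (N : ℝ) ^ 2 * (C * (R ^ (1 / 2 : ℝ) * L ^ (1 / 2 : ℝ) * H)) + 8 * C
        ≤ ((2 * d + 1) * L) ^ 2 * (C * (R ^ (1 / 2 : ℝ) * L ^ (1 / 2 : ℝ) * H)) +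
          8 * C * (R ^ (1 / 2 : ℝ) * H * L ^ (5 / 2 : ℝ)) := by
          refine add_le_add ?_ (le_mul_of_one_le_right (by positivity) h3)
          gcongr
      _ = _ := by rw [← hLL]; ring

/-- The expected integral of the random potential. -/
theorem lintegral_lintegral_anderson_le {μ : Measure ℝ} [IsProbabilityMeasure μ] {R : ℝ} (h : ℝ)
    {V : Eu d → ℂ} {c : Eu d} (hV : MemLp V ⊤ volume)
    (hsupp : Function.support V ⊆ Metric.ball c R) :
    ∫⁻ ω, ∫⁻ x, ‖anderson h ω V x‖ₑ ∂volume ∂(noise d μ) ≤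
      (∫⁻ t, ‖t‖ₑ ∂μ) * volume (Metric.ball c R) * eLpNorm V ⊤ volume := by
  have hB : eLpNorm V ⊤ volume ≠ ⊤ := hV.eLpNorm_ne_top
  have hmeas : Measurable fun p : ((Fin d → ℤ) → ℝ) × Eu d => ‖p.1 (cell h p.2)‖ₑ := by
    have h1 : Measurable fun q : ((Fin d → ℤ) → ℝ) × (Fin d → ℤ) => q.1 q.2 :=
      measurable_from_prod_countable_left fun n => measurable_pi_apply n
    exact (h1.comp (measurable_fst.prodMk ((measurable_cell h).comp measurable_snd))).enorm
  have hle : ∀ ω : (Fin d → ℤ) → ℝ, ∫⁻ x, ‖anderson h ω V x‖ₑ ≤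
      (∫⁻ x in Metric.ball c R, ‖ω (cell h x)‖ₑ) * eLpNorm V ⊤ volume := by
    intro ω
    rw [← lintegral_mul_const' _ _ hB, ← lintegral_indicator measurableSet_ball]
    refine lintegral_mono_ae ((ae_le_eLpNormEssSup (f := V) (μ := volume)).mono fun x hx => ?_)
    rw [← eLpNorm_exponent_top] at hx
    by_cases hxb : x ∈ Metric.ball c R
    · rw [Set.indicator_of_mem hxb, anderson, enorm_mul]
      refine mul_le_mul' (le_of_eq ?_) hx
      rw [← ofReal_norm, ← ofReal_norm, Complex.norm_real]
    · rw [anderson, Function.notMem_support.1 fun h' => hxb (hsupp h'), mul_zero, enorm_zero]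
      exact zero_le
  calc _ ≤ ∫⁻ ω, (∫⁻ x in Metric.ball c R, ‖ω (cell h x)‖ₑ) * eLpNorm V ⊤ volume ∂(noise d μ) :=
        lintegral_mono hle
    _ = (∫⁻ x in Metric.ball c R, (∫⁻ ω, ‖ω (cell h x)‖ₑ ∂(noise d μ))) *
        eLpNorm V ⊤ volume := by
        rw [lintegral_mul_const' _ _ hB, lintegral_lintegral_swap hmeas.aemeasurable]
    _ = _ := by
        congr 1
        have h2 : ∀ x : Eu d, ∫⁻ ω, ‖ω (cell h x)‖ₑ ∂(noise d μ) = ∫⁻ t, ‖t‖ₑ ∂μ := fun x =>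
          lintegral_noise_eval (cell h x) measurable_enorm
        simp only [h2]
        rw [setLIntegral_const]

/-- The operator norm bound, for balls of any radius and cells of any size. -/
theorem exists_lintegral_enorm_sandwich_le (hd : 1 ≤ d) {μ : Measure ℝ} [IsProbabilityMeasure μ]
    {K : NNReal} (hK : HasSubgaussianMGF id K μ) :
    ∃ C : ℝ, 1 ≤ C ∧ ∀ (R h : ℝ), 0 < R → 0 < h → ∀ (c : Eu d) (V : Eu d → ℂ),
      MemLp V ⊤ volume → Function.support V ⊆ Metric.ball c R →
      ∫⁻ ω, ‖sandwich (anderson h ω V)‖ₑ ∂(noise d μ) ≤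
        ENNReal.ofReal (C * (R ^ (1 / 2 : ℝ) * (2 + h) ^ ((d : ℝ) / 2) *
          (Real.log (2 + R)) ^ (5 / 2 : ℝ))) * eLpNorm V ⊤ volume := by
  obtain ⟨C₁, hC₁1, hC₁⟩ := exists_tsum_chain_le hd hK
  obtain ⟨C₀, hC₀0, hC₀⟩ := exists_enorm_sandwich_le d
  have hfin : ∫⁻ t, ‖t‖ₑ ∂μ ≠ ⊤ := hK.integrable.2.ne
  set m := (∫⁻ t, ‖t‖ₑ ∂μ).toReal with hm
  have hm0 : 0 ≤ m := ENNReal.toReal_nonneg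
  set v := (volume : Measure (Eu d)).real (Metric.ball 0 1) with hv
  have hv0 : 0 ≤ v := measureReal_nonneg
  refine ⟨C₁ + 8 * (C₀ * m * v), by nlinarith [mul_nonneg (mul_nonneg hC₀0 hm0) hv0], ?_⟩
  intro R h hR0 hh c V hV hsupp
  have hH1 : 1 ≤ (2 + h) ^ ((d : ℝ) / 2) := Real.one_le_rpow (by linarith) (by positivity)
  have hlog0 : 0 < Real.log (2 + R) := Real.log_pos (by linarith)
  have hp : 0 ≤ C₀ * m * v := by positivity
  -- Nets are used only for `R ≥ 1`. For smaller `R` the trivial bound gives `R^d ≤ R^{1/2}`, and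
  -- the logarithm is bounded below because its argument exceeds `2`.
  rcases le_or_gt 1 R with hR | hR
  · obtain ⟨Λ, hΛ⟩ := exists_isSphereNet (d := d) hd hR
    obtain ⟨Z, hZ⟩ := exists_isChain hd hR hΛ
    refine (lintegral_enorm_sandwich_le_tsum hd hR hh hV hsupp hΛ hZ).trans
      ((hC₁ R h hR hh c V hV hsupp Λ hΛ Z hZ).trans ?_)
    refine mul_le_mul' (ENNReal.ofReal_le_ofReal ?_) le_rfl
    gcongr
    linarith
  · calc _ ≤ ∫⁻ ω, ENNReal.ofReal C₀ * ∫⁻ x, ‖anderson h ω V x‖ₑ ∂volume ∂(noise d μ) :=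
          lintegral_mono fun ω => hC₀ _
      _ = ENNReal.ofReal C₀ * ∫⁻ ω, ∫⁻ x, ‖anderson h ω V x‖ₑ ∂volume ∂(noise d μ) :=
          lintegral_const_mul' _ _ ENNReal.ofReal_ne_top
      _ ≤ ENNReal.ofReal C₀ * ((∫⁻ t, ‖t‖ₑ ∂μ) * volume (Metric.ball c R) *
          eLpNorm V ⊤ volume) :=
          mul_le_mul' le_rfl (lintegral_lintegral_anderson_le h hV hsupp)
      _ = ENNReal.ofReal (C₀ * m * v * R ^ d) * eLpNorm V ⊤ volume := by
          have h1 : volume (Metric.ball c R) = ENNReal.ofReal (R ^ d * v) := by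
            rw [hv, ← volume_real_ball hd c hR0.le, Measure.real,
              ENNReal.ofReal_toReal measure_ball_lt_top.ne]
          rw [h1, ← ENNReal.ofReal_toReal hfin, ← hm, ← ENNReal.ofReal_mul hm0, ← mul_assoc,
            ← ENNReal.ofReal_mul hC₀0]
          congr 2; ring
      _ ≤ _ := by
          refine mul_le_mul' (ENNReal.ofReal_le_ofReal ?_) le_rfl
          have h2 : R ^ d ≤ R ^ (1 / 2 : ℝ) := by
            rw [← Real.rpow_natCast]
            refine Real.rpow_le_rpow_of_exponent_ge hR0 hR.le ?_
            have : (1 : ℝ) ≤ d := by exact_mod_cast hd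
            linarith
          have h3 : 1 / 8 ≤ (Real.log (2 + R)) ^ (5 / 2 : ℝ) := by
            have hlog : 1 / 2 ≤ Real.log (2 + R) := by
              have h4 : Real.log 2 ≤ Real.log (2 + R) := Real.log_le_log two_pos (by linarith)
              linarith [Real.log_two_gt_d9]
            calc (1 / 8 : ℝ) = (1 / 2 : ℝ) ^ (3 : ℝ) := by norm_num
              _ ≤ (1 / 2 : ℝ) ^ (5 / 2 : ℝ) :=
                  Real.rpow_le_rpow_of_exponent_ge (by norm_num) (by norm_num) (by norm_num)
              _ ≤ _ := Real.rpow_le_rpow (by norm_num) hlog (by norm_num)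
          have hRp : 0 ≤ R ^ (1 / 2 : ℝ) := by positivity
          have h5 : R ^ (1 / 2 : ℝ) ≤ 8 * (R ^ (1 / 2 : ℝ) * (2 + h) ^ ((d : ℝ) / 2) *
              (Real.log (2 + R)) ^ (5 / 2 : ℝ)) := by
            have h6 : R ^ (1 / 2 : ℝ) * 1 * (1 / 8) ≤ R ^ (1 / 2 : ℝ) * (2 + h) ^ ((d : ℝ) / 2) *
              (Real.log (2 + R)) ^ (5 / 2 : ℝ) := by gcongr
            linarith
          calc C₀ * m * v * R ^ d ≤ C₀ * m * v * (8 * (R ^ (1 / 2 : ℝ) *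
                (2 + h) ^ ((d : ℝ) / 2) * (Real.log (2 + R)) ^ (5 / 2 : ℝ))) := by
                gcongr
                exact h2.trans h5
            _ = 8 * (C₀ * m * v) * (R ^ (1 / 2 : ℝ) *
                (2 + h) ^ ((d : ℝ) / 2) * (Real.log (2 + R)) ^ (5 / 2 : ℝ)) := by ring
            _ ≤ _ := by
                gcongr
                linarith

end OperatorNormBound

end RandomExtension

namespace RandomExtension

/-! ### Linear dependence of the operator on the potential. -/

section Linearity

variable {d : ℕ}

theorem integrable_conj_mul_extension {W : Eu d → ℂ} (hW : Integrable W) (f g : L2Sph d) :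
    Integrable fun x => starRingEnd ℂ (W x * extension g x) * extension f x := by
  have hH := integrable_mul_extension hW (integrable_L2Sph g)
  exact integrable_mul_extension (hH.congr' (Complex.continuous_conj.comp_aestronglyMeasurable hH.1)
    (Eventually.of_forall fun x => (RCLike.norm_conj _).symm)) (integrable_L2Sph f)

/-- Compared through quadratic forms. Integrability is essential, because `sandwich` takes the
default value `0` on other functions and is not additive there. -/
theorem sandwich_finsetSum {ι : Type*} (s : Finset ι) (a : ι → ℂ) {W : ι → Eu d → ℂ}
    (hW : ∀ i ∈ s, Integrable (W i)) :
    sandwich (fun x => ∑ i ∈ s, a i * W i x) = ∑ i ∈ s, a i • sandwich (W i) := by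
  have hsum : Integrable fun x => ∑ i ∈ s, a i * W i x :=
    integrable_finsetSum s fun i hi => (hW i hi).const_mul (a i)
  refine ContinuousLinearMap.ext fun g => ext_inner_right ℂ fun f => ?_
  rw [inner_sandwich hsum, sum_apply, sum_inner]
  have h1 : ∀ i ∈ s, inner ℂ ((a i • sandwich (W i)) g) f =
      ∫ x, starRingEnd ℂ (a i) * (starRingEnd ℂ (W i x * extension g x) * extension f x) := by
    intro i hi
    rw [smul_apply, inner_smul_left, inner_sandwich (hW i hi),
      integral_const_mul]
  rw [Finset.sum_congr rfl h1, ← integral_finsetSum s fun i hi =>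
    (integrable_conj_mul_extension (hW i hi) f g).const_mul _]
  refine integral_congr_ae (Eventually.of_forall fun x => ?_)
  simp only [Finset.sum_mul, map_sum, map_mul]
  exact Finset.sum_congr rfl fun i _ => by ring

/-- The random operator is a finite sum of deterministic operators. -/
theorem stronglyMeasurable_sandwich_anderson {R h : ℝ} (hh : 0 < h) {V : Eu d → ℂ} {c : Eu d}
    (hV : MemLp V ⊤ volume) (hsupp : Function.support V ⊆ Metric.ball c R) :
    StronglyMeasurable fun ω => sandwich (anderson h ω V) := by
  classical
  have hfin := finite_cell_image_ball hh c R
  have hVi : Integrable V := by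
    have h1 := integrable_anderson hh (fun _ => 1) hV hsupp
    refine h1.congr (Eventually.of_forall fun x => ?_)
    simp [anderson]
  have h1 : ∀ ω, sandwich (anderson h ω V) = ∑ n ∈ hfin.toFinset,
      ((ω n : ℝ) : ℂ) • sandwich ((cell h ⁻¹' {n}).indicator V) := by
    intro ω
    rw [← sandwich_finsetSum _ _ fun n _ =>
      hVi.indicator (measurable_cell h (measurableSet_singleton n))]
    congr 1
    ext x
    by_cases hx : x ∈ Metric.ball c R
    · rw [Finset.sum_eq_single (cell h x)]
      · rw [anderson, Set.indicator_of_mem (by rfl)]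
      · intro n _ hn
        rw [Set.indicator_of_notMem (fun h' => hn h'.symm), mul_zero]
      · intro hn
        exact absurd (hfin.mem_toFinset.2 ⟨x, hx, rfl⟩) hn
    · have h0 : V x = 0 := Function.notMem_support.1 fun h' => hx (hsupp h')
      rw [anderson, h0, mul_zero]
      refine (Finset.sum_eq_zero fun n _ => ?_).symm
      rw [Set.indicator_apply]
      split_ifs <;> simp [h0]
  simp only [h1]
  refine Finset.stronglyMeasurable_fun_sum _ fun n _ => StronglyMeasurable.smul_const ?_ _
  exact (Complex.measurable_ofReal.comp (measurable_pi_apply n)).stronglyMeasurable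

end Linearity

/-! ### Dyadic annuli. -/

section Annuli

variable {d : ℕ}

/-- The index of the dyadic annulus `2^n ≤ 2 + |x| < 2^(n+1)` that contains `x`. -/
noncomputable def annulusIndex (x : Eu d) : ℕ := Nat.log 2 ⌊2 + ‖x‖⌋₊

theorem measurable_annulusIndex : Measurable (annulusIndex : Eu d → ℕ) :=
  (measurable_of_countable (Nat.log 2)).comp (Nat.measurable_floor.comp (by fun_prop))

theorem two_pow_annulusIndex_le (x : Eu d) : 2 ^ annulusIndex x ≤ 2 + ‖x‖ := by
  have h0 : (0 : ℝ) ≤ 2 + ‖x‖ := by positivity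
  have h1 : ⌊2 + ‖x‖⌋₊ ≠ 0 := by
    rw [Ne, Nat.floor_eq_zero]
    linarith [norm_nonneg x]
  have h2 := Nat.pow_log_le_self 2 h1
  have h3 := Nat.floor_le h0
  calc ((2 : ℝ) ^ annulusIndex x) = ((2 ^ annulusIndex x : ℕ) : ℝ) := by push_cast; rfl
    _ ≤ (⌊2 + ‖x‖⌋₊ : ℝ) := by exact_mod_cast h2
    _ ≤ _ := h3

theorem lt_two_pow_annulusIndex (x : Eu d) : 2 + ‖x‖ < 2 ^ (annulusIndex x + 1) := by
  have h2 := Nat.lt_pow_succ_log_self (b := 2) one_lt_two ⌊2 + ‖x‖⌋₊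
  have h3 := Nat.lt_floor_add_one (2 + ‖x‖)
  calc 2 + ‖x‖ < ⌊2 + ‖x‖⌋₊ + 1 := h3
    _ ≤ ((2 ^ (annulusIndex x + 1) : ℕ) : ℝ) := by exact_mod_cast h2
    _ = _ := by push_cast; rfl

/-- The decay of the contribution of the annulus of index `n`. -/
noncomputable def annulusWeight (ε : ℝ) (n : ℕ) : ℝ := 2 * ((n : ℝ) + 2) ^ 3 * (((2 : ℝ) ^ ε)⁻¹) ^ n

theorem annulusWeight_nonneg (ε : ℝ) (n : ℕ) : 0 ≤ annulusWeight ε n := by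
  unfold annulusWeight; positivity

theorem summable_annulusWeight {ε : ℝ} (hε : 0 < ε) : Summable (annulusWeight ε) := by
  have h1 : 1 < (2 : ℝ) ^ ε := Real.one_lt_rpow one_lt_two hε
  set r := ((2 : ℝ) ^ ε)⁻¹ with hr
  have hr0 : 0 < r := by positivity
  have hr1 : r < 1 := inv_lt_one_of_one_lt₀ h1
  have h2 := summable_pow_mul_geometric_of_norm_lt_one 3
    (by rwa [Real.norm_of_nonneg hr0.le] : ‖r‖ < 1)
  have h3 := ((summable_nat_add_iff 2).2 h2).mul_left (2 * (r ^ 2)⁻¹)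
  refine h3.congr fun n => ?_
  rw [annulusWeight, ← hr, pow_add]
  push_cast
  field_simp

/-- The operator bound at radius `2^{n+1}` meets the decay of the potential: the powers `2^{n/2}`
cancel, leaving `2^{-εn}` against a power of `n` from the logarithm. -/
theorem annulus_scale_le {ε : ℝ} (n : ℕ) :
    ((2 : ℝ) ^ (n + 1)) ^ (1 / 2 : ℝ) * (Real.log (2 + 2 ^ (n + 1))) ^ (5 / 2 : ℝ) *
      (((2 : ℝ) ^ n) ^ (1 / 2 + ε))⁻¹ ≤ annulusWeight ε n := by
  have hlog : Real.log (2 + 2 ^ (n + 1)) ≤ n + 2 := by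
    have h1 : (2 : ℝ) + 2 ^ (n + 1) ≤ 2 ^ (n + 2) := by
      have : (1 : ℝ) ≤ 2 ^ n := one_le_pow₀ one_le_two
      rw [pow_succ, pow_add]; linarith
    calc Real.log (2 + 2 ^ (n + 1)) ≤ Real.log (2 ^ (n + 2)) := Real.log_le_log (by positivity) h1
      _ = (n + 2) * Real.log 2 := by rw [Real.log_pow]; push_cast; ring
      _ ≤ (n + 2) * 1 := by gcongr; linarith [Real.log_two_lt_d9]
      _ = _ := mul_one _
  have hlog0 : 0 ≤ Real.log (2 + 2 ^ (n + 1)) :=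
    Real.log_nonneg (by linarith [show (0 : ℝ) ≤ 2 ^ (n + 1) by positivity])
  have hL : (Real.log (2 + 2 ^ (n + 1))) ^ (5 / 2 : ℝ) ≤ ((n : ℝ) + 2) ^ 3 := by
    calc _ ≤ ((n : ℝ) + 2) ^ (5 / 2 : ℝ) := Real.rpow_le_rpow hlog0 hlog (by norm_num)
      _ ≤ ((n : ℝ) + 2) ^ (3 : ℝ) :=
          Real.rpow_le_rpow_of_exponent_le (by linarith [Nat.cast_nonneg (α := ℝ) n]) (by norm_num)
      _ = _ := by rw [← Real.rpow_natCast]; norm_num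
  have h2 : ((2 : ℝ) ^ (n + 1)) ^ (1 / 2 : ℝ) ≤ 2 * ((2 : ℝ) ^ n) ^ (1 / 2 : ℝ) := by
    rw [pow_succ, Real.mul_rpow (by positivity) two_pos.le, mul_comm]
    gcongr
    calc (2 : ℝ) ^ (1 / 2 : ℝ) ≤ 2 ^ (1 : ℝ) :=
          Real.rpow_le_rpow_of_exponent_le one_le_two (by norm_num)
      _ = 2 := Real.rpow_one 2
  have h3 : ((2 : ℝ) ^ n) ^ (1 / 2 + ε) = ((2 : ℝ) ^ n) ^ (1 / 2 : ℝ) * ((2 : ℝ) ^ ε) ^ n := by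
    rw [Real.rpow_add (by positivity)]
    congr 1
    rw [← Real.rpow_natCast 2 n, ← Real.rpow_natCast _ n, ← Real.rpow_mul two_pos.le,
      ← Real.rpow_mul two_pos.le, mul_comm]
  have h4 : 0 < ((2 : ℝ) ^ n) ^ (1 / 2 : ℝ) := by positivity
  calc _ ≤ (2 * ((2 : ℝ) ^ n) ^ (1 / 2 : ℝ)) * ((n : ℝ) + 2) ^ 3 *
        (((2 : ℝ) ^ n) ^ (1 / 2 : ℝ) * ((2 : ℝ) ^ ε) ^ n)⁻¹ := by rw [h3]; gcongr
    _ = _ := by rw [annulusWeight, inv_pow]; field_simp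

end Annuli

/-! ### The random operator of a decaying potential. -/

section DecayingPotential

variable {d : ℕ}

theorem aestronglyMeasurable_of_weighted {s : ℝ} {V : Eu d → ℂ}
    (hV : AEStronglyMeasurable (fun x => (((2 + ‖x‖) ^ s : ℝ) : ℂ) * V x) volume) :
    AEStronglyMeasurable V volume := by
  have h1 : Measurable fun x : Eu d => ((((2 + ‖x‖) ^ s)⁻¹ : ℝ) : ℂ) := by fun_prop
  refine (h1.aestronglyMeasurable.mul hV).congr (Eventually.of_forall fun x => ?_)
  have h2 : (((2 + ‖x‖) ^ s : ℝ) : ℂ) ≠ 0 := by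
    have : 0 < (2 + ‖x‖) ^ s := Real.rpow_pos_of_pos (by positivity) _
    exact_mod_cast this.ne'
  simp only [Pi.mul_apply, Complex.ofReal_inv]
  rw [inv_mul_cancel_left₀ h2]

theorem eLpNorm_indicator_annulus_le {ε : ℝ} (hε : 0 < ε) {V : Eu d → ℂ} (n : ℕ) {A : Set (Eu d)}
    (hA : A ⊆ annulusIndex ⁻¹' {n}) :
    eLpNorm (A.indicator V) ⊤ volume ≤ ENNReal.ofReal (((2 : ℝ) ^ n) ^ (1 / 2 + ε))⁻¹ *
      eLpNorm (fun x => (((2 + ‖x‖) ^ (1 / 2 + ε) : ℝ) : ℂ) * V x) ⊤ volume := by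
  rw [eLpNorm_exponent_top, eLpNorm_exponent_top]
  refine eLpNormEssSup_le_of_ae_enorm_bound ((ae_le_eLpNormEssSup
    (f := fun x : Eu d => (((2 + ‖x‖) ^ (1 / 2 + ε) : ℝ) : ℂ) * V x)).mono fun x hx => ?_)
  by_cases hxA : x ∈ A
  swap
  · rw [Set.indicator_of_notMem hxA, enorm_zero]; exact zero_le
  rw [Set.indicator_of_mem hxA]
  refine le_trans ?_ (mul_le_mul' le_rfl hx)
  have hidx : annulusIndex x = n := hA hxA
  have h1 : (2 : ℝ) ^ n ≤ 2 + ‖x‖ := by rw [← hidx]; exact two_pow_annulusIndex_le x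
  have h0 : 0 < ((2 : ℝ) ^ n) ^ (1 / 2 + ε) := by positivity
  have h2 : ((2 : ℝ) ^ n) ^ (1 / 2 + ε) ≤ (2 + ‖x‖) ^ (1 / 2 + ε) :=
    Real.rpow_le_rpow (by positivity) h1 (by linarith)
  rw [← ofReal_norm, ← ofReal_norm, ← ENNReal.ofReal_mul (by positivity), norm_mul,
    Complex.norm_real, Real.norm_of_nonneg (h0.le.trans h2)]
  refine ENNReal.ofReal_le_ofReal ?_
  rw [← mul_assoc]
  refine le_mul_of_one_le_left (norm_nonneg _) ?_
  rw [inv_mul_eq_div, one_le_div h0]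
  exact h2

theorem support_indicator_annulus_subset (V : Eu d → ℂ) (n : ℕ) {A : Set (Eu d)}
    (hA : A ⊆ annulusIndex ⁻¹' {n}) :
    Function.support (A.indicator V) ⊆ Metric.ball 0 ((2 : ℝ) ^ (n + 1)) := by
  refine Set.support_indicator_subset.trans fun x hx => ?_
  have hidx : annulusIndex x = n := hA hx
  have h1 := lt_two_pow_annulusIndex x
  rw [hidx] at h1
  rw [mem_ball_zero_iff]
  linarith

/-- The operator bound for pointwise decaying potentials. -/
theorem exists_operator_of_decay (hd : 1 ≤ d) {μ : Measure ℝ} [IsProbabilityMeasure μ]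
    {K : NNReal} (hK : HasSubgaussianMGF id K μ) {ε : ℝ} (hε : 0 < ε) :
    ∃ C : ℝ, 0 < C ∧ ∀ h : ℝ, 0 < h → ∀ V : Eu d → ℂ,
      MemLp (fun x => (((2 + ‖x‖) ^ (1 / 2 + ε) : ℝ) : ℂ) * V x) ⊤ volume →
      ∃ T : ((Fin d → ℤ) → ℝ) → (L2Sph d →L[ℂ] L2Sph d),
        AEStronglyMeasurable T (noise d μ) ∧
        Tendsto (fun r : ℝ => ∫⁻ ω, ‖sandwich
            ((Metric.ball (0 : Eu d) r).indicator (anderson h ω V)) - T ω‖ₑ ∂(noise d μ))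
          atTop (𝓝 0) ∧
        ∫⁻ ω, ‖T ω‖ₑ ∂(noise d μ) ≤
          ENNReal.ofReal (C * (2 + h) ^ ((d : ℝ) / 2)) *
            eLpNorm (fun x => (((2 + ‖x‖) ^ (1 / 2 + ε) : ℝ) : ℂ) * V x) ⊤ volume := by
  obtain ⟨C, hC1, hC⟩ := exists_lintegral_enorm_sandwich_le hd hK
  have hC0 : 0 ≤ C := by linarith
  have hsum := summable_annulusWeight hε
  have hS0 : 0 ≤ ∑' n, annulusWeight ε n := tsum_nonneg (annulusWeight_nonneg ε)
  refine ⟨C * ∑' n, annulusWeight ε n + 1, by positivity, ?_⟩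
  intro h hh V hV
  set M := eLpNorm (fun x : Eu d => (((2 + ‖x‖) ^ (1 / 2 + ε) : ℝ) : ℂ) * V x) ⊤ volume with hM
  have hMtop : M ≠ ⊤ := hV.eLpNorm_ne_top
  set H := (2 + h) ^ ((d : ℝ) / 2) with hH
  have hH0 : 0 ≤ H := by positivity
  have hVm : AEStronglyMeasurable V volume := aestronglyMeasurable_of_weighted hV.1
  have hidx : ∀ n, MeasurableSet (annulusIndex ⁻¹' {n} : Set (Eu d)) := fun n =>
    measurable_annulusIndex (measurableSet_singleton n)
  have hmem : ∀ n (A : Set (Eu d)), MeasurableSet A → A ⊆ annulusIndex ⁻¹' {n} →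
      MemLp (A.indicator V) ⊤ volume := fun n A hAm hA =>
    ⟨hVm.indicator hAm, (eLpNorm_indicator_annulus_le hε n hA).trans_lt
      (ENNReal.mul_lt_top ENNReal.ofReal_lt_top hV.2)⟩
  -- Arbitrary measurable parts of an annulus are allowed, so the bound also holds for annuli cut by
  -- a ball, uniformly in its radius.
  have hbound : ∀ n (A : Set (Eu d)), MeasurableSet A → A ⊆ annulusIndex ⁻¹' {n} →
      ∫⁻ ω, ‖sandwich (anderson h ω (A.indicator V))‖ₑ ∂(noise d μ) ≤
        ENNReal.ofReal (C * H * annulusWeight ε n) * M := by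
    intro n A hAm hA
    refine (hC (2 ^ (n + 1)) h (by positivity) hh 0 _ (hmem n A hAm hA)
      (support_indicator_annulus_subset V n hA)).trans ?_
    refine (mul_le_mul' le_rfl (eLpNorm_indicator_annulus_le hε n hA)).trans ?_
    rw [← mul_assoc]
    have hlog0 : 0 ≤ Real.log (2 + 2 ^ (n + 1)) :=
      Real.log_nonneg (by linarith [show (0 : ℝ) ≤ 2 ^ (n + 1) by positivity])
    rw [← ENNReal.ofReal_mul (by positivity)]
    refine mul_le_mul' (ENNReal.ofReal_le_ofReal ?_) le_rfl
    calc _ = C * H * (((2 : ℝ) ^ (n + 1)) ^ (1 / 2 : ℝ) *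
          (Real.log (2 + 2 ^ (n + 1))) ^ (5 / 2 : ℝ) * (((2 : ℝ) ^ n) ^ (1 / 2 + ε))⁻¹) := by ring
      _ ≤ _ := by
        refine mul_le_mul_of_nonneg_left (annulus_scale_le n) (by positivity)
  have hsm : ∀ n (A : Set (Eu d)), MeasurableSet A → A ⊆ annulusIndex ⁻¹' {n} →
      StronglyMeasurable fun ω => sandwich (anderson h ω (A.indicator V)) := fun n A hAm hA =>
    stronglyMeasurable_sandwich_anderson hh (hmem n A hAm hA)
      (support_indicator_annulus_subset V n hA)
  set a : ℕ → ENNReal := fun n => ENNReal.ofReal (C * H * annulusWeight ε n) * M with ha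
  have hatot : ∑' n, a n = ENNReal.ofReal (C * H * ∑' n, annulusWeight ε n) * M := by
    rw [ha, ENNReal.tsum_mul_right, ← tsum_mul_left, ENNReal.ofReal_tsum_of_nonneg
      (fun n => mul_nonneg (by positivity) (annulusWeight_nonneg ε n)) (hsum.mul_left _)]
  have hafin : ∑' n, a n ≠ ⊤ := by
    rw [hatot]; exact ENNReal.mul_ne_top ENNReal.ofReal_ne_top hMtop
  set S : ℕ → ((Fin d → ℤ) → ℝ) → (L2Sph d →L[ℂ] L2Sph d) := fun n ω =>
    sandwich (anderson h ω ((annulusIndex ⁻¹' {n}).indicator V)) with hS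
  have hSm : ∀ n, StronglyMeasurable (S n) := fun n => hsm n _ (hidx n) subset_rfl
  have hSb : ∀ n, ∫⁻ ω, ‖S n ω‖ₑ ∂(noise d μ) ≤ a n := fun n => hbound n _ (hidx n) subset_rfl
  have hSint : ∫⁻ ω, ∑' n, ‖S n ω‖ₑ ∂(noise d μ) ≤ ∑' n, a n := by
    rw [lintegral_tsum fun n => (hSm n).aestronglyMeasurable.enorm]
    exact ENNReal.tsum_le_tsum hSb
  have hSsum : ∀ᵐ ω ∂(noise d μ), Summable fun n => S n ω := by
    refine (ae_lt_top' (AEMeasurable.tsum fun n => (hSm n).aestronglyMeasurable.enorm)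
      (ne_top_of_le_ne_top hafin hSint)).mono fun ω hω => ?_
    exact (tsum_enorm_ne_top_iff_summable_nnnorm.1 hω.ne).of_nnnorm
  -- The limit is the sum over the annuli. It converges in norm almost surely; elsewhere the sum has
  -- its default value `0`, which is harmless.
  refine ⟨fun ω => ∑' n, S n ω, ?_, ?_, ?_⟩
  · refine aestronglyMeasurable_of_tendsto_ae atTop (f := fun N ω => ∑ n ∈ Finset.range N, S n ω)
      (fun N => (Finset.stronglyMeasurable_fun_sum _ fun n _ => hSm n).aestronglyMeasurable) ?_
    exact hSsum.mono fun ω hω => hω.hasSum.tendsto_sum_nat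
  · set D : ℝ → ℕ → Set (Eu d) := fun r n => annulusIndex ⁻¹' {n} ∩ Metric.ball 0 r with hD
    have hDm : ∀ r n, MeasurableSet (D r n) := fun r n => (hidx n).inter measurableSet_ball
    have hDs : ∀ r n, D r n ⊆ annulusIndex ⁻¹' {n} := fun r n => Set.inter_subset_left
    set S' : ℝ → ℕ → ((Fin d → ℤ) → ℝ) → (L2Sph d →L[ℂ] L2Sph d) := fun r n ω =>
      sandwich (anderson h ω ((D r n).indicator V)) with hS'
    have hzero : ∀ ω, sandwich (anderson h ω fun _ : Eu d => (0 : ℂ)) = 0 := by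
      intro ω
      have h1 := sandwich_finsetSum (d := d) (∅ : Finset ℕ) (fun _ => 0) (W := fun _ _ => 0)
        (by simp)
      simp only [Finset.sum_empty] at h1
      rw [← h1]
      congr 1
      ext x; simp [anderson]
    have hS'0 : ∀ r n ω, r ≤ 2 ^ n - 2 → S' r n ω = 0 := by
      intro r n ω hr
      have h1 : D r n = ∅ := by
        refine Set.eq_empty_of_forall_notMem fun x hx => ?_
        have h2 := two_pow_annulusIndex_le x
        rw [show annulusIndex x = n from hx.1] at h2
        have h3 := mem_ball_zero_iff.1 hx.2
        linarith
      simp only [hS', h1, Set.indicator_empty]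
      exact hzero ω
    have hS'S : ∀ r n ω, 2 ^ (n + 1) ≤ r → S' r n ω = S n ω := by
      intro r n ω hr
      have h1 : D r n = annulusIndex ⁻¹' {n} := by
        refine Set.inter_eq_left.2 fun x hx => ?_
        have h2 := lt_two_pow_annulusIndex x
        rw [show annulusIndex x = n from hx] at h2
        rw [mem_ball_zero_iff]
        linarith
      simp only [hS', hS, h1]
    -- A ball meets only finitely many annuli, so the truncated operator is a finite sum and
    -- linearity applies.
    have hsplit : ∀ r ω, ∃ N : ℕ, (∀ n ∉ Finset.range N, S' r n ω = 0) ∧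
        sandwich ((Metric.ball (0 : Eu d) r).indicator (anderson h ω V)) =
          ∑ n ∈ Finset.range N, S' r n ω := by
      intro r ω
      obtain ⟨N, hN⟩ := pow_unbounded_of_one_lt (r + 2) (one_lt_two (α := ℝ))
      have hlarge : ∀ n, N ≤ n → r ≤ 2 ^ n - 2 := fun n hn => by
        have : (2 : ℝ) ^ N ≤ 2 ^ n := pow_le_pow_right₀ one_le_two hn
        linarith
      refine ⟨N, fun n hn => hS'0 r n ω (hlarge n (by simpa using hn)), ?_⟩
      have h1 := sandwich_finsetSum (Finset.range N) (fun _ => (1 : ℂ))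
        (W := fun n => anderson h ω ((D r n).indicator V)) fun n _ =>
          integrable_anderson hh ω (hmem n _ (hDm r n) (hDs r n))
            (support_indicator_annulus_subset V n (hDs r n))
      simp only [one_smul, one_mul] at h1
      simp only [hS']
      rw [← h1]
      congr 1
      ext x
      by_cases hx : x ∈ Metric.ball (0 : Eu d) r
      · rw [Set.indicator_of_mem hx, Finset.sum_eq_single (annulusIndex x)]
        · have : x ∈ D r (annulusIndex x) := ⟨rfl, hx⟩
          simp only [anderson, Set.indicator_of_mem this]
        · intro n _ hn
          have : x ∉ D r n := fun h' => hn (Set.mem_singleton_iff.1 h'.1).symm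
          simp only [anderson, Set.indicator_of_notMem this, mul_zero]
        · intro hn
          have h2 := hlarge _ (by simpa using hn)
          have h3 := two_pow_annulusIndex_le x
          have h4 := mem_ball_zero_iff.1 hx
          linarith
      · rw [Set.indicator_of_notMem hx]
        refine (Finset.sum_eq_zero fun n _ => ?_).symm
        have : x ∉ D r n := fun h' => hx h'.2
        simp only [anderson, Set.indicator_of_notMem this, mul_zero]
    have hS'm : ∀ r n, StronglyMeasurable (S' r n) := fun r n => hsm n _ (hDm r n) (hDs r n)
    have hle : ∀ r, ∫⁻ ω, ‖sandwich ((Metric.ball (0 : Eu d) r).indicator (anderson h ω V)) -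
        ∑' n, S n ω‖ₑ ∂(noise d μ) ≤ ∑' n, ∫⁻ ω, ‖S' r n ω - S n ω‖ₑ ∂(noise d μ) := by
      intro r
      refine le_trans (lintegral_mono_ae (hSsum.mono fun ω hω => ?_)) (lintegral_tsum fun n =>
        ((hS'm r n).sub (hSm n)).aestronglyMeasurable.enorm).le
      simp only [Pi.sub_apply]
      obtain ⟨N, hN0, hN⟩ := hsplit r ω
      have hS'sum : HasSum (fun n => S' r n ω) (∑ n ∈ Finset.range N, S' r n ω) :=
        hasSum_sum_of_ne_finset_zero hN0
      rw [hN, ← hS'sum.tsum_eq, ← hS'sum.summable.tsum_sub hω]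
      exact enorm_tsum_le_tsum_enorm (f := fun n => S' r n ω - S n ω)
    have hterm : ∀ r n, ∫⁻ ω, ‖S' r n ω - S n ω‖ₑ ∂(noise d μ) ≤ 2 * a n := by
      intro r n
      calc _ ≤ ∫⁻ ω, ‖S' r n ω‖ₑ + ‖S n ω‖ₑ ∂(noise d μ) := lintegral_mono fun ω => enorm_sub_le
        _ = ∫⁻ ω, ‖S' r n ω‖ₑ ∂(noise d μ) + ∫⁻ ω, ‖S n ω‖ₑ ∂(noise d μ) :=
            lintegral_add_left' (hS'm r n).aestronglyMeasurable.enorm _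
        _ ≤ a n + a n := add_le_add (hbound n _ (hDm r n) (hDs r n)) (hSb n)
        _ = _ := (two_mul _).symm
    -- Dominated convergence by hand: annuli of index below `N` lie in the ball once `r ≥ 2^N` and
    -- contribute nothing to the difference; the others are bounded by the tail of a convergent
    -- series.
    have htail := ENNReal.tendsto_sum_nat_add (fun n => 2 * a n)
      (by rw [ENNReal.tsum_mul_left]; exact ENNReal.mul_ne_top (by norm_num) hafin)
    rw [ENNReal.tendsto_nhds_zero] at htail ⊢
    intro δ hδ
    obtain ⟨N, hN⟩ := (htail δ hδ).exists
    filter_upwards [eventually_ge_atTop ((2 : ℝ) ^ N)] with r hr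
    refine (hle r).trans ?_
    rw [← ENNReal.summable.sum_add_tsum_nat_add' (k := N), Finset.sum_eq_zero, zero_add]
    · exact (ENNReal.tsum_le_tsum fun n => hterm r (n + N)).trans hN
    · intro n hn
      have h1 : (2 : ℝ) ^ (n + 1) ≤ r :=
        (pow_le_pow_right₀ one_le_two (Finset.mem_range.1 hn)).trans hr
      have h2 : ∀ ω, ‖S' r n ω - S n ω‖ₑ = 0 := fun ω => by
        rw [hS'S r n ω h1, sub_self, ← ofReal_norm, norm_zero, ENNReal.ofReal_zero]
      simp only [h2, lintegral_zero]
  · calc _ ≤ ∫⁻ ω, ∑' n, ‖S n ω‖ₑ ∂(noise d μ) := lintegral_mono fun ω =>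
          enorm_tsum_le_tsum_enorm (f := fun n => S n ω)
      _ ≤ ∑' n, a n := hSint
      _ ≤ _ := by
        rw [hatot]
        refine mul_le_mul' (ENNReal.ofReal_le_ofReal ?_) le_rfl
        rw [mul_right_comm]
        gcongr
        linarith

end DecayingPotential

end RandomExtension

/-! ### Assembly of the theorem. -/

open RandomExtension in
theorem mainTheorem3 (d : ℕ) (hd : 1 ≤ d) :
    -- nets and chains of covers exist
    (∀ R : ℝ, 1 ≤ R → (∃ Λ : Finset (Eu d), IsSphereNet R Λ) ∧
      ∀ Λ : Finset (Eu d), IsSphereNet R Λ →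
        ∃ Z : ℕ → Finset (EuclideanSpace ℂ Λ), IsChain R Λ Z) ∧
    -- the deterministic bound, for each realization `w`
    (∃ C : ℝ, 0 < C ∧ ∀ (R h : ℝ), 1 ≤ R → 0 < h → h ≤ R →
      ∀ (c : Eu d) (V : Eu d → ℂ), MemLp V ⊤ volume →
      Function.support V ⊆ Metric.ball c R →
      ∀ Λ : Finset (Eu d), IsSphereNet R Λ →
      ∀ Z : ℕ → Finset (EuclideanSpace ℂ Λ), IsChain R Λ Z →
      ∀ (k k' : ℕ) (w : (Fin d → ℤ) → ℝ),
        ∫⁻ y in unitCell d, ∫⁻ τ, ∫⁻ τ', maxTerm R h w V c Λ Z k k' y τ τ'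
            ∂(shiftMeasure d R) ∂(shiftMeasure d R) ≤
          ENNReal.ofReal (C * (R * (2 : ℝ)⁻¹ ^ (k + k'))) * eLpNorm V ⊤ volume *
            ⨆ x ∈ Metric.ball c R, ‖w (cell h x)‖ₑ) ∧
    ∀ (μ : Measure ℝ) [IsProbabilityMeasure μ], IsNoiseLaw μ →
      (∃ C : ℝ, 0 < C ∧
        (∀ (R h : ℝ), 1 ≤ R → 0 < h → h ≤ R →
          ∀ (c : Eu d) (V : Eu d → ℂ), MemLp V ⊤ volume →
          Function.support V ⊆ Metric.ball c R →
          ∀ Λ : Finset (Eu d), IsSphereNet R Λ →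
          ∀ Z : ℕ → Finset (EuclideanSpace ℂ Λ), IsChain R Λ Z →
          -- the probabilistic bound, in integrated form
          (∀ k k' : ℕ,
            ENNReal.ofReal (R ^ (d - 1)) *
              ∫⁻ y in unitCell d, ∫⁻ τ, ∫⁻ τ', ∫⁻ ω, maxTerm R h ω V c Λ Z k k' y τ τ'
                ∂(noise d μ) ∂(shiftMeasure d R) ∂(shiftMeasure d R) ≤
            ENNReal.ofReal (C * (R ^ (1 / 2 : ℝ) * (Real.log (2 + R)) ^ (1 / 2 : ℝ) *
              (2 + h) ^ ((d : ℝ) / 2))) * eLpNorm V ⊤ volume) ∧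
          -- the probabilistic bound, in square integrated form
          (∀ k k' : ℕ,
            ∫⁻ y in unitCell d, (∫⁻ τ, ∫⁻ τ', ∫⁻ ω, maxTerm R h ω V c Λ Z k k' y τ τ' ^ 2
                ∂(noise d μ) ∂(shiftMeasure d R) ∂(shiftMeasure d R)) ^ (1 / 2 : ℝ) ≤
            ENNReal.ofReal (C * (R ^ (1 / 2 : ℝ) * (Real.log (2 + R)) ^ (1 / 2 : ℝ) *
              (2 + h) ^ ((d : ℝ) / 2))) * eLpNorm V ⊤ volume) ∧
          -- the bound with decay in `k + k'`, in expectation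
          (∀ k k' : ℕ,
            ∫⁻ y in unitCell d, ∫⁻ τ, ∫⁻ τ', ∫⁻ ω, maxTerm R h ω V c Λ Z k k' y τ τ'
                ∂(noise d μ) ∂(shiftMeasure d R) ∂(shiftMeasure d R) ≤
            ENNReal.ofReal (C * (R * (2 : ℝ)⁻¹ ^ (k + k'))) * eLpNorm V ⊤ volume) ∧
          -- the chaining bound for the operator, and the sum of the chain
          ∫⁻ ω, ‖sandwich (anderson h ω V)‖ₑ ∂(noise d μ) ≤
            ENNReal.ofReal C * ∑' (k : ℕ) (k' : ℕ),
              ∫⁻ y in unitCell d, (∫⁻ τ, ∫⁻ τ', ∫⁻ ω, maxTerm R h ω V c Λ Z k k' y τ τ' ^ 2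
                ∂(noise d μ) ∂(shiftMeasure d R) ∂(shiftMeasure d R)) ^ (1 / 2 : ℝ) ∧
          ∑' (k : ℕ) (k' : ℕ),
              ∫⁻ y in unitCell d, (∫⁻ τ, ∫⁻ τ', ∫⁻ ω, maxTerm R h ω V c Λ Z k k' y τ τ' ^ 2
                ∂(noise d μ) ∂(shiftMeasure d R) ∂(shiftMeasure d R)) ^ (1 / 2 : ℝ) ≤
            ENNReal.ofReal (C * (R ^ (1 / 2 : ℝ) * (2 + h) ^ ((d : ℝ) / 2) *
              (Real.log (2 + R)) ^ (5 / 2 : ℝ))) * eLpNorm V ⊤ volume) ∧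
        -- the operator bound for potentials supported in a ball
        (∀ (R h : ℝ), 0 < h → h ≤ R →
          ∀ (c : Eu d) (V : Eu d → ℂ), MemLp V ⊤ volume →
          Function.support V ⊆ Metric.ball c R →
          ∫⁻ ω, ‖sandwich (anderson h ω V)‖ₑ ∂(noise d μ) ≤
            ENNReal.ofReal (C * (R ^ (1 / 2 : ℝ) * (2 + h) ^ ((d : ℝ) / 2) *
              (Real.log (2 + R)) ^ (5 / 2 : ℝ))) * eLpNorm V ⊤ volume)) ∧
      -- the operator bound for pointwise decaying potentials
      ∀ ε : ℝ, 0 < ε → ∃ C : ℝ, 0 < C ∧ ∀ h : ℝ, 0 < h → ∀ V : Eu d → ℂ,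
        MemLp (fun x => (((2 + ‖x‖) ^ (1 / 2 + ε) : ℝ) : ℂ) * V x) ⊤ volume →
        ∃ T : ((Fin d → ℤ) → ℝ) → (L2Sph d →L[ℂ] L2Sph d),
          AEStronglyMeasurable T (noise d μ) ∧
          Tendsto (fun r : ℝ => ∫⁻ ω, ‖sandwich
              ((Metric.ball (0 : Eu d) r).indicator (anderson h ω V)) - T ω‖ₑ ∂(noise d μ))
            atTop (𝓝 0) ∧
          ∫⁻ ω, ‖T ω‖ₑ ∂(noise d μ) ≤
            ENNReal.ofReal (C * (2 + h) ^ ((d : ℝ) / 2)) *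
              eLpNorm (fun x => (((2 + ‖x‖) ^ (1 / 2 + ε) : ℝ) : ℂ) * V x) ⊤ volume := by
  refine ⟨fun R hR => ⟨exists_isSphereNet hd hR, fun Λ hΛ => exists_isChain hd hR hΛ⟩,
    exists_deterministic_bound hd, ?_⟩
  intro μ _ hμ
  obtain ⟨K, hK⟩ := hμ.exists_hasSubgaussianMGF
  refine ⟨?_, fun ε hε => exists_operator_of_decay hd hK hε⟩
  obtain ⟨C₁, hC₁1, hC₁⟩ := exists_chaining_bounds hd hK
  obtain ⟨C₂, hC₂1, hC₂⟩ := exists_tsum_chain_le hd hK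
  obtain ⟨C₃, hC₃1, hC₃⟩ := exists_lintegral_enorm_sandwich_le hd hK
  have hmono : ∀ {C C' X : ℝ} {B : ENNReal}, C ≤ C' → 0 ≤ X →
      ENNReal.ofReal (C * X) * B ≤ ENNReal.ofReal (C' * X) * B := fun h hX =>
    mul_le_mul' (ENNReal.ofReal_le_ofReal (mul_le_mul_of_nonneg_right h hX)) le_rfl
  refine ⟨C₁ + C₂ + C₃, by linarith, ?_, ?_⟩
  · intro R h hR hh _ c V hV hsupp Λ hΛ Z hZ
    have hlog0 : 0 ≤ Real.log (2 + R) := zero_le_one.trans (one_le_log hR)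
    have hR0 : 0 ≤ R := by linarith
    have hC := hC₁ R h hR hh c V hV hsupp Λ hΛ Z hZ
    refine ⟨fun k k' => (hC k k').1.trans (hmono (by linarith) (by positivity)),
      fun k k' => (hC k k').2.1.trans (hmono (by linarith) (by positivity)),
      fun k k' => (hC k k').2.2.1.trans (hmono (by linarith) (by positivity)), ?_,
      (hC₂ R h hR hh c V hV hsupp Λ hΛ Z hZ).trans (hmono (by linarith) (by positivity))⟩
    -- The chaining bound holds with constant one; the common constant is at least one.
    refine (lintegral_enorm_sandwich_le_tsum hd hR hh hV hsupp hΛ hZ).trans ?_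
    exact le_mul_of_one_le_left' (ENNReal.one_le_ofReal.2 (by linarith))
  · intro R h hh hhR c V hV hsupp
    have hR0 : 0 < R := hh.trans_le hhR
    have hlog0 : 0 ≤ Real.log (2 + R) := Real.log_nonneg (by linarith)
    exact (hC₃ R h hR0 hh c V hV hsupp).trans (hmono (by linarith) (by positivity))
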